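/- Let $F$ be a number field with ring of integers $\mathcal O_F$, let $\ell$ be a prime, and write $\eta:\operatorname{Spec}F\to\operatorname{Spec}\mathcal O_F$ for the generic point. **Framework.** Assume given a formalism of (rational) mixed motives over the separated schemes $S$ of finite type over $\operatorname{Spec}\mathcal O_F$ or $\operatorname{Spec}F$, that is: * closed symmetric monoidal triangulated $\mathbb Q$-linear categories $DM(S)$ with direct sums, with unit $\mathbf 1$, and functors $f^*\dashv f_*$ (with $f^*$ a monoidal triangulated functor, pseudofunctorial in $f$) and, for quasi-projective $f$, $f_!\dashv f^!$; the full subcategory $DM_{gm}(S)$ of compact objects (geometric motives) contains $\mathbf 1$ and is preserved by $f^*,f^!,f_!,\otimes,\underline{\mathrm{Hom}}$ and, for $f$ of finite type, by $f_*$; geometric motives over the bases $\mathfrak B$ below are reflexive ($M\cong M^{\vee\vee}$). Put $M_S(X)=f_*f^*\mathbf 1$ for $f:X\to S$. The object $\mathbf 1(-1)$ with $\mathbf 1(-1)[-2]=\ker(M(\mathbb P^1)\to M(S)\to M(\mathbb P^1))$ has a tensor inverse $\mathbf 1(1)$, and $M(n)=M\otimes\mathbf 1(1)^{\otimes n}$.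 The localization triangles, $f_!\to f_*$ (an isomorphism for projective $f$), relative and absolute purity, base change $f^*g_!\cong g'_!f'^*$, Verdier duality (which exchanges $!$ and $*$) and, for open $U\subseteq\operatorname{Spec}\mathcal O_F$, the distinguished triangles $\bigoplus_{\mathfrak p\in U}i_{\mathfrak p*}i_{\mathfrak p}^!M\to M\to\eta_*\eta^*M$ for geometric $M$ hold. * for $S$ in the class $\mathfrak B$ consisting of $\operatorname{Spec}F$, the closed points and the open subschemes of $\operatorname{Spec}\mathcal O_F$, a bounded $t$-structure on $DM_{gm}(S)$, with heart $MM(S)$ (mixed motives) and cohomology functors ${}^pH^i$, of cohomological dimension $0$ over closed points and $1$ over $F$; $\mathbf 1$ (over fields) and $\mathbf 1[1]$ (over open subschemes) are mixed; for open immersions $j$, closed points $i$ and $\eta$, the functors $j^*,j_*,j_!,i_*,\eta^*[-1]$ are exact, $i^*$ and $i^!$ have amplitude $[-1,0]$ and $[0,1]$, and Verdier duality is anti-exact; $M(X)\cong\bigoplus_n{}^pH^n(M(X))[-n]$ for $X/S$ smooth projective, over open subschemes compatibly with the fibres over closed points (up to the shift of degree by one). * functorial finite weight filtrations on mixed motives,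 for which all morphisms are strict; $\mathbf 1$ is pure of weight $0$, twisting a pure mixed motive by $(n)$ lowers its weight by $2n$; the functors $f_!f^*,i^*,j_!,j^*,\eta^*$ preserve weights $\le0$ and $f_*f^!,i^!,j_*,j^*,\eta^*$ preserve weights $\ge0$. * for $X$ smooth over $F$, natural isomorphisms $\operatorname{Hom}_{DM(X)}(\mathbf 1,\mathbf 1(n)[2n])\cong CH^n(X)_{\mathbb Q}$, and $\operatorname{Hom}_{DM(X)}(\mathbf 1,\mathbf 1(n)[k])=0$ for $k>2n$; a geometric $\ell$-adic realization on $DM_{gm}(\operatorname{Spec}F)$ that gives $H^*(X_{\overline F},\mathbb Q_\ell)$ on $M(X)$; and, for $X/F$ smooth projective, the image of $H^{2n}(\tau_{\le 2n-1}M(X)(n))\to H^{2n}(M(X)(n))=CH^n(X)_{\mathbb Q}$ is the kernel $CH^n(X)_{\mathbb Q,\hom}$ of the map to $H^{2n}(X_{\overline F},\mathbb Q_\ell(n))$ induced by the realization. **Notation.** $H^i(M)=\operatorname{Hom}_{DM(S)}(\mathbf 1,M[i])$, $H^i(X,n)=H^i(M_S(X)(n))$, $h^i(X,n)={}^pH^i(M_S(X)(n))$.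 For $X_\eta/F$ smooth projective, a projective model is a projective scheme $X/\mathcal O_F$ with $X\times_{\mathcal O_F}F=X_\eta$ (neither flat nor regular in general), and $$H^i(X_\eta,n)_{\mathcal O_F}:=\operatorname{im}\bigl(H^i(X,n)\to H^i(X_\eta,n)\bigr).$$ A motive $M$ over an open $U\subseteq\operatorname{Spec}\mathcal O_F$ is smooth if $i^!M\cong i^*M(-1)[-2]$ for every closed point $i$ of $U$. If $N\in DM_{gm}(F)$ and $M\in MM(\operatorname{Spec}\mathcal O_F)$ are such that $\eta^*M\cong N$ and $j^*M$ is smooth for some open immersion $j:U\to\operatorname{Spec}\mathcal O_F$ with $U\neq\emptyset$, then $\eta_{!*}N:=j_{!*}j^*M:=\operatorname{im}(j_!j^*M\to j_*j^*M)$, the image being taken in $MM(\operatorname{Spec}\mathcal O_F)$. **Theorem.** Let $X_\eta$ be smooth and projective over $F$, and let $i,n\in\mathbb Z$. Projective models of $X_\eta$ exist, and $h^{i-1}(X_\eta,n)[1]$ has a generic intermediate extension. For every choice of $M$, $U$ and $\eta^*M\cong h^{i-1}(X_\eta,n)[1]$ in its definition the following holds. 1. If $i\neq 2n$, then $H^i(X_\eta,n)_{\mathcal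 O_F}$ does not depend on the projective model. If $i<2n$, there is for every projective model a $\mathbb Q$-linear isomorphism $H^0(\eta_{!*}h^{i-1}(X_\eta,n)[1])\cong H^i(X_\eta,n)_{\mathcal O_F}$. 2. If $i=2n$, there is a $\mathbb Q$-linear isomorphism $H^0(\eta_{!*}h^{2n-1}(X_\eta,n)[1])\cong CH^n(X_\eta)_{\mathbb Q,\hom}$. 3. The restriction along $\eta$ is an isomorphism $H^{-1}(\eta_{!*}h^{i-1}(X_\eta,n)[1])\cong H^{-1}(h^{i-1}(X_\eta,n)[1])=H^0(h^{i-1}(X_\eta,n))$. The isomorphisms $\Phi$ in 1 and 2 are the natural ones: for every $x$ there is $w\in H^i(\tau_{\le i-1}M(X_\eta)(n))$ whose image in $H^i(({}^pH^{i-1}M(X_\eta)(n))[1-i])=H^0(h^{i-1}(X_\eta,n)[1])$ is the restriction of $x$ along $\eta$, and whose image in $H^i(X_\eta,n)$ is $\Phi(x)$ (in case 2 by means of $H^{2n}(X_\eta,n)=CH^n(X_\eta)_{\mathbb Q}$). -/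

import Mathlib

open CategoryTheory Limits AlgebraicGeometry MonoidalCategory Pretriangulated Triangulated
open scoped NumberField

universe v u

noncomputable section

set_option linter.checkUnivs false

/-- A `ℚ`-linear tensor triangulated category with small direct sums: a closed symmetric monoidal
structure for which tensoring with an object is a triangulated functor. -/
class TensorTriangulated (C : Type u) [Category.{v} C] where
  [preadditive : Preadditive C]
  [linear : Linear ℚ C]
  [hasZero : HasZeroObject C]
  [shift : HasShift C ℤ]
  [shiftAdditive : ∀ n : ℤ, (shiftFunctor C n).Additive]
  [shiftLinear : ∀ n : ℤ, (shiftFunctor C n).Linear ℚ]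
  [pretriangulated : Pretriangulated C]
  [triangulated : IsTriangulated C]
  [coproducts : HasCoproducts.{0} C]
  [monoidal : MonoidalCategory C]
  [symmetric : SymmetricCategory C]
  [closed : MonoidalClosed C]
  [tensorAdditive : MonoidalPreadditive C]
  [tensorLinear : MonoidalLinear ℚ C]
  [tensorShift : ∀ X : C, (tensorRight X).CommShift ℤ]
  [tensorShiftNatural : ∀ {X Y : C} (f : X ⟶ Y),
    NatTrans.CommShift ((curriedTensor C).flip.map f) ℤ]
  [tensorTriangulated : ∀ X : C, (tensorRight X).IsTriangulated]

attribute [reducible, instance] TensorTriangulated.preadditive TensorTriangulated.linear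
  TensorTriangulated.shift TensorTriangulated.pretriangulated TensorTriangulated.monoidal
  TensorTriangulated.symmetric TensorTriangulated.closed TensorTriangulated.tensorShift

attribute [instance] TensorTriangulated.hasZero TensorTriangulated.shiftAdditive
  TensorTriangulated.shiftLinear TensorTriangulated.triangulated TensorTriangulated.coproducts
  TensorTriangulated.tensorAdditive TensorTriangulated.tensorLinear
  TensorTriangulated.tensorShiftNatural TensorTriangulated.tensorTriangulated

section Compact
variable {C : Type u} [Category.{v} C] [Preadditive C] 
/-- `X` is compact if `Hom(X, -)` commutes with small direct sums, that is, if every map from `X`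
to a direct sum is a finite sum of maps to the summands. (Uniqueness of these maps is automatic in
a preadditive category, because the summands of a direct sum are retracts of it.) -/
def compactObjects (C : Type u) [Category.{v} C] [Preadditive C] : ObjectProperty C := fun X =>
  ∀ (J : Type) (A : J → C) (c : Cofan A) (_ : IsColimit c) (f : X ⟶ c.pt),
    ∃ (s : Finset J) (g : ∀ j, X ⟶ A j), f = ∑ j ∈ s, g j ≫ c.inj j

instance : (compactObjects C).IsClosedUnderIsomorphisms where
  of_iso e h J A c hc f := by
    obtain ⟨s, g, hg⟩ := h J A c hc (e.hom ≫ f)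
    refine ⟨s, fun j => e.inv ≫ g j, ?_⟩
    rw [← Iso.inv_hom_id_assoc e f, hg, Preadditive.comp_sum]
    simp

instance [HasZeroObject C] : (compactObjects C).ContainsZero where
  exists_zero := ⟨_, isZero_zero C, fun _ _ _ _ f => ⟨∅, fun _ => 0, by
    simpa using (isZero_zero C).eq_of_src _ _⟩⟩

variable [HasZeroObject C] [HasShift C ℤ] [∀ n : ℤ, (shiftFunctor C n).Additive] [Pretriangulated C]

instance : (compactObjects C).IsStableUnderShift ℤ where
  isStableUnderShiftBy n := ⟨fun X h J A c hc f => by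
    let e := (shiftEquiv C n)
    let c' : Cofan (fun j => (A j)⟦-n⟧) := Cofan.mk (c.pt⟦-n⟧) (fun j => (c.inj j)⟦-n⟧')
    have hc' : IsColimit c' := by
      exact (isColimitMapCoconeCofanMkEquiv (shiftFunctor C (-n)) A _ ).toFun (isColimitOfPreserves _ hc)
    have : e.functor.Additive := inferInstanceAs (shiftFunctor C n).Additive
    let a := e.toAdjunction.homAddEquiv X c.pt
    obtain ⟨s, g, hg⟩ := h J _ c' hc' (a f)
    refine ⟨s, fun j => (e.toAdjunction.homEquiv _ _).symm (g j), ?_⟩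
    refine ((a.symm_apply_apply f).symm.trans (congrArg a.symm hg)).trans ?_
    refine (map_sum a.symm _ _).trans ?_
    refine Finset.sum_congr rfl fun j _ => ?_
    exact e.toAdjunction.homEquiv_naturality_right_symm (g j) (c.inj j)⟩

instance : (compactObjects C).IsTriangulated where
  toIsTriangulatedClosed₂ := .mk' fun T hT h₁ h₃ J A c hc f => by
    obtain ⟨s, g, hg⟩ := h₁ J A c hc (T.mor₁ ≫ f)
    classical
    let p : ∀ j, c.pt ⟶ A j := fun j => Cofan.IsColimit.desc hc
      (fun k => if h : k = j then eqToHom (by rw [h]) else 0)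
    have hp : ∀ k j, c.inj k ≫ p j = if h : k = j then eqToHom (by rw [h]) else 0 :=
      fun k j => Cofan.IsColimit.fac hc _ k
    let q : c.pt ⟶ c.pt := 𝟙 _ - ∑ j ∈ s, p j ≫ c.inj j
    have hq : T.mor₁ ≫ f ≫ q = 0 := by
      rw [← Category.assoc, hg, Preadditive.sum_comp]
      refine Finset.sum_eq_zero fun j hj => ?_
      have : c.inj j ≫ q = 0 := by
        simp only [q, Preadditive.comp_sub, Category.comp_id, Preadditive.comp_sum]
        rw [Finset.sum_eq_single_of_mem j hj]
        · rw [← Category.assoc, hp]; simp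
        · intro k _ hk
          rw [← Category.assoc, hp, dif_neg (Ne.symm hk), zero_comp]
      rw [Category.assoc, this, comp_zero]
    obtain ⟨h, hh⟩ := Triangle.yoneda_exact₂ T hT (f ≫ q) hq
    obtain ⟨t, k, hk⟩ := h₃ J A c hc h
    have key : f = ∑ j ∈ s, (f ≫ p j) ≫ c.inj j + ∑ j ∈ t, (T.mor₂ ≫ k j) ≫ c.inj j := by
      have h1 : f ≫ q = ∑ j ∈ t, (T.mor₂ ≫ k j) ≫ c.inj j := by
        rw [hh, hk, Preadditive.comp_sum]; simp
      rw [← h1]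
      simp [q, Preadditive.comp_sum]
    refine ⟨s ∪ t, fun j => (if j ∈ s then f ≫ p j else 0) + (if j ∈ t then T.mor₂ ≫ k j else 0), ?_⟩
    simp only [Preadditive.add_comp, Finset.sum_add_distrib, ite_comp, zero_comp]
    refine key.trans (congrArg₂ (· + ·) ?_ ?_)
    · rw [Finset.sum_ite_mem, Finset.union_inter_cancel_left]
    · rw [Finset.sum_ite_mem, Finset.union_inter_cancel_right]
end Compact

section Schemes

/-- Projective space `ℙⁿ` over `ℤ`. -/
def projSpaceZ (n : ℕ) : Scheme.{0} :=
  letI := MvPolynomial.gradedAlgebra (σ := Fin (n + 1)) (R := ℤ)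
  Proj (MvPolynomial.homogeneousSubmodule (Fin (n + 1)) ℤ)

/-- Projective space `ℙⁿ` over `S`, with its projection to `S`. -/
def projSpace (n : ℕ) (S : Scheme.{0}) : Over S :=
  Over.mk (pullback.fst (terminal.from S) (terminal.from (projSpaceZ n)))

/-- A projective morphism: a closed immersion into some `ℙⁿ_Y`, followed by the projection. -/
def IsProjectiveHom {X Y : Scheme.{0}} (f : X ⟶ Y) : Prop :=
  ∃ (n : ℕ) (i : X ⟶ (projSpace n Y).left), IsClosedImmersion i ∧ i ≫ (projSpace n Y).hom = f

/-- A quasi-projective morphism: an immersion into some `ℙⁿ_Y`, followed by the projection. -/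
def IsQuasiProjectiveHom {X Y : Scheme.{0}} (f : X ⟶ Y) : Prop :=
  ∃ (n : ℕ) (i : X ⟶ (projSpace n Y).left), IsImmersion i ∧ i ≫ (projSpace n Y).hom = f

/-- A scheme all of whose local rings are regular. -/
def IsRegularScheme (X : Scheme.{0}) : Prop := ∀ x : X, IsRegularLocalRing (X.presheaf.stalk x)

/-- The closed immersion `i` has codimension `c` everywhere. -/
def HasCodim {Z X : Scheme.{0}} (i : Z ⟶ X) (c : ℕ) : Prop :=
  ∀ z : Z, ringKrullDim (X.presheaf.stalk (i z)) = ringKrullDim (Z.presheaf.stalk z) + c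

/-- Cycles of codimension `n` with rational coefficients; an irreducible closed subset is given by
its generic point, and the codimension of its closure is the coheight for specialization. -/
def cycles (X : Scheme.{0}) (n : ℤ) : Submodule ℚ (X →₀ ℚ) :=
  Finsupp.supported ℚ ℚ {x : X | ∃ m : ℕ, (m : ℤ) = n ∧ Order.coheight x = m}

/-- The cycles generated by the divisors of nonzero rational functions on integral closed
subschemes `W` of codimension `n - 1`. -/
def principalCycles (X : Scheme.{0}) (n : ℤ) : Submodule ℚ (X →₀ ℚ) :=
  Submodule.span ℚ {c | ∃ (W : Scheme.{0}) (_ : IsIntegral W) (_ : IsLocallyNoetherian W)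
    (i : W ⟶ X) (_ : IsClosedImmersion i) (f : W.functionField), f ≠ 0 ∧
    (∃ m : ℕ, (m : ℤ) + 1 = n ∧ Order.coheight (i (genericPoint W)) = m) ∧
    (∀ z : W, c (i z) = Scheme.ord f z) ∧ ∀ x ∉ Set.range i, c x = 0}

/-- The Chow group of cycles of codimension `n` modulo rational equivalence, tensored with `ℚ`. -/
abbrev Chow (X : Scheme.{0}) (n : ℤ) : Type :=
  cycles X n ⧸ (principalCycles X n).comap (cycles X n).subtype

variable (F : Type) [Field F]

/-- `Spec 𝓞 F`. -/
abbrev specO : Scheme.{0} := Spec (CommRingCat.of (𝓞 F))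

/-- The generic point `Spec F ⟶ Spec 𝓞 F`. -/
abbrev genericPt : Spec (CommRingCat.of F) ⟶ specO F :=
  Spec.map (CommRingCat.ofHom (algebraMap (𝓞 F) F))

/-- Separated schemes over `Spec 𝓞 F` of finite type over `Spec 𝓞 F` or over `Spec F`. -/
def arithmeticSchemes : ObjectProperty (Over (specO F)) := fun X =>
  IsSeparated X.hom ∧ QuasiCompact X.hom ∧ (LocallyOfFiniteType X.hom ∨
    ∃ g : X.left ⟶ Spec (CommRingCat.of F), g ≫ genericPt F = X.hom ∧ LocallyOfFiniteType g)

/-- The category of the schemes in `arithmeticSchemes`, with morphisms over `Spec 𝓞 F`. -/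
abbrev Sch := (arithmeticSchemes F).FullSubcategory

variable {F}

/-- The scheme underlying an object. -/
abbrev Sch.toScheme (X : Sch F) : Scheme.{0} := X.obj.left

/-- The morphism of schemes underlying a morphism. -/
abbrev Sch.mor {X Y : Sch F} (f : X ⟶ Y) : X.toScheme ⟶ Y.toScheme := f.hom.left

/-- A cartesian square of schemes. -/
abbrev Sch.Cartesian {P X Y Z : Sch F} (fst : P ⟶ X) (snd : P ⟶ Y) (f : X ⟶ Z) (g : Y ⟶ Z) :
    Prop :=
  IsPullback (Sch.mor fst) (Sch.mor snd) (Sch.mor f) (Sch.mor g)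

variable (F) [NumberField F]

/-- `Spec F`. -/
def Sch.gen : Sch F := ⟨Over.mk (genericPt F), by
  refine ⟨?_, ?_, Or.inr ⟨𝟙 _, ?_, ?_⟩⟩
  · dsimp; infer_instance
  · dsimp; infer_instance
  · simp
  · dsimp; infer_instance⟩

variable {F}

/-- An open subscheme of `Spec 𝓞 F`. -/
def Sch.op (U : (specO F).Opens) : Sch F := ⟨Over.mk U.ι, by
  refine ⟨?_, ?_, Or.inl ?_⟩ <;> dsimp <;> infer_instance⟩

/-- The closed point of `Spec 𝓞 F` belonging to a nonzero prime ideal, that is, the spectrum of the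
residue field. -/
def Sch.pt (p : IsDedekindDomain.HeightOneSpectrum (𝓞 F)) : Sch F :=
  ⟨Over.mk (Spec.map (CommRingCat.ofHom (Ideal.Quotient.mk p.asIdeal))), by
    have : IsClosedImmersion (Spec.map (CommRingCat.ofHom (Ideal.Quotient.mk p.asIdeal))) :=
      IsClosedImmersion.spec_of_surjective _ Ideal.Quotient.mk_surjective
    refine ⟨?_, ?_, Or.inl ?_⟩ <;> dsimp <;> infer_instance⟩

variable (F) in
/-- `Spec 𝓞 F` itself. -/
abbrev Sch.top : Sch F := Sch.op (⊤ : (specO F).Opens)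

/-- The structural morphism to `Spec 𝓞 F`. -/
def Sch.struct (X : Sch F) : X ⟶ Sch.top F :=
  ObjectProperty.homMk (Over.homMk (X.obj.hom ≫ (specO F).topIso.inv) (
    (Category.assoc _ _ _).trans ((congrArg (X.obj.hom ≫ ·) (specO F).topIso.inv_hom_id).trans
      (Category.comp_id _))))

lemma Sch.op_top_hom_ext {X : Sch F} (f g : X ⟶ Sch.top F) : f = g := by
  apply ObjectProperty.hom_ext
  apply Over.OverMorphism.ext
  exact (cancel_mono (⊤ : (specO F).Opens).ι).1 ((Over.w f.hom).trans (Over.w g.hom).symm)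

end Schemes

section EllAdic
variable (ℓ : ℕ) [Fact ℓ.Prime]

instance : IsGrothendieckAbelian.{1} (Sheaf Scheme.proetaleTopology.{0} Ab.{1}) := by
  have : EssentiallySmall.{1} Scheme.{0} := inferInstance
  exact Sheaf.isGrothendieckAbelian_of_essentiallySmall _ _

/-- The pro-étale sheaf of continuous functions with values in `ℚ_ℓ`. -/
def ellAdicSheaf : Sheaf Scheme.proetaleTopology.{0} Ab.{0} :=
  ⟨continuousMapPresheafAb ℚ_[ℓ], .of_le Scheme.proetaleTopology_le_fpqcTopology <|
    isSheaf_fpqcTopology_continuousMapPresheafAb _⟩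

/-- Pro-étale cohomology `Hⁱ(X, ℚ_ℓ)` as a functor on schemes: `Ext` groups from the sheaf freely
generated by `X` to the sheaf `ℚ_ℓ`. On schemes of finite type over an algebraically closed field
in which `ℓ` is invertible, this is `ℓ`-adic cohomology. -/
def ellAdicCohomology (i : ℕ) : Scheme.{0}ᵒᵖ ⥤ Ab.{1} :=
  ((uliftYoneda.{1} ⋙ (Functor.whiskeringRight _ _ _).obj AddCommGrpCat.free ⋙
    presheafToSheaf Scheme.proetaleTopology.{0} Ab.{1}).op ⋙ Abelian.extFunctor i).flip.obj
    ((sheafCompose _ AddCommGrpCat.uliftFunctor.{1}).obj (ellAdicSheaf ℓ))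

/-- The geometric fibre `X ↦ X ×_F F̄` of schemes over `F`. -/
def geometricFibre (F : Type) [Field F] : Over (Spec (CommRingCat.of F)) ⥤ Scheme.{0} :=
  Over.pullback (Spec.map (CommRingCat.ofHom (algebraMap F (AlgebraicClosure F)))) ⋙ Over.forget _

end EllAdic

section Motives
open Functor.LaxMonoidal Functor.OplaxMonoidal

/-- Tensor triangulated categories `DM(S)` with the adjoint functors `f^* ⊣ f_*`, functorial in the
sense that `f ↦ f^*` is a pseudofunctor compatible with tensor products and shifts. -/
structure InverseImages (F : Type) [Field F] [NumberField F] where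
  DM : Sch F → Type u
  [category : ∀ S, Category.{v} (DM S)]
  [tensorTriangulated : ∀ S, TensorTriangulated (DM S)]
  pull {X Y : Sch F} (f : X ⟶ Y) : DM Y ⥤ DM X
  push {X Y : Sch F} (f : X ⟶ Y) : DM X ⥤ DM Y
  adj {X Y : Sch F} (f : X ⟶ Y) : pull f ⊣ push f
  [pullMonoidal : ∀ {X Y : Sch F} (f : X ⟶ Y), (pull f).Monoidal]
  [pullShift : ∀ {X Y : Sch F} (f : X ⟶ Y), (pull f).CommShift ℤ]
  [pullTriangulated : ∀ {X Y : Sch F} (f : X ⟶ Y), (pull f).IsTriangulated]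
  pullId (X : Sch F) : pull (𝟙 X) ≅ 𝟭 (DM X)
  pullComp {X Y Z : Sch F} {f : X ⟶ Y} {g : Y ⟶ Z} {h : X ⟶ Z} (w : f ≫ g = h) :
    pull g ⋙ pull f ≅ pull h
  pullComp_monoidal {X Y Z : Sch F} {f : X ⟶ Y} {g : Y ⟶ Z} {h : X ⟶ Z} (w : f ≫ g = h) :
    NatTrans.IsMonoidal (pullComp w).hom
  pullComp_shift {X Y Z : Sch F} {f : X ⟶ Y} {g : Y ⟶ Z} {h : X ⟶ Z} (w : f ≫ g = h) :
    NatTrans.CommShift (pullComp w).hom ℤ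
  id_pullComp {X Y : Sch F} (f : X ⟶ Y) (M : DM Y) :
    (pullComp (Category.id_comp f)).hom.app M = (pullId X).hom.app ((pull f).obj M)
  pullComp_id {X Y : Sch F} (f : X ⟶ Y) (M : DM Y) :
    (pullComp (Category.comp_id f)).hom.app M = (pull f).map ((pullId Y).hom.app M)
  pullComp_assoc {X Y Z W : Sch F} {f : X ⟶ Y} {g : Y ⟶ Z} {h : Z ⟶ W} {fg : X ⟶ Z}
    {gh : Y ⟶ W} {k : X ⟶ W} (w₁ : f ≫ g = fg) (w₂ : g ≫ h = gh) (w₃ : fg ≫ h = k)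
    (w₄ : f ≫ gh = k) (M : DM W) :
    (pull f).map ((pullComp w₂).hom.app M) ≫ (pullComp w₄).hom.app M =
      (pullComp w₁).hom.app ((pull h).obj M) ≫ (pullComp w₃).hom.app M

attribute [instance] InverseImages.category InverseImages.tensorTriangulated
  InverseImages.pullMonoidal InverseImages.pullShift
attribute [instance] InverseImages.pullTriangulated

namespace InverseImages
variable {F : Type} [Field F] [NumberField F] (D : InverseImages.{v, u} F)

/-- The category of geometric motives: the compact objects. -/
abbrev Gm (S : Sch F) := (compactObjects (D.DM S)).FullSubcategory

/-- `H^k(M) = Hom(1, M[k])`. -/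
abbrev H {S : Sch F} (M : D.DM S) (k : ℤ) := 𝟙_ (D.DM S) ⟶ M⟦k⟧

/-- The map `H^k(M) → H^k(N)` induced by `f^*` and a map `f^* M → N`. -/
def pullH {X Y : Sch F} (f : X ⟶ Y) {M : D.DM Y} {N : D.DM X} (φ : (D.pull f).obj M ⟶ N)
    (k : ℤ) : D.H M k →ₗ[ℚ] D.H N k :=
  Linear.leftComp ℚ _ (ε (D.pull f)) ∘ₗ
    Linear.rightComp ℚ _ (((D.pull f).commShiftIso k).hom.app M ≫ φ⟦k⟧') ∘ₗ
      (D.pull f).mapLinearMap ℚ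

/-- The exchange map `f^* g_* → g'_* f'^*` of a commutative square. -/
def exchange {P X Y S : Sch F} {f' : P ⟶ X} {g' : P ⟶ Y} {g : X ⟶ S} {f : Y ⟶ S}
    (w : f' ≫ g = g' ≫ f) (M : D.DM X) :
    (D.pull f).obj ((D.push g).obj M) ⟶ (D.push g').obj ((D.pull f').obj M) :=
  (D.adj g').homEquiv _ _ ((D.pullComp rfl).hom.app _ ≫ (D.pullComp w).inv.app _ ≫
    (D.pull f').map ((D.adj g).counit.app M))

/-- The motive `M_S(X) = f_* f^* 1` of `f : X ⟶ S`. -/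
abbrev mot {X S : Sch F} (f : X ⟶ S) : D.DM S := (D.push f).obj ((D.pull f).obj (𝟙_ (D.DM S)))

/-- The map `M_S(Y) → M_S(X)` induced by a morphism `a : X ⟶ Y` over `S`. -/
def motMap {X Y S : Sch F} {f : X ⟶ S} {g : Y ⟶ S} {a : X ⟶ Y} (w : a ≫ g = f) :
    D.mot g ⟶ D.mot f :=
  (D.adj f).homEquiv _ _ ((D.pullComp w).inv.app _ ≫
    (D.pull a).map ((D.adj g).counit.app _) ≫ (D.pullComp w).hom.app _)

/-- The base change map `s^* M_S(X) → M_{S'}(X')` of a commutative square with right-hand side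
`f : X ⟶ S` and left-hand side `f' : X' ⟶ S'`. -/
def motBaseChange {X X' S S' : Sch F} {f : X ⟶ S} {f' : X' ⟶ S'} {a : X' ⟶ X} {s : S' ⟶ S}
    (w : a ≫ f = f' ≫ s) : (D.pull s).obj (D.mot f) ⟶ D.mot f' :=
  D.exchange w _ ≫ (D.push f').map ((D.pullComp w).hom.app _ ≫ (D.pullComp rfl).inv.app _ ≫
    (D.pull f').map (η (D.pull s)))

end InverseImages

/-- Tensor powers. -/
def tensorPower {C : Type u} [Category.{v} C] [MonoidalCategory C] (X : C) : ℕ → C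
  | 0 => 𝟙_ C
  | n + 1 => tensorPower X n ⊗ X

/-- Inverse images together with objects `1(-1)` and `1(1)` over `Spec 𝓞 F`. -/
structure TateMotives (F : Type) [Field F] [NumberField F] extends InverseImages.{v, u} F where
  tateNeg : DM (Sch.top F)
  tatePos : DM (Sch.top F)

namespace TateMotives
variable {F : Type} [Field F] [NumberField F] (D : TateMotives.{v, u} F)

/-- `1(n)` over `Spec 𝓞 F`. -/
def tateTop : ℤ → D.DM (Sch.top F)
  | Int.ofNat n => tensorPower D.tatePos n
  | Int.negSucc n => tensorPower D.tateNeg (n + 1)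

/-- `1(n)` over any base. -/
def tate (S : Sch F) (n : ℤ) : D.DM S := (D.pull S.struct).obj (D.tateTop n)

/-- The functor `M ↦ M(n)`. -/
abbrev twist (S : Sch F) (n : ℤ) : D.DM S ⥤ D.DM S := tensorRight (D.tate S n)

/-- `f^* 1(n) ≅ 1(n)`. -/
def pullTate {X Y : Sch F} (f : X ⟶ Y) (n : ℤ) : (D.pull f).obj (D.tate Y n) ≅ D.tate X n :=
  (D.pullComp (Sch.op_top_hom_ext _ _)).app (D.tateTop n)

/-- `f^* (M(n)) ≅ (f^* M)(n)`. -/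
def pullTwist {X Y : Sch F} (f : X ⟶ Y) (n : ℤ) (M : D.DM Y) :
    (D.pull f).obj ((D.twist Y n).obj M) ≅ (D.twist X n).obj ((D.pull f).obj M) :=
  (Functor.Monoidal.μIso (D.pull f) _ _).symm ≪≫ whiskerLeftIso _ (D.pullTate f n)

end TateMotives

section Schemes
variable {F : Type} [Field F] [NumberField F]

/-- The bases over which mixed motives are considered: `Spec F`, the open subschemes of `Spec 𝓞 F`,
and the closed points of `Spec 𝓞 F`. -/
inductive IsArithmeticBase : Sch F → Prop
  | gen : IsArithmeticBase (Sch.gen F)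
  | op (U : (specO F).Opens) : IsArithmeticBase (Sch.op U)
  | pt (p : IsDedekindDomain.HeightOneSpectrum (𝓞 F)) : IsArithmeticBase (Sch.pt p)

/-- `i` is a closed immersion and `j` is an open immersion onto the complement of its image. -/
def IsOpenComplement {V Z X : Sch F} (j : V ⟶ X) (i : Z ⟶ X) : Prop :=
  IsOpenImmersion (Sch.mor j) ∧ IsClosedImmersion (Sch.mor i) ∧
    Set.range (Sch.mor j) = (Set.range (Sch.mor i))ᶜ

end Schemes

/-- Adding the functors with compact support and the exceptional inverse images `f_! ⊣ f^!`.
The functors `f_! = shriek f` and `f^! = upper f` are only meaningful for quasi-projective `f`; for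
any other `f` they are irrelevant (they may be taken to be zero). -/
structure ExceptionalImages (F : Type) [Field F] [NumberField F] extends
    TateMotives.{v, u} F where
  shriek {X Y : Sch F} (f : X ⟶ Y) : DM X ⥤ DM Y
  upper {X Y : Sch F} (f : X ⟶ Y) : DM Y ⥤ DM X
  shriekAdj {X Y : Sch F} (f : X ⟶ Y) : shriek f ⊣ upper f
  [shriekShift : ∀ {X Y : Sch F} (f : X ⟶ Y), (shriek f).CommShift ℤ]
  [shriekTriangulated : ∀ {X Y : Sch F} (f : X ⟶ Y), (shriek f).IsTriangulated]
  shriekComp {X Y Z : Sch F} {f : X ⟶ Y} {g : Y ⟶ Z} {h : X ⟶ Z} (w : f ≫ g = h)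
    (hf : IsQuasiProjectiveHom (Sch.mor f)) (hg : IsQuasiProjectiveHom (Sch.mor g)) :
    shriek f ⋙ shriek g ≅ shriek h
  /-- The map `f_! → f_*`. -/
  forget {X Y : Sch F} (f : X ⟶ Y) : shriek f ⟶ push f

attribute [instance] ExceptionalImages.shriekShift ExceptionalImages.shriekTriangulated

/-- The Verdier dual `Hom(M, b^! 1(1)[2])` on a quasi-projective scheme `b : X ⟶ U` over an open
subscheme `U` of `Spec 𝓞 F`. -/
def ExceptionalImages.verdierDual {F : Type} [Field F] [NumberField F]
    (D : ExceptionalImages.{v, u} F) {U : (specO F).Opens} {X : Sch F} (b : X ⟶ Sch.op U)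
    (M : D.DM X) : D.DM X :=
  (ihom M).obj ((D.upper b).obj ((D.tate (Sch.op U) 1)⟦(2 : ℤ)⟧))

/-- A formalism of triangulated motives over the schemes of finite type over `Spec 𝓞 F` or
`Spec F`. -/
structure TriangulatedMotives (F : Type) [Field F] [NumberField F] extends
    ExceptionalImages.{v, u} F where
  -- compact objects
  unit_compact (S : Sch F) : compactObjects (DM S) (𝟙_ (DM S))
  pull_compact {X Y : Sch F} (f : X ⟶ Y) (M : DM Y) (hM : compactObjects _ M) :
    compactObjects _ ((pull f).obj M)
  upper_compact {X Y : Sch F} (f : X ⟶ Y) (hf : IsQuasiProjectiveHom (Sch.mor f)) (M : DM Y)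
    (hM : compactObjects _ M) : compactObjects _ ((upper f).obj M)
  push_compact {X Y : Sch F} (f : X ⟶ Y) (hf : LocallyOfFiniteType (Sch.mor f)) (M : DM X)
    (hM : compactObjects _ M) : compactObjects _ ((push f).obj M)
  shriek_compact {X Y : Sch F} (f : X ⟶ Y) (hf : IsQuasiProjectiveHom (Sch.mor f)) (M : DM X)
    (hM : compactObjects _ M) : compactObjects _ ((shriek f).obj M)
  tensor_compact {S : Sch F} (M N : DM S) (hM : compactObjects _ M) (hN : compactObjects _ N) :
    compactObjects _ (M ⊗ N)
  ihom_compact {S : Sch F} (M N : DM S) (hM : compactObjects _ M) (hN : compactObjects _ N) :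
    compactObjects _ ((ihom M).obj N)
  /-- The canonical map from a compact object to its double dual is an isomorphism (over the
  spectra of the fields in question and over the open subschemes of `Spec 𝓞 F`). -/
  biduality {S : Sch F} (hS : IsArithmeticBase S) (M : DM S) (hM : compactObjects _ M) :
    IsIso (MonoidalClosed.curry ((β_ ((ihom M).obj (𝟙_ (DM S))) M).hom ≫
      (ihom.ev M).app (𝟙_ (DM S))))
  -- Tate objects
  /-- `1(-1)[-2]` is the kernel of `M(ℙ¹) → M(S) → M(ℙ¹)`, defined by a rational point. -/
  tateNeg_kernel {P : Sch F} (π : P ⟶ Sch.top F) (s : Sch.top F ⟶ P) (hs : s ≫ π = 𝟙 _)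
    (e : P.toScheme ≅ (projSpace 1 (Sch.top F).toScheme).left)
    (he : e.hom ≫ (projSpace 1 (Sch.top F).toScheme).hom = Sch.mor π) :
    ∃ (a : tateNeg⟦(-2 : ℤ)⟧ ⟶ toInverseImages.mot π)
      (w : a ≫ toInverseImages.motMap hs ≫ toInverseImages.motMap (Category.comp_id π) = 0),
      Nonempty (IsLimit (KernelFork.ofι a w))
  tate_inverse : Nonempty (tateNeg ⊗ tatePos ≅ 𝟙_ (DM (Sch.top F)))
  tateNeg_compact : compactObjects _ tateNeg
  tatePos_compact : compactObjects _ tatePos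
  -- localization
  /-- For an open immersion, `j^! = j^*`. -/
  openIso {V X : Sch F} (j : V ⟶ X) (hj : IsOpenImmersion (Sch.mor j)) : pull j ≅ upper j
  open_counit {V X : Sch F} (j : V ⟶ X) (hj : IsOpenImmersion (Sch.mor j)) :
    IsIso (adj j).counit
  closed_counit {Z X : Sch F} (i : Z ⟶ X) (hi : IsClosedImmersion (Sch.mor i)) :
    IsIso (adj i).counit
  open_closed_zero {V Z X : Sch F} (j : V ⟶ X) (i : Z ⟶ X) (h : IsOpenComplement j i)
    (M : DM Z) : IsZero ((pull j).obj ((push i).obj M))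
  localization {V Z X : Sch F} (j : V ⟶ X) (i : Z ⟶ X) (h : IsOpenComplement j i) (M : DM X) :
    ∃ δ, Triangle.mk ((shriek j).map ((openIso j h.1).hom.app M) ≫ (shriekAdj j).counit.app M)
      ((adj i).unit.app M) δ ∈ distTriang (DM X)
  /-- (Here `i_! = i_*`.) -/
  dualLocalization {V Z X : Sch F} (j : V ⟶ X) (i : Z ⟶ X) (h : IsOpenComplement j i)
    (M : DM X) :
    ∃ δ, Triangle.mk ((shriekAdj i).counit.app M) ((adj j).unit.app M) δ ∈ distTriang (DM X)
  -- purity and base change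
  forget_isIso {X Y : Sch F} (f : X ⟶ Y) (hf : IsProjectiveHom (Sch.mor f)) : IsIso (forget f)
  relativePurity {X Y : Sch F} (f : X ⟶ Y) (d : ℕ) (hf : IsQuasiProjectiveHom (Sch.mor f))
    (hd : SmoothOfRelativeDimension d (Sch.mor f)) :
    Nonempty (upper f ≅ pull f ⋙ toTateMotives.twist X d ⋙ shiftFunctor (DM X) (2 * d : ℤ))
  /-- Absolute purity `i^! 1 ≅ 1(-c)[-2c]`, written as `1 ≅ i^! (1(c)[2c])`. -/
  absolutePurity {Z X : Sch F} (i : Z ⟶ X) (c : ℕ) (hi : IsClosedImmersion (Sch.mor i))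
    (hZ : IsRegularScheme Z.toScheme) (hX : IsRegularScheme X.toScheme)
    (hc : HasCodim (Sch.mor i) c) :
    𝟙_ (DM Z) ≅ (upper i).obj ((toTateMotives.tate X c)⟦(2 * c : ℤ)⟧)
  baseChange {P X Y S : Sch F} {f' : P ⟶ X} {g' : P ⟶ Y} {g : X ⟶ S} {f : Y ⟶ S}
    (w : f' ≫ g = g' ≫ f) (hc : Sch.Cartesian f' g' g f)
    (hg : IsQuasiProjectiveHom (Sch.mor g)) : shriek g ⋙ pull f ≅ pull f' ⋙ shriek g'
  /-- The base change isomorphism is compatible with the exchange map for `f^* g_*`. -/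
  baseChange_forget {P X Y S : Sch F} {f' : P ⟶ X} {g' : P ⟶ Y} {g : X ⟶ S} {f : Y ⟶ S}
    (w : f' ≫ g = g' ≫ f) (hc : Sch.Cartesian f' g' g f)
    (hg : IsQuasiProjectiveHom (Sch.mor g)) (M : DM X) :
    (baseChange w hc hg).hom.app M ≫ (forget g').app ((pull f').obj M) =
      (pull f).map ((forget g).app M) ≫ toInverseImages.exchange w M
  -- Verdier duality
  verdier_upper {U : (specO F).Opens} {X Y : Sch F} (f : X ⟶ Y) (b : Y ⟶ Sch.op U)
    (hf : IsQuasiProjectiveHom (Sch.mor f)) (hb : IsQuasiProjectiveHom (Sch.mor b)) (M : DM Y)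
    (hM : compactObjects _ M) :
    Nonempty (toExceptionalImages.verdierDual (f ≫ b) ((upper f).obj M) ≅ (pull f).obj (toExceptionalImages.verdierDual b M))
  verdier_pull {U : (specO F).Opens} {X Y : Sch F} (f : X ⟶ Y) (b : Y ⟶ Sch.op U)
    (hf : IsQuasiProjectiveHom (Sch.mor f)) (hb : IsQuasiProjectiveHom (Sch.mor b)) (M : DM Y)
    (hM : compactObjects _ M) :
    Nonempty (toExceptionalImages.verdierDual (f ≫ b) ((pull f).obj M) ≅ (upper f).obj (toExceptionalImages.verdierDual b M))
  verdier_shriek {U : (specO F).Opens} {X Y : Sch F} (f : X ⟶ Y) (b : Y ⟶ Sch.op U)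
    (hf : IsQuasiProjectiveHom (Sch.mor f)) (hb : IsQuasiProjectiveHom (Sch.mor b)) (M : DM X)
    (hM : compactObjects _ M) :
    Nonempty (toExceptionalImages.verdierDual b ((shriek f).obj M) ≅ (push f).obj (toExceptionalImages.verdierDual (f ≫ b) M))
  verdier_push {U : (specO F).Opens} {X Y : Sch F} (f : X ⟶ Y) (b : Y ⟶ Sch.op U)
    (hf : IsQuasiProjectiveHom (Sch.mor f)) (hb : IsQuasiProjectiveHom (Sch.mor b)) (M : DM X)
    (hM : compactObjects _ M) :
    Nonempty (toExceptionalImages.verdierDual b ((push f).obj M) ≅ (shriek f).obj (toExceptionalImages.verdierDual (f ≫ b) M))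
  /-- The axiom on the generic point: `⨁_𝔭 i_* i^! M → M → η_* η^* M` is a distinguished triangle
  (here `i_! = i_*`). -/
  genericTriangle (U : (specO F).Opens) (ηU : Sch.gen F ⟶ Sch.op U) (M : DM (Sch.op U))
    (hM : compactObjects _ M) :
    ∃ (c : Cofan fun p : {p // Nonempty (Sch.pt p ⟶ Sch.op U)} =>
        (shriek p.2.some).obj ((upper p.2.some).obj M)) (_ : IsColimit c) (a : c.pt ⟶ M)
      (δ : _), (∀ p, c.inj p ≫ a = (shriekAdj p.2.some).counit.app M) ∧
        Triangle.mk a ((adj ηU).unit.app M) δ ∈ distTriang (DM (Sch.op U))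

/-- Adding a motivic `t`-structure on `DM_gm(S)` and a weight filtration on the objects of its heart.
Both are only meaningful for the arithmetic bases `S`; over any other base they are irrelevant. -/
structure TStructuresAndWeights (F : Type) [Field F] [NumberField F] extends
    TriangulatedMotives.{v, u} F where
  t (S : Sch F) : TStructure (toInverseImages.Gm S)
  weight (S : Sch F) (n : ℤ) : (t S).heart.FullSubcategory ⥤ (t S).heart.FullSubcategory
  weightι (S : Sch F) (n : ℤ) : weight S n ⟶ 𝟭 _
  weightStep (S : Sch F) (n : ℤ) : weight S n ⟶ weight S (n + 1)

namespace TStructuresAndWeights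
variable {F : Type} [Field F] [NumberField F] (D : TStructuresAndWeights.{v, u} F)

/-- The category `MM(S)` of mixed motives: the heart. -/
abbrev MM (S : Sch F) := (D.t S).heart.FullSubcategory

/-- `M` is geometric and in cohomological degrees `≤ n`. -/
def LE {S : Sch F} (M : D.DM S) (n : ℤ) : Prop :=
  ∃ h : compactObjects (D.DM S) M, (D.t S).IsLE ⟨M, h⟩ n

/-- `M` is geometric and in cohomological degrees `≥ n`. -/
def GE {S : Sch F} (M : D.DM S) (n : ℤ) : Prop :=
  ∃ h : compactObjects (D.DM S) M, (D.t S).IsGE ⟨M, h⟩ n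

/-- `M` is a mixed motive. -/
def IsMixed {S : Sch F} (M : D.DM S) : Prop := D.LE M 0 ∧ D.GE M 0

/-- A mixed motive, as an object of `MM(S)`. -/
def IsMixed.toMM {D : TStructuresAndWeights.{v, u} F} {S : Sch F} {M : D.DM S}
    (h : D.IsMixed M) : D.MM S :=
  ⟨⟨M, h.1.1⟩, ((D.t S).mem_heart_iff _).2 ⟨h.1.2, h.2.2⟩⟩

/-- The cohomology `ᵖHⁿ(M) = (τ_{≥ n} τ_{≤ n} M)[n]` with respect to the motivic `t`-structure. -/
def pH {S : Sch F} (M : D.Gm S) (n : ℤ) : D.MM S :=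
  ⟨((D.t S).truncGELE n n |>.obj M)⟦n⟧, ((D.t S).mem_heart_iff _).2
    ⟨(D.t S).isLE_shift _ n n 0, (D.t S).isGE_shift _ n n 0⟩⟩

/-- The weights of a mixed motive: the integers `n` with `W_{n-1} M ≠ W_n M`. -/
def weights {S : Sch F} (M : D.MM S) : Set ℤ :=
  {n | ¬ IsIso ((D.weightStep S (n - 1)).app M)}

/-- `M` is geometric and `P` holds for all its weights; the weights of a geometric motive are the
integers `w - n` for the weights `w` of `ᵖHⁿ(M)`. -/
def Weights {S : Sch F} (M : D.DM S) (P : ℤ → Prop) : Prop :=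
  ∃ h : compactObjects (D.DM S) M, ∀ n, ∀ w ∈ D.weights (D.pH ⟨M, h⟩ n), P (w - n)

lemma tate_compact (S : Sch F) (n : ℤ) : compactObjects _ (D.tate S n) := by
  refine D.pull_compact _ _ ?_
  have key : ∀ X, compactObjects _ X → ∀ m, compactObjects (D.DM (Sch.top F)) (tensorPower X m) :=
    fun X hX m => by
      induction m with
      | zero => exact D.unit_compact _
      | succ m ih => exact D.tensor_compact _ _ ih hX
  cases n with
  | ofNat m => exact key _ D.tatePos_compact m
  | negSucc m => exact key _ D.tateNeg_compact (m + 1)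

/-- The motive `M_S(X)(n)` of a scheme `X` of finite type over `S`, as a geometric motive. -/
def gm {X S : Sch F} (f : X ⟶ S) [hf : LocallyOfFiniteType (Sch.mor f)] (n : ℤ) : D.Gm S :=
  ⟨(D.twist S n).obj (D.mot f), D.tensor_compact _ _
    (D.push_compact f hf _ (D.pull_compact f _ (D.unit_compact S))) (D.tate_compact S n)⟩

/-- `h^i(X, n) = ᵖH^i(M_S(X)(n))`. -/
def h {X S : Sch F} (f : X ⟶ S) [LocallyOfFiniteType (Sch.mor f)] (i n : ℤ) : D.MM S :=
  D.pH (D.gm f n) i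

/-- The functor `M ↦ M(n)` on geometric motives. -/
def gmTwist (S : Sch F) (n : ℤ) : D.Gm S ⥤ D.Gm S :=
  (compactObjects _).lift ((compactObjects _).ι ⋙ D.twist S n)
    fun M => D.tensor_compact _ _ M.property (D.tate_compact S n)

/-- A decomposition `M ≅ ⨁_n ᵖHⁿ(M)[-n]`, given by the inclusions of the summands. -/
def IsDecomposition {S : Sch F} (M : D.Gm S) (s : ∀ n : ℤ, (D.pH M n).obj⟦-n⟧ ⟶ M) : Prop :=
  Nonempty (IsColimit (Cofan.mk M s))

/-- The functor `G` has cohomological amplitude in `[a, b]`. -/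
def Amplitude {S S' : Sch F} (G : D.DM S ⥤ D.DM S') (a b : ℤ) : Prop :=
  ∀ (M : D.DM S) (n : ℤ),
    (D.GE M n → D.GE (G.obj M) (n + a)) ∧ (D.LE M n → D.LE (G.obj M) (n + b))

/-- The functor `G` preserves the geometric motives with weights `≤ 0`. -/
def PreservesNonpos {S S' : Sch F} (G : D.DM S ⥤ D.DM S') : Prop :=
  ∀ M : D.DM S, D.Weights M (· ≤ 0) → D.Weights (G.obj M) (· ≤ 0)

/-- The functor `G` preserves the geometric motives with weights `≥ 0`. -/
def PreservesNonneg {S S' : Sch F} (G : D.DM S ⥤ D.DM S') : Prop :=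
  ∀ M : D.DM S, D.Weights M (0 ≤ ·) → D.Weights (G.obj M) (0 ≤ ·)

end TStructuresAndWeights

/-- The axioms on the motivic `t`-structure: boundedness, cohomological dimension, exactness
properties, and the decomposition of the motives of smooth projective schemes. -/
structure TStructureAxioms {F : Type} [Field F] [NumberField F]
    (D : TStructuresAndWeights.{v, u} F) : Prop where
  bounded {S : Sch F} (hS : IsArithmeticBase S) (M : D.Gm S) :
    ∃ a b : ℤ, (D.t S).IsGE M a ∧ (D.t S).IsLE M b
  cohDim_pt (p : IsDedekindDomain.HeightOneSpectrum (𝓞 F)) (M N : D.DM (Sch.pt p))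
    (hM : D.IsMixed M) (hN : D.IsMixed N) (i : ℤ) (hi : 0 < i) (a : M ⟶ N⟦i⟧) : a = 0
  cohDim_gen (M N : D.DM (Sch.gen F)) (hM : D.IsMixed M) (hN : D.IsMixed N) (i : ℤ) (hi : 1 < i)
    (a : M ⟶ N⟦i⟧) : a = 0
  unit_gen : D.IsMixed (𝟙_ (D.DM (Sch.gen F)))
  unit_pt (p : IsDedekindDomain.HeightOneSpectrum (𝓞 F)) : D.IsMixed (𝟙_ (D.DM (Sch.pt p)))
  unit_op (U : (specO F).Opens) : D.IsMixed ((𝟙_ (D.DM (Sch.op U)))⟦(1 : ℤ)⟧)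
  open_pull {V U : (specO F).Opens} (j : Sch.op V ⟶ Sch.op U) : D.Amplitude (D.pull j) 0 0
  open_push {V U : (specO F).Opens} (j : Sch.op V ⟶ Sch.op U) : D.Amplitude (D.push j) 0 0
  open_shriek {V U : (specO F).Opens} (j : Sch.op V ⟶ Sch.op U) : D.Amplitude (D.shriek j) 0 0
  generic_pull {U : (specO F).Opens} (e : Sch.gen F ⟶ Sch.op U) :
    D.Amplitude (D.pull e) (-1) (-1)
  closed_push {p : IsDedekindDomain.HeightOneSpectrum (𝓞 F)} {U : (specO F).Opens}
    (i : Sch.pt p ⟶ Sch.op U) : D.Amplitude (D.push i) 0 0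
  closed_pull {p : IsDedekindDomain.HeightOneSpectrum (𝓞 F)} {U : (specO F).Opens}
    (i : Sch.pt p ⟶ Sch.op U) : D.Amplitude (D.pull i) (-1) 0
  closed_upper {p : IsDedekindDomain.HeightOneSpectrum (𝓞 F)} {U : (specO F).Opens}
    (i : Sch.pt p ⟶ Sch.op U) : D.Amplitude (D.upper i) 0 1
  verdier_le {V U : (specO F).Opens} (j : Sch.op V ⟶ Sch.op U) (M : D.DM (Sch.op V)) :
    D.LE M 0 → D.GE (D.verdierDual j M) 0
  verdier_ge {V U : (specO F).Opens} (j : Sch.op V ⟶ Sch.op U) (M : D.DM (Sch.op V)) :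
    D.GE M 0 → D.LE (D.verdierDual j M) 0
  decomposition {X S : Sch F} (hS : IsArithmeticBase S) (f : X ⟶ S) [Smooth (Sch.mor f)]
    (hf : IsProjectiveHom (Sch.mor f)) : ∃ s, D.IsDecomposition (D.gm f 0) s
  /-- Over an open subscheme of `Spec 𝓞 F`, the decomposition can be chosen to be compatible, with
  a shift of the degree by one, with decompositions of the fibres over the closed points. -/
  decomposition_fibres {U : (specO F).Opens} {X : Sch F} (f : X ⟶ Sch.op U) [Smooth (Sch.mor f)]
    (hf : IsProjectiveHom (Sch.mor f)) :
    ∃ s, D.IsDecomposition (D.gm f 0) s ∧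
      ∀ (p : IsDedekindDomain.HeightOneSpectrum (𝓞 F)) (i : Sch.pt p ⟶ Sch.op U) (Z : Sch F)
        (a : Z ⟶ X) (g : Z ⟶ Sch.pt p) [LocallyOfFiniteType (Sch.mor g)] (w : a ≫ f = g ≫ i),
        Sch.Cartesian a g f i →
        ∃ s', D.IsDecomposition (D.gm g 0) s' ∧
          ∀ n : ℤ, ∃ ψ : (D.pull i).obj ((D.h f n 0).obj⟦-n⟧).obj ≅
              ((D.h g (n - 1) 0).obj⟦-(n - 1)⟧).obj,
            (D.pull i).map (s n).hom ≫ (D.pullTwist i 0 _).hom ≫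
              (D.twist _ 0).map (D.motBaseChange w) = ψ.hom ≫ (s' (n - 1)).hom

/-- The axioms on weights. -/
structure WeightAxioms {F : Type} [Field F] [NumberField F]
    (D : TStructuresAndWeights.{v, u} F) : Prop where
  mono {S : Sch F} (hS : IsArithmeticBase S) (n : ℤ) (M : D.MM S) : Mono ((D.weightι S n).app M)
  step {S : Sch F} (hS : IsArithmeticBase S) (n : ℤ) :
    D.weightStep S n ≫ D.weightι S (n + 1) = D.weightι S n
  finite {S : Sch F} (hS : IsArithmeticBase S) (M : D.MM S) :
    ∃ a b : ℤ, IsZero ((D.weight S a).obj M) ∧ IsIso ((D.weightι S b).app M)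
  /-- Strictness `f (W_n M) = f (M) ∩ W_n N`, in terms of generalized elements. -/
  strict {S : Sch F} (hS : IsArithmeticBase S) {M N T : D.MM S} (f : M ⟶ N) (n : ℤ)
    (a : T ⟶ (D.weight S n).obj N) (b : T ⟶ M) (hab : b ≫ f = a ≫ (D.weightι S n).app N) :
    ∃ (T' : D.MM S) (e : T' ⟶ T) (_ : Epi e) (c : T' ⟶ (D.weight S n).obj M),
      c ≫ (D.weightι S n).app M ≫ f = e ≫ a ≫ (D.weightι S n).app N
  unit {S : Sch F} (hS : IsArithmeticBase S) : D.Weights (𝟙_ (D.DM S)) (· = 0)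
  /-- Twisting a pure mixed motive lowers its weight by `2n`. -/
  twist {S : Sch F} (hS : IsArithmeticBase S) (M : D.DM S) (hM : D.IsMixed M) (w n : ℤ)
    (hw : D.Weights M (· = w)) :
    D.IsMixed ((D.twist S n).obj M) ∧ D.Weights ((D.twist S n).obj M) (· = w - 2 * n)
  shriek_pull {S X : Sch F} (hS : IsArithmeticBase S) (f : X ⟶ S)
    (hf : IsQuasiProjectiveHom (Sch.mor f)) : D.PreservesNonpos (D.pull f ⋙ D.shriek f)
  push_upper {S X : Sch F} (hS : IsArithmeticBase S) (f : X ⟶ S)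
    (hf : IsQuasiProjectiveHom (Sch.mor f)) : D.PreservesNonneg (D.upper f ⋙ D.push f)
  closed_pull {p : IsDedekindDomain.HeightOneSpectrum (𝓞 F)} {U : (specO F).Opens}
    (i : Sch.pt p ⟶ Sch.op U) : D.PreservesNonpos (D.pull i)
  closed_upper {p : IsDedekindDomain.HeightOneSpectrum (𝓞 F)} {U : (specO F).Opens}
    (i : Sch.pt p ⟶ Sch.op U) : D.PreservesNonneg (D.upper i)
  open_shriek {V U : (specO F).Opens} (j : Sch.op V ⟶ Sch.op U) : D.PreservesNonpos (D.shriek j)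
  open_push {V U : (specO F).Opens} (j : Sch.op V ⟶ Sch.op U) : D.PreservesNonneg (D.push j)
  open_pull {V U : (specO F).Opens} (j : Sch.op V ⟶ Sch.op U) :
    D.PreservesNonpos (D.pull j) ∧ D.PreservesNonneg (D.pull j)
  generic_pull {U : (specO F).Opens} (e : Sch.gen F ⟶ Sch.op U) :
    D.PreservesNonpos (D.pull e) ∧ D.PreservesNonneg (D.pull e)

namespace TStructuresAndWeights
variable {F : Type} [Field F] [NumberField F] (D : TStructuresAndWeights.{v, u} F)

/-- The unit `1` as a geometric motive. -/
def gmUnit (S : Sch F) : D.Gm S := ⟨𝟙_ _, D.unit_compact S⟩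

/-- The map `H^k(S, M_S(X)(n)) → H^k(X, 1(n))` given by `f^*` and the counit `f^* f_* 1 → 1`. -/
def toUnitH {X S : Sch F} (f : X ⟶ S) (n k : ℤ) :
    D.H ((D.twist S n).obj (D.mot f)) k →ₗ[ℚ] D.H (D.tate X n) k :=
  D.pullH f ((D.pullTwist f n _).hom ≫ (D.twist X n).map ((D.adj f).counit.app _ ≫
    Functor.OplaxMonoidal.η (D.pull f)) ≫ (λ_ _).hom) k

/-- The restriction map `H^k(Y, 1(n)) → H^k(X, 1(n))`. -/
def restrictH {X Y : Sch F} (f : X ⟶ Y) (n k : ℤ) :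
    D.H (D.tate Y n) k →ₗ[ℚ] D.H (D.tate X n) k :=
  D.pullH f (D.pullTate f n).hom k

/-- `a` is the class in `H^{2c}(X, 1(c))` of the closed immersion `i : Z ⟶ X`, of codimension `c`,
of regular schemes: the composite `1 → i_* 1 ≅ i_! 1 → 1(c)[2c]`. -/
def IsGysinClass {Z X : Sch F} (i : Z ⟶ X) (c : ℕ) (hi : IsClosedImmersion (Sch.mor i))
    (hZ : IsRegularScheme Z.toScheme) (hX : IsRegularScheme X.toScheme)
    (hc : HasCodim (Sch.mor i) c) (a : D.H (D.tate X c) (2 * c)) : Prop :=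
  ∃ b : 𝟙_ (D.DM X) ⟶ (D.shriek i).obj (𝟙_ (D.DM Z)),
    b ≫ (D.forget i).app _ =
      (D.adj i).homEquiv _ _ (Functor.OplaxMonoidal.η (D.pull i)) ∧
    b ≫ ((D.shriekAdj i).homEquiv _ _).symm (D.absolutePurity i c hi hZ hX hc).hom = a

end TStructuresAndWeights

/-- A formalism of mixed motives, satisfying all axioms, with its relation to Chow groups and its
`ℓ`-adic realization (over `F`, with values in the cohomology of geometric fibres). -/
structure MixedMotives (F : Type) [Field F] [NumberField F] (ℓ : ℕ) [Fact ℓ.Prime] extends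
    TStructuresAndWeights.{v, u} F where
  tAxioms : TStructureAxioms toTStructuresAndWeights
  wAxioms : WeightAxioms toTStructuresAndWeights
  /-- Motivic cohomology of a smooth scheme in degree `(2n, n)` is the Chow group. -/
  chow {X : Sch F} (f : X ⟶ Sch.gen F) (hf : Smooth (Sch.mor f)) (n : ℤ) :
    Chow X.toScheme n ≃ₗ[ℚ] toInverseImages.H (toTateMotives.tate X n) (2 * n)
  /-- The identification is compatible with restriction to open subschemes. -/
  chow_open {U X : Sch F} (j : U ⟶ X) (hj : IsOpenImmersion (Sch.mor j)) (f : X ⟶ Sch.gen F)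
    (hf : Smooth (Sch.mor f)) (hU : Smooth (Sch.mor (j ≫ f))) (n : ℤ) (z : cycles X.toScheme n)
    (w : cycles U.toScheme n) (h : ∀ x, w.1 x = z.1 (Sch.mor j x)) :
    chow (j ≫ f) hU n (Submodule.Quotient.mk w) =
      toTStructuresAndWeights.restrictH j n (2 * n) (chow f hf n (Submodule.Quotient.mk z))
  /-- The cycle of a regular integral closed subscheme corresponds to its Gysin class. -/
  chow_regular {Z X : Sch F} (f : X ⟶ Sch.gen F) (hf : Smooth (Sch.mor f)) (i : Z ⟶ X) (c : ℕ)
    (hi : IsClosedImmersion (Sch.mor i)) (hint : IsIntegral Z.toScheme)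
    (hZ : IsRegularScheme Z.toScheme) (hX : IsRegularScheme X.toScheme)
    (hc : HasCodim (Sch.mor i) c) (z : cycles X.toScheme c)
    (hz : z.1 = Finsupp.single (Sch.mor i (genericPoint Z.toScheme)) 1) :
    toTStructuresAndWeights.IsGysinClass i c hi hZ hX hc (chow f hf c (Submodule.Quotient.mk z))
  /-- The motivic cohomology of a smooth scheme vanishes in degree `(k, n)` for `k > 2n`. -/
  vanishing {X : Sch F} (f : X ⟶ Sch.gen F) (hf : Smooth (Sch.mor f)) (n k : ℤ) (hk : 2 * n < k)
    (a : toInverseImages.H (toTateMotives.tate X n) k) : a = 0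
  /-- The degree zero cohomology of the geometric `ℓ`-adic realization of a motive over `F`. -/
  real : toInverseImages.Gm (Sch.gen F) ⥤ ModuleCat.{1} ℚ_[ℓ]
  [real_additive : real.Additive]
  [real_homological : real.IsHomological]
  /-- The realization of `M(X)` is the `ℓ`-adic cohomology of the geometric fibre. -/
  realMot {X : Sch F} (f : X ⟶ Sch.gen F) (hf : LocallyOfFiniteType (Sch.mor f)) (k : ℕ) :
    real.obj ((⟨toInverseImages.mot f, push_compact f hf _ (pull_compact f _ (unit_compact _))⟩ :
      toInverseImages.Gm (Sch.gen F))⟦(k : ℤ)⟧) ≃+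
      (ellAdicCohomology ℓ k).obj (.op ((geometricFibre F).obj (Over.mk (Sch.mor f))))
  realMot_natural {X Y : Sch F} (f : X ⟶ Sch.gen F) (g : Y ⟶ Sch.gen F) (a : X ⟶ Y)
    (w : a ≫ g = f) (hf : LocallyOfFiniteType (Sch.mor f))
    (hg : LocallyOfFiniteType (Sch.mor g)) (k : ℕ) (x) :
    realMot f hf k (real.map ((ObjectProperty.homMk (toInverseImages.motMap w))⟦(k : ℤ)⟧') x) =
      (ellAdicCohomology ℓ k).map ((geometricFibre F).map
        (Over.homMk (Sch.mor a) (congrArg Sch.mor w))).op (realMot g hg k x)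
  realMot_neg {X : Sch F} (f : X ⟶ Sch.gen F) (hf : LocallyOfFiniteType (Sch.mor f)) (k : ℤ)
    (hk : k < 0) :
    IsZero (real.obj ((⟨toInverseImages.mot f,
      push_compact f hf _ (pull_compact f _ (unit_compact _))⟩ :
      toInverseImages.Gm (Sch.gen F))⟦k⟧))
  /-- Over an algebraic closure, `ℚ_ℓ(1)` is (non-canonically) isomorphic to `ℚ_ℓ`. -/
  real_twist (n : ℤ) : Nonempty (toTStructuresAndWeights.gmTwist (Sch.gen F) n ⋙ real ≅ real)
  /-- For `X` smooth and projective over `F`, the subgroup `H^1(h^{2n-1}(X, n))` of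
  `H^{2n}(X, n) = CH^n(X)` consists of the homologically trivial cycles. -/
  chow_hom {X : Sch F} (f : X ⟶ Sch.gen F) [Smooth (Sch.mor f)]
    (hf : IsProjectiveHom (Sch.mor f)) (n : ℤ)
    (a : toTStructuresAndWeights.gmUnit _ ⟶ (toTStructuresAndWeights.gm f n)⟦2 * n⟧) :
    (∃ b : toTStructuresAndWeights.gmUnit _ ⟶
        (((t _).truncLE (2 * n - 1)).obj (toTStructuresAndWeights.gm f n))⟦2 * n⟧,
      b ≫ (((t _).truncLEι (2 * n - 1)).app _)⟦2 * n⟧' = a) ↔ real.map a = 0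

attribute [instance] MixedMotives.real_additive MixedMotives.real_homological

namespace MixedMotives
variable {F : Type} [Field F] [NumberField F] {ℓ : ℕ} [Fact ℓ.Prime] (D : MixedMotives.{v, u} F ℓ)

/-- The morphisms `1 → M[k]` of geometric motives are the elements of `H^k(M)`. -/
def ofGm {S : Sch F} (M : D.Gm S) (k : ℤ) : (D.gmUnit S ⟶ M⟦k⟧) →ₗ[ℚ] D.H M.obj k :=
  Linear.rightComp ℚ _ (((compactObjects (D.DM S)).ι.commShiftIso k).hom.app M) ∘ₗ
    (compactObjects (D.DM S)).ι.mapLinearMap ℚ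

/-- The homologically trivial part of `CH^n(X)_ℚ` for `X` smooth over `F`: the classes whose
realization `H^0(Spec F̄, ℚ_ℓ) → H^{2n}(X_F̄, ℚ_ℓ(n))` is zero. -/
def chowHom {X : Sch F} (f : X ⟶ Sch.gen F) [hf : Smooth (Sch.mor f)] (n : ℤ) :
    Submodule ℚ (Chow X.toScheme n) :=
  (((LinearMap.ker (D.real.mapLinearMap ℚ)).map (D.ofGm (D.gm f n) (2 * n))).map
    (D.toUnitH f n (2 * n))).comap (D.chow f hf n).toLinearMap

/-- A projective model over `Spec 𝓞 F` of a scheme `y : Y ⟶ Spec F`. -/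
structure ProjectiveModel {Y : Sch F} (y : Y ⟶ Sch.gen F) where
  X : Sch F
  f : X ⟶ Sch.top F
  a : Y ⟶ X
  comm : a ≫ f = y ≫ (Sch.gen F).struct
  projective : IsProjectiveHom (Sch.mor f)
  cartesian : Sch.Cartesian a y f (Sch.gen F).struct

/-- The pullback `H^i(X, n) → H^i(Y, n)` along the inclusion of the generic fibre. -/
def ProjectiveModel.restrict {Y : Sch F} {y : Y ⟶ Sch.gen F} (m : ProjectiveModel y) (i n : ℤ) :
    D.H ((D.twist _ n).obj (D.mot m.f)) i →ₗ[ℚ] D.H ((D.twist _ n).obj (D.mot y)) i :=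
  D.pullH (Sch.gen F).struct
    ((D.pullTwist _ n _).hom ≫ (D.twist _ n).map (D.motBaseChange m.comm)) i

/-- The group `H^i(Y, n)_{𝓞 F}` defined by a projective model of `Y`: the image of
`H^i(X, n) → H^i(Y, n)`. -/
def integralH {Y : Sch F} {y : Y ⟶ Sch.gen F} (m : ProjectiveModel y) (i n : ℤ) :
    Submodule ℚ (D.H ((D.twist _ n).obj (D.mot y)) i) :=
  LinearMap.range (m.restrict D i n)

/-- A geometric motive over an open subscheme of `Spec 𝓞 F` is smooth if `i^! M ≅ i^* M(-1)[-2]` for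
all closed points `i`. -/
def IsSmoothMotive {U : (specO F).Opens} (M : D.DM (Sch.op U)) : Prop :=
  ∀ (p : IsDedekindDomain.HeightOneSpectrum (𝓞 F)) (i : Sch.pt p ⟶ Sch.op U),
    Nonempty ((D.upper i).obj M ≅ ((D.twist _ (-1)).obj ((D.pull i).obj M))⟦(-2 : ℤ)⟧)

lemma isMixed_of_amplitude {S S' : Sch F} {G : D.DM S ⥤ D.DM S'} (hG : D.Amplitude G 0 0)
    {M : D.DM S} (hM : D.IsMixed M) : D.IsMixed (G.obj M) :=
  ⟨by simpa using (hG M 0).2 hM.1, by simpa using (hG M 0).1 hM.2⟩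

/-- The map `j_! M → j_* M` in `MM(S)` for a mixed motive `M` over an open subscheme. -/
def forgetSupports {U V : (specO F).Opens} (j : Sch.op V ⟶ Sch.op U) {M : D.DM (Sch.op V)}
    (hM : D.IsMixed M) :
    (D.isMixed_of_amplitude (D.tAxioms.open_shriek j) hM).toMM ⟶
      (D.isMixed_of_amplitude (D.tAxioms.open_push j) hM).toMM :=
  ObjectProperty.homMk (ObjectProperty.homMk ((D.forget j).app M))

/-- A generic intermediate extension `η_{!*} N = j_{!*} j^* M` of a motive `N` over `F`: here `M` is
a mixed motive over `Spec 𝓞 F` with `η^* M ≅ N` such that `j^* M` is smooth for a non-empty open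
subscheme `j`, and `j_{!*} j^* M` is the image of `j_! j^* M → j_* j^* M` in `MM(Spec 𝓞 F)`. -/
structure GenericIntermediateExtension (N : D.DM (Sch.gen F)) where
  M : D.DM (Sch.top F)
  mixed : D.IsMixed M
  genericIso : (D.pull (Sch.gen F).struct).obj M ≅ N
  U : (specO F).Opens
  nonempty : U ≠ ⊥
  j : Sch.op U ⟶ Sch.top F
  ηU : Sch.gen F ⟶ Sch.op U
  smooth : D.IsSmoothMotive ((D.pull j).obj M)
  image : ImageFactorisation (D.forgetSupports j
    (D.isMixed_of_amplitude (D.tAxioms.open_pull j) mixed))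

namespace GenericIntermediateExtension
variable {D} {N : D.DM (Sch.gen F)} (e : D.GenericIntermediateExtension N)

/-- The motive `η_{!*} N` itself. -/
def obj : D.DM (Sch.top F) := e.image.F.I.obj.obj

/-- The canonical map `η^* η_{!*} N → N`, induced by `j_{!*} j^* M → j_* j^* M`. -/
def toGeneric : (D.pull (Sch.gen F).struct).obj e.obj ⟶ N :=
  (D.pull _).map e.image.F.m.hom.hom ≫ (D.pullComp (Sch.op_top_hom_ext _ _)).inv.app _ ≫
    (D.pull e.ηU).map ((D.adj e.j).counit.app _) ≫
      (D.pullComp (Sch.op_top_hom_ext (e.ηU ≫ e.j) _)).hom.app _ ≫ e.genericIso.hom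

/-- The restriction `H^k(η_{!*} N) → H^k(N)`. -/
def restrict (k : ℤ) : D.H e.obj k →ₗ[ℚ] D.H N k :=
  D.pullH (Sch.gen F).struct e.toGeneric k

end GenericIntermediateExtension

/-- The map `H^i(τ_{≤ i-1} M) → H^i(M)`, for `M = M(Y)(n)`. -/
def truncMap {Y : Sch F} (y : Y ⟶ Sch.gen F) [LocallyOfFiniteType (Sch.mor y)] (i n : ℤ) :
    D.H (((D.t _).truncLE (i - 1)).obj (D.gm y n)).obj i →ₗ[ℚ]
      D.H ((D.twist _ n).obj (D.mot y)) i :=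
  Linear.rightComp ℚ _ ((((D.t _).truncLEι (i - 1)).app (D.gm y n)).hom⟦i⟧')

/-- The map `H^i(τ_{≤ i-1} M) → H^i((ᵖH^{i-1} M)[1-i]) = H^0(h^{i-1}(Y, n)[1])`, for
`M = M(Y)(n)`. -/
def edgeMap {Y : Sch F} (y : Y ⟶ Sch.gen F) [LocallyOfFiniteType (Sch.mor y)] (i n : ℤ) :
    D.H (((D.t _).truncLE (i - 1)).obj (D.gm y n)).obj i →ₗ[ℚ]
      D.H ((D.h y (i - 1) n).obj.obj⟦(1 : ℤ)⟧) 0 :=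
  Linear.rightComp ℚ _ ((((D.t _).truncGEπ (i - 1)).app
      (((D.t _).truncLE (i - 1)).obj (D.gm y n))).hom⟦i⟧' ≫
    (shiftFunctorAdd' (D.DM (Sch.gen F)) (i - 1) 1 i (by omega)).hom.app _ ≫
    (((compactObjects (D.DM (Sch.gen F))).ι.commShiftIso (i - 1)).inv.app _)⟦(1 : ℤ)⟧' ≫
    (shiftFunctorZero (D.DM (Sch.gen F)) ℤ).inv.app ((D.h y (i - 1) n).obj.obj⟦(1 : ℤ)⟧))

/-- The identification `H^{-1}(N[1]) = H^0(N)`. -/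
def unshiftH {S : Sch F} (N : D.DM S) : D.H (N⟦(1 : ℤ)⟧) (-1) ≃ₗ[ℚ] D.H N 0 :=
  Linear.homCongr ℚ (Iso.refl _)
    ((shiftFunctorAdd' (D.DM S) 1 (-1) 0 (by omega)).symm.app N)

end MixedMotives
end Motives
end

/-!
# Motivic cohomology of intermediate extensions

Let `N = h^{i-1}(Y, n)[1]` and let `E = η_{!*} N` be an intermediate extension. At every closed point
`i_p` of `Spec 𝓞 F` the motive `i_p^! E` has cohomology only in degrees `≥ 1` and `i_p^* E` only in
degrees `≤ -1` (`GenericIntermediateExtension.upper_GE` and `pull_LE`): where `E` is smooth this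
follows from `i^! ≅ i^*(-1)[-2]` and the amplitudes of `i^!` and `i^*`, and at the remaining points
from the embedding of `E` into `j_*` and its presentation as a quotient of `j_!`. Hence `E` has neither
subobjects nor quotients supported in closed points. In the triangle that compares `E` with
`η_* η^* E`, the terms `i_p^! E` do not meet degrees `≤ 0`. So the restriction of `H^k(E)` to the
generic fibre is injective for `k ≤ 0` (`restrict_injective`) and bijective for `k = -1`
(`restrict_bijective`).

If `N` extends to a mixed motive `Q` over `Spec 𝓞 F` of weights `< 0`, then `E` and `Q` are related by
morphisms whose kernels and cokernels are supported in closed points; the cokernel that matters has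
weights `< 0` and therefore no `H^0`, while the kernel has no `H^1` for reasons of degree. Thus `E`
and `Q` have the same classes over the generic point (`range_restrict`). For a projective model `X`
and `i < 2n` this applies to `Q = ᵖH^i(M(X)(n))`, because the motive of a projective scheme has weights
`≤ -2n` (`weights_mot_le`). The same weight estimate, for `ᵖH^{i+1}`, and the cohomological dimension
lift every class of `H^i(X, n)` and of `H^0(Q)` to `H^i(τ_{≤ i} M(X)(n))`. Over the generic fibre, which
lies one perverse degree lower, the edge map from `H^i(τ_{≤ i-1} M(Y)(n))` to `H^0(N)` is bijective and
the map to `H^i(Y, n)` is injective (`edgeMap_bijective`, `truncMap_injective`). Together these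
describe the integral part of `H^i(Y, n)` in terms of `E` alone (`integralH_eq`), which proves both the
independence of the model and the isomorphism with `H^0(E)`. For `i > 2n` the group `H^i(Y, n)`
vanishes (`eq_zero_of_two_mul_lt`).

For `i = 2n` the extension of `N` can be chosen with weights `≥ 0` (`exists_extension`). Then `E` has
weights `≥ 0`, the obstructions to extending a class from the generic fibre vanish
(`restrict_surjective`), and `H^0(E)` is all of `H^0(N)`. The latter is identified with
`H^{2n}(τ_{≤ 2n-1} M(Y)(n))` by the edge map, and its image in the Chow group consists of the
homologically trivial cycles (`chowHom_eq`).

A projective model is given by the closure of `Y` in projective space (`exists_projectiveModel`), and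
it is smooth over some open `U`, over which the intermediate extension is constructed. There the motive
of the model satisfies `i^! M ≅ i^* M(-1)[-2]` by absolute and relative purity, after splitting into
pieces of constant relative dimension (`isSmoothMotive_mot`). To pass to a single cohomology motive,
one uses that `i^!` and `i^*(-1)[-2]` both take the summand `h^k[-k]` to a motive in degree `k + 1`,
and that over a closed point motives in different degrees are orthogonal (`isSmoothMotive_h`). For
`i^*` the degree is known from the decomposition of the fibre. For `i^!` it follows from purity of the
weights of `h^k`, which excludes subobjects supported in closed points (`upper_GE_of_pure`).
-/

noncomputable section

set_option linter.checkUnivs false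

/-! ### The heart of a t-structure -/

namespace CategoryTheory.Triangulated.TStructure

section Heart
variable {C : Type u} [Category.{v} C] [Preadditive C] [HasZeroObject C] [HasShift C ℤ]
  [∀ n : ℤ, (shiftFunctor C n).Additive] [Pretriangulated C] (t : TStructure C)

instance (X : t.heart.FullSubcategory) : t.IsLE X.obj 0 := ((t.mem_heart_iff _).1 X.property).1

instance (X : t.heart.FullSubcategory) : t.IsGE X.obj 0 := ((t.mem_heart_iff _).1 X.property).2

lemma heart_hom_eq_zero ⦃X Y : t.heart.FullSubcategory⦄ ⦃n : ℤ⦄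
    (f : t.heart.ι.obj X ⟶ (t.heart.ι.obj Y)⟦n⟧) (hn : n < 0) : f = 0 := by
  have : t.IsLE (t.heart.ι.obj X) 0 := inferInstanceAs (t.IsLE X.obj 0)
  have : t.IsGE (t.heart.ι.obj Y) 0 := inferInstanceAs (t.IsGE Y.obj 0)
  have : t.IsGE ((t.heart.ι.obj Y)⟦n⟧) (-n) := t.isGE_shift _ 0 n (-n)
  exact t.zero f 0 (-n)

open ZeroObject in
instance : HasFiniteProducts t.heart.FullSubcategory := by
  have : HasZeroObject t.heart.FullSubcategory :=
    ⟨⟨⟨0, (t.mem_heart_iff _).2 ⟨inferInstance, inferInstance⟩⟩, by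
      rw [IsZero.iff_id_eq_zero]
      ext⟩⟩
  have : HasBinaryProducts t.heart.FullSubcategory := by
    refine @hasBinaryProducts_of_hasLimit_pair _ _ (fun {X Y} => ?_)
    have hT := binaryBiproductTriangle_distinguished X.obj Y.obj
    have h₁ : t.IsLE (X.obj ⊞ Y.obj) 0 := t.isLE₂ _ hT 0
      (inferInstanceAs (t.IsLE X.obj 0)) (inferInstanceAs (t.IsLE Y.obj 0))
    have h₂ : t.IsGE (X.obj ⊞ Y.obj) 0 := t.isGE₂ _ hT 0
      (inferInstanceAs (t.IsGE X.obj 0)) (inferInstanceAs (t.IsGE Y.obj 0))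
    let Z : t.heart.FullSubcategory := ⟨X.obj ⊞ Y.obj, (t.mem_heart_iff _).2 ⟨h₁, h₂⟩⟩
    exact ⟨⟨_, BinaryFan.IsLimit.mk
      (BinaryFan.mk (P := Z) (ObjectProperty.homMk biprod.fst) (ObjectProperty.homMk biprod.snd))
      (fun f g => ObjectProperty.homMk (biprod.lift f.hom g.hom))
      (fun f g => ObjectProperty.hom_ext _ (biprod.lift_fst _ _))
      (fun f g => ObjectProperty.hom_ext _ (biprod.lift_snd _ _))
      (fun f g m hf hg => ObjectProperty.hom_ext _ (biprod.hom_ext _ _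
        ((congrArg (·.hom) hf).trans (biprod.lift_fst _ _).symm)
        ((congrArg (·.hom) hg).trans (biprod.lift_snd _ _).symm)))⟩⟩
  exact hasFiniteProducts_of_has_binary_and_terminal

lemma isLE₃ (T : Triangle C) (hT : T ∈ distTriang C) (n : ℤ) (h₁ : t.IsLE T.obj₁ (n + 1))
    (h₂ : t.IsLE T.obj₂ n) : t.IsLE T.obj₃ n :=
  t.isLE₂ _ (rot_of_distTriang _ hT) n h₂ (t.isLE_shift T.obj₁ (n + 1) 1 n)

lemma isGE₃ (T : Triangle C) (hT : T ∈ distTriang C) (n : ℤ) (h₁ : t.IsGE T.obj₁ (n + 1))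
    (h₂ : t.IsGE T.obj₂ n) : t.IsGE T.obj₃ n :=
  t.isGE₂ _ (rot_of_distTriang _ hT) n h₂ (t.isGE_shift T.obj₁ (n + 1) 1 n)

lemma isGE₁ (T : Triangle C) (hT : T ∈ distTriang C) (n : ℤ) (h₂ : t.IsGE T.obj₂ n)
    (h₃ : t.IsGE T.obj₃ (n - 1)) : t.IsGE T.obj₁ n :=
  t.isGE₂ _ (inv_rot_of_distTriang _ hT) n (t.isGE_shift T.obj₃ (n - 1) (-1) n) h₂

/-- Truncating the third vertex of a triangle on a morphism of the heart produces its kernel and its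
cokernel, so that every morphism of the heart is admissible. -/
lemma heart_admissible : AbelianSubcategory.admissibleMorphism t.heart.ι = ⊤ := by
  ext X Y f
  simp only [MorphismProperty.top_apply, iff_true]
  intro Z f₂ f₃ hT
  have hZ₁ : t.IsGE Z (-1) := t.isGE₃ _ hT (-1) (inferInstanceAs (t.IsGE X.obj 0))
    (t.isGE_of_ge Y.obj (-1) 0)
  have hZ₂ : t.IsLE Z 0 := t.isLE₃ _ hT 0 (t.isLE_of_le X.obj 0 1) (inferInstanceAs (t.IsLE Y.obj 0))
  obtain ⟨A, B, hA, hB, a, b, c, hT'⟩ := t.exists_triangle Z (-1) 0 (by omega)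
  have hA : t.IsLE A (-1) := ⟨hA⟩
  have hB : t.IsGE B 0 := ⟨hB⟩
  have hA' : t.IsGE A (-1) := t.isGE₁ _ hT' (-1) hZ₁ (t.isGE_of_ge B (-1 - 1) 0)
  have hB' : t.IsLE B 0 := t.isLE₃ _ hT' 0 (t.isLE_of_le A (-1) 1) hZ₂
  let e : A⟦(-1 : ℤ)⟧⟦(1 : ℤ)⟧ ≅ A := (shiftEquiv C (1 : ℤ)).counitIso.app A
  refine ⟨⟨A⟦(-1 : ℤ)⟧, (t.mem_heart_iff _).2
      ⟨t.isLE_shift A (-1) (-1) 0, t.isGE_shift A (-1) (-1) 0⟩⟩,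
    ⟨B, (t.mem_heart_iff _).2 ⟨hB', hB⟩⟩, e.hom ≫ a, b, c ≫ e.inv⟦(1 : ℤ)⟧', ?_⟩
  refine isomorphic_distinguished _ hT' _ (Triangle.isoMk _ _ e (Iso.refl _) (Iso.refl _) ?_ ?_ ?_)
  · exact Category.comp_id _
  · exact (Category.comp_id _).trans (Category.id_comp _).symm
  · change (c ≫ e.inv⟦(1 : ℤ)⟧') ≫ e.hom⟦(1 : ℤ)⟧' = 𝟙 B ≫ c
    rw [Category.assoc, ← Functor.map_comp, e.inv_hom_id, Functor.map_id, Category.comp_id,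
      Category.id_comp]

/-- The heart of a `t`-structure is an abelian category. -/
@[reducible]
def heartAbelian [IsTriangulated C] : Abelian t.heart.FullSubcategory :=
  AbelianSubcategory.abelian t.heart.ι t.heart_hom_eq_zero t.heart_admissible

attribute [instance] heartAbelian

lemma exists_triangle_of_epi {X Y : t.heart.FullSubcategory} (f : X ⟶ Y) [Epi f] :
    ∃ (K : t.heart.FullSubcategory) (i : K ⟶ X) (δ : Y.obj ⟶ K.obj⟦(1 : ℤ)⟧),
      Triangle.mk i.hom f.hom δ ∈ distTriang C :=
  AbelianSubcategory.exists_distinguished_triangle_of_epi t.heart_hom_eq_zero t.heart_admissible f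

lemma exists_triangle_of_mono [IsTriangulated C] {X Y : t.heart.FullSubcategory} (f : X ⟶ Y)
    [Mono f] : ∃ (Q : t.heart.FullSubcategory) (p : Y ⟶ Q) (δ : Q.obj ⟶ X.obj⟦(1 : ℤ)⟧),
      Triangle.mk f.hom p.hom δ ∈ distTriang C := by
  obtain ⟨K, i, δ, h⟩ := t.exists_triangle_of_epi (cokernel.π f)
  have hi := AbelianSubcategory.isLimitKernelForkOfDistTriang t.heart_hom_eq_zero i
    (cokernel.π f) δ h
  have hf := Abelian.monoIsKernelOfCokernel _ (cokernelIsCokernel f)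
  let e : X ≅ K := hf.conePointUniqueUpToIso hi
  have he : e.hom ≫ i = f := hf.conePointUniqueUpToIso_hom_comp hi .zero
  let e' : X.obj ≅ K.obj := t.heart.ι.mapIso e
  have he' : e'.hom ≫ i.hom = f.hom := congrArg (·.hom) he
  refine ⟨_, cokernel.π f, δ ≫ e'.inv⟦(1 : ℤ)⟧', ?_⟩
  refine isomorphic_distinguished _ h _ (Triangle.isoMk _ _ e' (Iso.refl _) (Iso.refl _) ?_ ?_ ?_)
  · exact (Category.comp_id _).trans he'.symm
  · exact (Category.comp_id _).trans (Category.id_comp _).symm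
  · change (δ ≫ e'.inv⟦(1 : ℤ)⟧') ≫ e'.hom⟦(1 : ℤ)⟧' = 𝟙 _ ≫ δ
    rw [Category.assoc, ← Functor.map_comp, e'.inv_hom_id, Functor.map_id, Category.comp_id,
      Category.id_comp]

lemma mono_of_triangle {X Y Z : t.heart.FullSubcategory} (f : X ⟶ Y) (g : Y ⟶ Z)
    (δ : Z.obj ⟶ X.obj⟦(1 : ℤ)⟧) (h : Triangle.mk f.hom g.hom δ ∈ distTriang C) : Mono f :=
  mono_of_isLimit_fork
    (AbelianSubcategory.isLimitKernelForkOfDistTriang t.heart_hom_eq_zero f g δ h)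

lemma epi_of_triangle {X Y Z : t.heart.FullSubcategory} (f : X ⟶ Y) (g : Y ⟶ Z)
    (δ : Z.obj ⟶ X.obj⟦(1 : ℤ)⟧) (h : Triangle.mk f.hom g.hom δ ∈ distTriang C) : Epi g :=
  epi_of_isColimit_cofork
    (AbelianSubcategory.isColimitCokernelCoforkOfDistTriang t.heart_hom_eq_zero f g δ h)

end Heart
end CategoryTheory.Triangulated.TStructure

/-! ### Degrees of geometric motives -/

section Subcategory
variable {C : Type u} [Category.{v} C] [Preadditive C] [HasZeroObject C] [HasShift C ℤ]
  [∀ n : ℤ, (shiftFunctor C n).Additive] [Pretriangulated C] (P : ObjectProperty C)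
  [P.IsTriangulated]

/-- A distinguished triangle all of whose objects lie in a triangulated subcategory. -/
lemma exists_triangle_fullSubcategory {X Y Z : C} {f : X ⟶ Y} {g : Y ⟶ Z} {h : Z ⟶ X⟦(1 : ℤ)⟧}
    (hT : Triangle.mk f g h ∈ distTriang C) (hX : P X) (hY : P Y) (hZ : P Z) :
    ∃ h' : (⟨Z, hZ⟩ : P.FullSubcategory) ⟶ (⟨X, hX⟩ : P.FullSubcategory)⟦(1 : ℤ)⟧,
      Triangle.mk (ObjectProperty.homMk f : (⟨X, hX⟩ : P.FullSubcategory) ⟶ ⟨Y, hY⟩)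
        (ObjectProperty.homMk g : _ ⟶ (⟨Z, hZ⟩ : P.FullSubcategory)) h' ∈
          distTriang P.FullSubcategory := by
  refine ⟨P.fullyFaithfulι.preimage
    (h ≫ (P.ι.commShiftIso (1 : ℤ)).inv.app (⟨X, hX⟩ : P.FullSubcategory)),
    isomorphic_distinguished _ hT _
      (Triangle.isoMk _ _ (Iso.refl _) (Iso.refl _) (Iso.refl _) ?_ ?_ ?_)⟩
  · exact (Category.comp_id _).trans (Category.id_comp _).symm
  · exact (Category.comp_id _).trans (Category.id_comp _).symm
  · have e : ((h ≫ (P.ι.commShiftIso (1 : ℤ)).inv.app (⟨X, hX⟩ : P.FullSubcategory)) ≫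
        (P.ι.commShiftIso (1 : ℤ)).hom.app (⟨X, hX⟩ : P.FullSubcategory)) = h := by
      rw [Category.assoc, Iso.inv_hom_id_app]
      exact Category.comp_id _
    exact ((congrArg (_ ≫ ·) ((shiftFunctor C (1 : ℤ)).map_id X)).trans (Category.comp_id _)).trans
      (e.trans (Category.id_comp h).symm)

lemma triangle_ι {X Y Z : P.FullSubcategory} {f : X ⟶ Y} {g : Y ⟶ Z} {h : Z ⟶ X⟦(1 : ℤ)⟧}
    (hT : Triangle.mk f g h ∈ distTriang P.FullSubcategory) :
    ∃ h' : Z.obj ⟶ X.obj⟦(1 : ℤ)⟧, Triangle.mk f.hom g.hom h' ∈ distTriang C :=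
  ⟨_, hT⟩

end Subcategory

namespace TStructuresAndWeights
variable {F : Type} [Field F] [NumberField F] (D : TStructuresAndWeights.{v, u} F) {S : Sch F}
variable {D} {M N K : D.DM S} {a b n : ℤ}

lemma LE.of_iso (h : D.LE M n) (e : M ≅ N) : D.LE N n :=
  ⟨(compactObjects _).prop_of_iso e h.1, by
    have := h.2
    exact (D.t S).isLE_of_iso ((compactObjects _).isoMk (X := ⟨M, h.1⟩)
      (Y := ⟨N, (compactObjects _).prop_of_iso e h.1⟩) e) n⟩

lemma GE.of_iso (h : D.GE M n) (e : M ≅ N) : D.GE N n :=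
  ⟨(compactObjects _).prop_of_iso e h.1, by
    have := h.2
    exact (D.t S).isGE_of_iso ((compactObjects _).isoMk (X := ⟨M, h.1⟩)
      (Y := ⟨N, (compactObjects _).prop_of_iso e h.1⟩) e) n⟩

lemma LE.mono (h : D.LE M a) (hab : a ≤ b) : D.LE M b :=
  ⟨h.1, by have := h.2; exact (D.t S).isLE_of_le _ a b⟩

lemma GE.anti (h : D.GE M b) (hab : a ≤ b) : D.GE M a :=
  ⟨h.1, by have := h.2; exact (D.t S).isGE_of_ge _ a b⟩

lemma LE.shift (h : D.LE M n) (a b : ℤ) (hab : a + b = n) : D.LE (M⟦a⟧) b :=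
  ⟨(compactObjects (D.DM S)).le_shift a _ h.1, by
    have := h.2
    have := (D.t S).isLE_shift (⟨M, h.1⟩ : D.Gm S) n a b hab
    exact (D.t S).isLE_of_iso ((compactObjects (D.DM S)).isoMk (Y := ⟨M⟦a⟧, _⟩)
      (((compactObjects (D.DM S)).ι.commShiftIso a).app (⟨M, h.1⟩ : D.Gm S))) b⟩

lemma GE.shift (h : D.GE M n) (a b : ℤ) (hab : a + b = n) : D.GE (M⟦a⟧) b :=
  ⟨(compactObjects (D.DM S)).le_shift a _ h.1, by
    have := h.2
    have := (D.t S).isGE_shift (⟨M, h.1⟩ : D.Gm S) n a b hab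
    exact (D.t S).isGE_of_iso ((compactObjects (D.DM S)).isoMk (Y := ⟨M⟦a⟧, _⟩)
      (((compactObjects (D.DM S)).ι.commShiftIso a).app (⟨M, h.1⟩ : D.Gm S))) b⟩

lemma LE.of_shift (a b : ℤ) (h : D.LE (M⟦a⟧) b) (hab : a + b = n) : D.LE M n :=
  (h.shift (-a) n (by omega)).of_iso ((shiftEquiv (D.DM S) a).unitIso.app M).symm

lemma GE.of_shift (a b : ℤ) (h : D.GE (M⟦a⟧) b) (hab : a + b = n) : D.GE M n :=
  (h.shift (-a) n (by omega)).of_iso ((shiftEquiv (D.DM S) a).unitIso.app M).symm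

lemma hom_eq_zero (hM : D.LE M a) (hN : D.GE N b) (hab : a < b) (f : M ⟶ N) : f = 0 := by
  have := hM.2
  have := hN.2
  exact congrArg (·.hom) ((D.t S).zero
    (ObjectProperty.homMk f : (⟨M, hM.1⟩ : D.Gm S) ⟶ ⟨N, hN.1⟩) a b hab)

section Triangle
variable {f : M ⟶ N} {g : N ⟶ K} {h : K ⟶ M⟦(1 : ℤ)⟧}
  (hT : Triangle.mk f g h ∈ distTriang (D.DM S))
include hT

lemma LE.obj₂ (h₁ : D.LE M n) (h₃ : D.LE K n) : D.LE N n := by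
  have hN : compactObjects _ N :=
    (compactObjects (D.DM S)).ext_of_isTriangulatedClosed₂ _ hT h₁.1 h₃.1
  obtain ⟨h', hT'⟩ := exists_triangle_fullSubcategory _ hT h₁.1 hN h₃.1
  exact ⟨hN, (D.t S).isLE₂ _ hT' n h₁.2 h₃.2⟩

lemma GE.obj₂ (h₁ : D.GE M n) (h₃ : D.GE K n) : D.GE N n := by
  have hN : compactObjects _ N :=
    (compactObjects (D.DM S)).ext_of_isTriangulatedClosed₂ _ hT h₁.1 h₃.1
  obtain ⟨h', hT'⟩ := exists_triangle_fullSubcategory _ hT h₁.1 hN h₃.1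
  exact ⟨hN, (D.t S).isGE₂ _ hT' n h₁.2 h₃.2⟩

lemma LE.obj₃ (h₁ : D.LE M (n + 1)) (h₂ : D.LE N n) : D.LE K n :=
  LE.obj₂ (rot_of_distTriang _ hT) h₂ (h₁.shift 1 n (by omega))

lemma GE.obj₁ (h₂ : D.GE N n) (h₃ : D.GE K (n - 1)) : D.GE M n :=
  GE.obj₂ (inv_rot_of_distTriang _ hT) (h₃.shift (-1) n (by omega)) h₂

end Triangle

lemma LE.of_isZero (h : IsZero M) : D.LE M n := by
  have hc : compactObjects (D.DM S) M := (compactObjects _).prop_of_isZero h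
  exact ⟨hc, (D.t S).isLE_of_isZero ((IsZero.iff_id_eq_zero _).2
    (ObjectProperty.hom_ext _ (h.eq_of_src _ _))) n⟩

lemma GE.of_isZero (h : IsZero M) : D.GE M n := by
  have hc : compactObjects (D.DM S) M := (compactObjects _).prop_of_isZero h
  exact ⟨hc, (D.t S).isGE_of_isZero ((IsZero.iff_id_eq_zero _).2
    (ObjectProperty.hom_ext _ (h.eq_of_src _ _))) n⟩

lemma isZero_of_LE_GE (h₁ : D.LE M a) (h₂ : D.GE M b) (hab : a < b) : IsZero M :=
  (IsZero.iff_id_eq_zero _).2 (hom_eq_zero h₁ h₂ hab _)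

variable (D) in
/-- Truncation of a geometric motive. -/
lemma exists_truncation (hM : compactObjects _ M) (n : ℤ) :
    ∃ (A B : D.DM S) (f : A ⟶ M) (g : M ⟶ B) (h : B ⟶ A⟦(1 : ℤ)⟧),
      Triangle.mk f g h ∈ distTriang (D.DM S) ∧ D.LE A n ∧ D.GE B (n + 1) := by
  obtain ⟨A, B, hA, hB, f, g, h, hT⟩ := (D.t S).exists_triangle ⟨M, hM⟩ n (n + 1) rfl
  obtain ⟨h', hT'⟩ := triangle_ι _ hT
  exact ⟨A.obj, B.obj, f.hom, g.hom, h', hT', ⟨A.property, ⟨hA⟩⟩, ⟨B.property, ⟨hB⟩⟩⟩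

lemma IsMixed.of_iso (h : D.IsMixed M) (e : M ≅ N) : D.IsMixed N := ⟨h.1.of_iso e, h.2.of_iso e⟩

lemma isMixed_obj (M : D.MM S) : D.IsMixed M.obj.obj :=
  ⟨⟨M.obj.property, ((D.t S).mem_heart_iff _).1 M.property |>.1⟩,
    ⟨M.obj.property, ((D.t S).mem_heart_iff _).1 M.property |>.2⟩⟩

lemma exists_triangle_of_epi {M N : D.MM S} (f : M ⟶ N) [Epi f] :
    ∃ (K : D.MM S) (i : K ⟶ M) (δ : N.obj.obj ⟶ K.obj.obj⟦(1 : ℤ)⟧),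
      Triangle.mk i.hom.hom f.hom.hom δ ∈ distTriang (D.DM S) := by
  obtain ⟨K, i, δ, h⟩ := (D.t S).exists_triangle_of_epi f
  exact ⟨K, i, triangle_ι _ h⟩

lemma exists_triangle_of_mono {M N : D.MM S} (f : M ⟶ N) [Mono f] :
    ∃ (Q : D.MM S) (p : N ⟶ Q) (δ : Q.obj.obj ⟶ M.obj.obj⟦(1 : ℤ)⟧),
      Triangle.mk f.hom.hom p.hom.hom δ ∈ distTriang (D.DM S) := by
  obtain ⟨K, i, δ, h⟩ := (D.t S).exists_triangle_of_mono f
  exact ⟨K, i, triangle_ι _ h⟩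

lemma mono_of_triangle {M N K : D.MM S} (f : M ⟶ N) (g : N ⟶ K)
    (δ : K.obj.obj ⟶ M.obj.obj⟦(1 : ℤ)⟧)
    (h : Triangle.mk f.hom.hom g.hom.hom δ ∈ distTriang (D.DM S)) : Mono f := by
  obtain ⟨h', hT'⟩ := exists_triangle_fullSubcategory _ h M.obj.2 N.obj.2 K.obj.2
  exact (D.t S).mono_of_triangle f g h' hT'

lemma epi_of_triangle {M N K : D.MM S} (f : M ⟶ N) (g : N ⟶ K)
    (δ : K.obj.obj ⟶ M.obj.obj⟦(1 : ℤ)⟧)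
    (h : Triangle.mk f.hom.hom g.hom.hom δ ∈ distTriang (D.DM S)) : Epi g := by
  obtain ⟨h', hT'⟩ := exists_triangle_fullSubcategory _ h M.obj.2 N.obj.2 K.obj.2
  exact (D.t S).epi_of_triangle f g h' hT'

end TStructuresAndWeights

/-! ### Cohomology motives -/

section Pretriangulated
variable {C : Type u} [Category.{v} C] [Preadditive C] [HasZeroObject C] [HasShift C ℤ]
  [∀ n : ℤ, (shiftFunctor C n).Additive] [Pretriangulated C]

lemma distinguished_of_iso {X Y Z X' Y' Z' : C} {f : X ⟶ Y} {g : Y ⟶ Z} {h : Z ⟶ X⟦(1 : ℤ)⟧}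
    (hT : Triangle.mk f g h ∈ distTriang C) (a : X ≅ X') (b : Y ≅ Y') (c : Z ≅ Z')
    (f' : X' ⟶ Y') (g' : Y' ⟶ Z') (hf : f ≫ b.hom = a.hom ≫ f') (hg : g ≫ c.hom = b.hom ≫ g') :
    ∃ h', Triangle.mk f' g' h' ∈ distTriang C := by
  refine ⟨c.inv ≫ h ≫ a.hom⟦(1 : ℤ)⟧', isomorphic_distinguished _ hT _
    (Triangle.isoMk _ _ a b c hf hg ?_).symm⟩
  exact (Iso.hom_inv_id_assoc c _).symm

lemma shift_distinguished {X Y Z : C} {f : X ⟶ Y} {g : Y ⟶ Z} {h : Z ⟶ X⟦(1 : ℤ)⟧}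
    (hT : Triangle.mk f g h ∈ distTriang C) (n : ℤ) :
    ∃ h', Triangle.mk (f⟦n⟧') (g⟦n⟧') h' ∈ distTriang C := by
  have h' := Triangle.shift_distinguished _ hT n
  change Triangle.mk (n.negOnePow • f⟦n⟧') (n.negOnePow • g⟦n⟧') _ ∈ _ at h'
  refine distinguished_of_iso h' (Iso.refl (X⟦n⟧))
    (n.negOnePow • Iso.refl (Y⟦n⟧)) (Iso.refl (Z⟦n⟧)) _ _ ?_ ?_
  · simp [smul_smul]
  · simp

lemma map_distinguished {E : Type*} [Category* E] [Preadditive E] [HasZeroObject E] [HasShift E ℤ]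
    [∀ n : ℤ, (shiftFunctor E n).Additive] [Pretriangulated E] (G : C ⥤ E) [G.CommShift ℤ]
    [G.IsTriangulated] {X Y Z : C} {f : X ⟶ Y} {g : Y ⟶ Z} {h : Z ⟶ X⟦(1 : ℤ)⟧}
    (hT : Triangle.mk f g h ∈ distTriang C) :
    ∃ h', Triangle.mk (G.map f) (G.map g) h' ∈ distTriang E :=
  ⟨_, G.map_distinguished _ hT⟩

end Pretriangulated

namespace TStructuresAndWeights
variable {F : Type} [Field F] [NumberField F] (D : TStructuresAndWeights.{v, u} F) {S S' : Sch F}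

/-- The cohomology functor `ᵖHⁿ`. -/
def pHFunctor (S : Sch F) (n : ℤ) : D.Gm S ⥤ D.MM S :=
  (D.t S).heart.lift ((D.t S).truncGELE n n ⋙ shiftFunctor _ n) fun M => (D.pH M n).property

instance (n : ℤ) : (D.pHFunctor S n).Additive where
  map_add {X Y f g} := by
    refine ObjectProperty.hom_ext _ ?_
    change ((D.t S).truncGELE n n ⋙ shiftFunctor _ n).map (f + g) = _
    dsimp only [TStructure.truncGELE]
    rw [Functor.map_add]
    rfl

/-- `K` is the `n`-th cohomology motive of `M`, exhibited by distinguished triangles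
`A → M → B` and `C → A → K[-n]`, where `B` is in degrees `> n` and `C` is in degrees `< n`. -/
def IsCohomology (M : D.DM S) (n : ℤ) (K : D.DM S) : Prop :=
  D.IsMixed K ∧ ∃ (A B C : D.DM S) (i : A ⟶ M) (q : M ⟶ B) (δ : B ⟶ A⟦(1 : ℤ)⟧)
    (j : C ⟶ A) (p : A ⟶ K⟦-n⟧) (δ' : K⟦-n⟧ ⟶ C⟦(1 : ℤ)⟧),
    Triangle.mk i q δ ∈ distTriang (D.DM S) ∧ Triangle.mk j p δ' ∈ distTriang (D.DM S) ∧
      D.GE B (n + 1) ∧ D.LE C (n - 1)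

open ZeroObject

variable {D} {M N K L : D.DM S} {n : ℤ}

/-- Two truncations of isomorphic motives are isomorphic. -/
lemma truncation_unique {A B M A' B' M' : D.DM S} {i : A ⟶ M} {q : M ⟶ B} {δ : B ⟶ A⟦(1 : ℤ)⟧}
    {i' : A' ⟶ M'} {q' : M' ⟶ B'} {δ' : B' ⟶ A'⟦(1 : ℤ)⟧}
    (h : Triangle.mk i q δ ∈ distTriang (D.DM S)) (h' : Triangle.mk i' q' δ' ∈ distTriang (D.DM S))
    (hA : D.LE A n) (hB : D.GE B (n + 1)) (hA' : D.LE A' n) (hB' : D.GE B' (n + 1))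
    (e : M ≅ M') : ∃ (a : A ≅ A') (b : B ≅ B'), a.hom ≫ i' = i ≫ e.hom ∧ q ≫ b.hom = e.hom ≫ q' := by
  have hM := (compactObjects (D.DM S)).ext_of_isTriangulatedClosed₂ _ h hA.1 hB.1
  have hM' := (compactObjects (D.DM S)).ext_of_isTriangulatedClosed₂ _ h' hA'.1 hB'.1
  obtain ⟨_, hT⟩ := exists_triangle_fullSubcategory _ h hA.1 hM hB.1
  obtain ⟨_, hT'⟩ := exists_triangle_fullSubcategory _ h' hA'.1 hM' hB'.1
  obtain ⟨E, hE⟩ := (D.t S).triangle_iso_exists hT hT'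
    ((compactObjects (D.DM S)).isoMk (X := ⟨M, hM⟩) (Y := ⟨M', hM'⟩) e) n (n + 1)
    hA.2 hB.2 hA'.2 hB'.2
  refine ⟨(compactObjects (D.DM S)).ι.mapIso (Triangle.π₁.mapIso E),
    (compactObjects (D.DM S)).ι.mapIso (Triangle.π₃.mapIso E), ?_, ?_⟩
  · have := congrArg (·.hom) E.hom.comm₁
    rw [hE] at this
    exact this.symm
  · have := congrArg (·.hom) E.hom.comm₂
    rw [hE] at this
    exact this

lemma IsCohomology.le {A C : D.DM S} {j : C ⟶ A} {p : A ⟶ K⟦-n⟧}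
    {δ' : K⟦-n⟧ ⟶ C⟦(1 : ℤ)⟧} (hT : Triangle.mk j p δ' ∈ distTriang (D.DM S)) (hK : D.IsMixed K)
    (hC : D.LE C (n - 1)) : D.LE A n :=
  LE.obj₂ hT (hC.mono (by omega)) (hK.1.shift (-n) n (by omega))

/-- The cohomology motive is unique up to isomorphism. -/
lemma IsCohomology.unique (h : D.IsCohomology M n K) (h' : D.IsCohomology N n L) (e : M ≅ N) :
    Nonempty (K ≅ L) := by
  obtain ⟨hK, A, B, C, i, q, δ, j, p, δ', hT₁, hT₂, hB, hC⟩ := h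
  obtain ⟨hK', A', B', C', i', q', ε, j', p', ε', hT₁', hT₂', hB', hC'⟩ := h'
  obtain ⟨a, -, -, -⟩ := truncation_unique hT₁ hT₁' (IsCohomology.le hT₂ hK hC) hB
    (IsCohomology.le hT₂' hK' hC') hB' e
  obtain ⟨-, b, -, -⟩ := truncation_unique hT₂ hT₂' hC
    ((hK.2.shift (-n) n (by omega)).anti (by omega)) hC'
    ((hK'.2.shift (-n) n (by omega)).anti (by omega)) a
  exact ⟨(shiftFunctor (D.DM S) (-n)).preimageIso b⟩

lemma IsCohomology.of_iso (h : D.IsCohomology M n K) (e : M ≅ N) (e' : K ≅ L) :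
    D.IsCohomology N n L := by
  obtain ⟨hK, A, B, C, i, q, δ, j, p, δ', hT₁, hT₂, hB, hC⟩ := h
  obtain ⟨ε, h₁⟩ := distinguished_of_iso hT₁ (Iso.refl _) e (Iso.refl _) (i ≫ e.hom) (e.inv ≫ q)
    (by simp) (by simp)
  obtain ⟨ε', h₂⟩ := distinguished_of_iso hT₂ (Iso.refl _) (Iso.refl _)
    ((shiftFunctor _ (-n)).mapIso e') j (p ≫ e'.hom⟦-n⟧') (by simp) (by simp)
  exact ⟨hK.of_iso e', A, B, C, _, _, ε, _, _, ε', h₁, h₂, hB, hC⟩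

lemma IsCohomology.shift (h : D.IsCohomology M n K) (k m : ℤ) (hm : m + k = n) :
    D.IsCohomology (M⟦k⟧) m K := by
  obtain ⟨hK, A, B, C, i, q, δ, j, p, δ', hT₁, hT₂, hB, hC⟩ := h
  obtain ⟨ε, h₁⟩ := shift_distinguished hT₁ k
  obtain ⟨ε', h₂⟩ := shift_distinguished hT₂ k
  obtain ⟨ε', h₂⟩ := distinguished_of_iso h₂ (Iso.refl _) (Iso.refl _)
    ((shiftFunctorAdd' (D.DM S) (-n) k (-m) (by omega)).symm.app K) (j⟦k⟧')
    (p⟦k⟧' ≫ (shiftFunctorAdd' (D.DM S) (-n) k (-m) (by omega)).inv.app K) (by simp) (by simp)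
  exact ⟨hK, _, _, _, _, _, ε, _, _, ε', h₁, h₂, hB.shift _ _ (by omega),
    hC.shift _ _ (by omega)⟩

/-- A functor of cohomological amplitude `[a, a]` shifts the cohomology by `a`. -/
lemma IsCohomology.map (h : D.IsCohomology M n K) (G : D.DM S ⥤ D.DM S') [G.CommShift ℤ]
    [G.IsTriangulated] {a : ℤ} (hG : D.Amplitude G a a) (m : ℤ) (hm : n + a = m) :
    D.IsCohomology (G.obj M) m ((G.obj K)⟦a⟧) := by
  obtain ⟨hK, A, B, C, i, q, δ, j, p, δ', hT₁, hT₂, hB, hC⟩ := h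
  obtain ⟨ε, h₁⟩ := map_distinguished G hT₁
  obtain ⟨ε', h₂⟩ := map_distinguished G hT₂
  let e : G.obj (K⟦-n⟧) ≅ (G.obj K)⟦a⟧⟦-m⟧ := (G.commShiftIso (-n)).app K ≪≫
    (shiftFunctorAdd' (D.DM S') a (-m) (-n) (by omega)).app _
  obtain ⟨ε', h₂⟩ := distinguished_of_iso h₂ (Iso.refl _) (Iso.refl _) e (G.map j) (G.map p ≫ e.hom)
    (by simp) (by simp)
  exact ⟨⟨((hG _ _).2 hK.1).shift _ _ (by omega), ((hG _ _).1 hK.2).shift _ _ (by omega)⟩,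
    _, _, _, _, _, ε, _, _, ε', h₁, h₂, ((hG _ _).1 hB).anti (by omega),
    ((hG _ _).2 hC).mono (by omega)⟩

lemma IsCohomology.of_isMixed (h : D.IsMixed K) : D.IsCohomology K 0 K := by
  obtain ⟨δ, hT⟩ := distinguished_of_iso (contractible_distinguished₁ K) (Iso.refl 0) (Iso.refl K)
    ((shiftFunctorZero (D.DM S) ℤ).symm.app K) 0 ((shiftFunctorZero (D.DM S) ℤ).inv.app K)
    (by simp) (by simp)
  exact ⟨h, K, 0, 0, 𝟙 _, 0, 0, 0, _, δ, contractible_distinguished K, hT,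
    GE.of_isZero (isZero_zero _), LE.of_isZero (isZero_zero _)⟩

lemma isMixed_zero : D.IsMixed (0 : D.DM S) :=
  ⟨LE.of_isZero (isZero_zero _), GE.of_isZero (isZero_zero _)⟩

lemma IsCohomology.of_le (h : D.LE M (n - 1)) : D.IsCohomology M n 0 := by
  have hz : IsZero ((0 : D.DM S)⟦-n⟧) := (shiftFunctor _ (-n)).map_isZero (isZero_zero _)
  obtain ⟨δ, hT⟩ := distinguished_of_iso (contractible_distinguished M) (Iso.refl M) (Iso.refl M)
    ((isZero_zero _).iso hz) (𝟙 M) 0 (by simp) (by simp)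
  exact ⟨isMixed_zero, M, 0, M, 𝟙 _, 0, 0, 𝟙 _, 0, δ, contractible_distinguished M, hT,
    GE.of_isZero (isZero_zero _), h⟩

lemma IsCohomology.of_ge (h : D.GE M (n + 1)) : D.IsCohomology M n 0 := by
  have hz : IsZero ((0 : D.DM S)⟦-n⟧) := (shiftFunctor _ (-n)).map_isZero (isZero_zero _)
  obtain ⟨δ, hT⟩ := distinguished_of_iso (contractible_distinguished (0 : D.DM S)) (Iso.refl 0)
    (Iso.refl 0) ((isZero_zero _).iso hz) (𝟙 0) 0 (by simp) (by simp)
  exact ⟨isMixed_zero, 0, M, 0, 0, 𝟙 _, 0, 𝟙 _, 0, δ, contractible_distinguished₁ M, hT, h,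
    LE.of_isZero (isZero_zero _)⟩

/-- The cohomology motives of the `t`-structure satisfy `IsCohomology`. -/
lemma isCohomology_pH (M : D.Gm S) (n : ℤ) : D.IsCohomology M.obj n (D.pH M n).obj.obj := by
  obtain ⟨δ, h₁⟩ := triangle_ι _ ((D.t S).triangleLEGE_distinguished n (n + 1) rfl M)
  obtain ⟨δ', h₂⟩ := triangle_ι _ ((D.t S).triangleLEGE_distinguished (n - 1) n (by omega)
    (((D.t S).truncLE n).obj M))
  let e : (((D.t S).truncGE n).obj (((D.t S).truncLE n).obj M)).obj ≅
      (D.pH M n).obj.obj⟦-n⟧ :=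
    (shiftFunctorCompIsoId (D.DM S) n (-n) (by omega)).symm.app _ ≪≫
      (shiftFunctor _ (-n)).mapIso
        (((compactObjects (D.DM S)).ι.commShiftIso n).symm.app
          (((D.t S).truncGELE n n).obj M))
  obtain ⟨δ', h₂⟩ := distinguished_of_iso h₂ (Iso.refl _) (Iso.refl _) e _ (_ ≫ e.hom)
    (by exact (Category.comp_id _).trans (Category.id_comp _).symm)
    (by exact (Category.id_comp _).symm)
  exact ⟨isMixed_obj _, _, _, _, _, _, _, _, _, _, h₁, h₂,
    ⟨((D.t S).truncGE (n + 1)).obj M |>.property,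
      inferInstanceAs ((D.t S).IsGE (((D.t S).truncGE (n + 1)).obj M) (n + 1))⟩,
    ⟨((D.t S).truncLE (n - 1)).obj (((D.t S).truncLE n).obj M) |>.property,
      inferInstanceAs ((D.t S).IsLE (((D.t S).truncLE (n - 1)).obj (((D.t S).truncLE n).obj M))
        (n - 1))⟩⟩

lemma mm_iso {M N : D.MM S} (e : M.obj.obj ≅ N.obj.obj) : Nonempty (M ≅ N) :=
  ⟨(D.t S).heart.isoMk ((compactObjects _).isoMk e)⟩

/-- Cohomology motives may be computed from arbitrary truncation triangles. -/
lemma IsCohomology.pH_iso {M : D.Gm S} {K : D.MM S} (h : D.IsCohomology M.obj n K.obj.obj) :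
    Nonempty (D.pH M n ≅ K) :=
  ((isCohomology_pH M n).unique h (Iso.refl _)).elim mm_iso

end TStructuresAndWeights

/-! ### Weights of mixed motives -/

namespace TStructuresAndWeights
variable {F : Type} [Field F] [NumberField F] {D : TStructuresAndWeights.{v, u} F} {S S' : Sch F}

/-- All weights of the mixed motive `M` are at most `n`: the step `W_n M` is all of `M`. -/
def WeightLE (M : D.MM S) (n : ℤ) : Prop := IsIso ((D.weightι S n).app M)

/-- All weights of the mixed motive `M` are at least `n`: the step `W_{n-1} M` vanishes. -/
def WeightGE (M : D.MM S) (n : ℤ) : Prop := IsZero ((D.weight S (n - 1)).obj M)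

lemma weights_eq_of_iso {M N : D.MM S} (e : M ≅ N) : D.weights M = D.weights N := by
  ext n
  simp only [weights, Set.mem_ofPred_eq, NatTrans.isIso_app_iff_of_iso (D.weightStep S (n - 1)) e]

end TStructuresAndWeights

namespace WeightAxioms
open TStructuresAndWeights ZeroObject
variable {F : Type} [Field F] [NumberField F] {D : TStructuresAndWeights.{v, u} F} {S S' : Sch F}
  (W : WeightAxioms D) (hS : IsArithmeticBase S)
include W hS

lemma step_app (n : ℤ) (M : D.MM S) :
    (D.weightStep S n).app M ≫ (D.weightι S (n + 1)).app M = (D.weightι S n).app M :=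
  congrArg (fun f => f.app M) (W.step hS n)

lemma mono_step (n : ℤ) (M : D.MM S) : Mono ((D.weightStep S n).app M) := by
  have := W.mono hS n M
  rw [← W.step_app hS] at this
  exact mono_of_mono _ ((D.weightι S (n + 1)).app M)

lemma weightLE_succ {M : D.MM S} {n : ℤ} (h : WeightLE M n) : WeightLE M (n + 1) := by
  have h : IsIso ((D.weightι S n).app M) := h
  have := W.mono hS (n + 1) M
  have : IsSplitEpi ((D.weightι S (n + 1)).app M) :=
    ⟨⟨inv ((D.weightι S n).app M) ≫ (D.weightStep S n).app M, by
      rw [Category.assoc, W.step_app hS, IsIso.inv_hom_id]⟩⟩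
  exact isIso_of_mono_of_isSplitEpi _

lemma weightLE_mono {M : D.MM S} {n m : ℤ} (h : WeightLE M n) (hnm : n ≤ m) : WeightLE M m := by
  induction m, hnm using Int.leInduction with
  | base => exact h
  | succ m _ ih => exact W.weightLE_succ hS ih

lemma isZero_weight_mono {M : D.MM S} {n m : ℤ} (h : IsZero ((D.weight S m).obj M)) (hnm : n ≤ m) :
    IsZero ((D.weight S n).obj M) := by
  induction n, hnm using Int.leInductionDown with
  | base => exact h
  | pred n _ ih =>
    have := W.mono_step hS (n - 1) M
    exact IsZero.of_mono ((D.weightStep S (n - 1)).app M) (by rwa [sub_add_cancel])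

lemma weightLE_iff {M : D.MM S} {n : ℤ} : WeightLE M n ↔ ∀ w ∈ D.weights M, w ≤ n := by
  constructor
  · intro h w hw
    by_contra! hlt
    have h₁ : IsIso ((D.weightι S (w - 1)).app M) := W.weightLE_mono hS h (by omega)
    have h₂ : IsIso ((D.weightι S (w - 1 + 1)).app M) := W.weightLE_mono hS h (by omega)
    rw [← W.step_app hS] at h₁
    exact hw (IsIso.of_isIso_comp_right _ ((D.weightι S (w - 1 + 1)).app M))
  · intro h
    obtain ⟨-, b, -, hb⟩ := W.finite hS M
    have hb : WeightLE M b := hb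
    by_cases hbn : b ≤ n
    · exact W.weightLE_mono hS hb hbn
    · have hnb : n ≤ b := by omega
      clear hbn
      induction n, hnb using Int.leInductionDown with
      | base => exact hb
      | pred n _ ih =>
        have ih : IsIso ((D.weightι S n).app M) := ih fun w hw => (h w hw).trans (by omega)
        have hstep : IsIso ((D.weightStep S (n - 1)).app M) := by
          by_contra hn
          have := h n hn
          omega
        have e := W.step_app hS (n - 1) M
        unfold WeightLE
        rw [← e]
        have : IsIso ((D.weightι S (n - 1 + 1)).app M) := by rwa [sub_add_cancel]
        infer_instance

lemma weightGE_iff {M : D.MM S} {n : ℤ} : WeightGE M n ↔ ∀ w ∈ D.weights M, n ≤ w := by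
  constructor
  · intro h w hw
    by_contra! hlt
    refine hw (IsZero.isIso (W.isZero_weight_mono hS h (by omega))
      (W.isZero_weight_mono hS h (by omega)) _)
  · intro h
    obtain ⟨a, -, ha, -⟩ := W.finite hS M
    by_cases han : n - 1 ≤ a
    · exact W.isZero_weight_mono hS ha han
    · have key : ∀ m, a ≤ m → m ≤ n - 1 → IsZero ((D.weight S m).obj M) := by
        intro m ham
        induction m, ham using Int.leInduction with
        | base => exact fun _ => ha
        | succ m _ ih =>
          intro hm
          have hstep : IsIso ((D.weightStep S (m + 1 - 1)).app M) := by
            by_contra hn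
            have := h (m + 1) hn
            omega
          rw [add_sub_cancel_right] at hstep
          exact (ih (by omega)).of_iso (asIso ((D.weightStep S m).app M)).symm
      exact key _ (by omega) le_rfl

lemma weightGE_of_mono {M N : D.MM S} (f : M ⟶ N) [Mono f] {n : ℤ} (h : WeightGE N n) :
    WeightGE M n := by
  have := W.mono hS (n - 1) M
  have hz : (D.weightι S (n - 1)).app M = 0 := by
    rw [← cancel_mono f, zero_comp]
    exact ((D.weightι S (n - 1)).naturality f).symm.trans
      ((congrArg (· ≫ _) (h.eq_of_tgt _ 0)).trans zero_comp)
  exact IsZero.of_mono_eq_zero _ hz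

lemma weightLE_of_epi {M N : D.MM S} (f : M ⟶ N) [Epi f] {n : ℤ} (h : WeightLE M n) :
    WeightLE N n := by
  have := W.mono hS n N
  have h : IsIso ((D.weightι S n).app M) := h
  have e : (D.weight S n).map f ≫ (D.weightι S n).app N = (D.weightι S n).app M ≫ f :=
    (D.weightι S n).naturality f
  have : Epi ((D.weight S n).map f ≫ (D.weightι S n).app N) := by
    rw [e]
    exact epi_comp _ _
  have : Epi ((D.weightι S n).app N) := epi_of_epi ((D.weight S n).map f) _
  exact isIso_of_mono_of_epi _

/-- Strictness passes the condition on the weights to subobjects. -/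
lemma weightLE_of_mono {M N : D.MM S} (f : M ⟶ N) [Mono f] {n : ℤ} (h : WeightLE N n) :
    WeightLE M n := by
  have := W.mono hS n M
  have h : IsIso ((D.weightι S n).app N) := h
  obtain ⟨T, e, he, c, hc⟩ := W.strict hS f n (f ≫ inv ((D.weightι S n).app N)) (𝟙 M) (by simp)
  have hce : c ≫ (D.weightι S n).app M = e := by
    rw [← cancel_mono f, Category.assoc, hc]
    simp
  have : Epi (c ≫ (D.weightι S n).app M) := hce ▸ he
  have : Epi ((D.weightι S n).app M) := epi_of_epi c _
  exact isIso_of_mono_of_epi _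

/-- By strictness, a morphism to a motive of smaller weights factors, up to an epimorphism, through
a vanishing step of the weight filtration of the source. -/
lemma hom_eq_zero_of_gt {M N : D.MM S} {a b : ℤ} (hM : WeightGE M a) (hN : WeightLE N b)
    (hab : b < a) (f : M ⟶ N) : f = 0 := by
  have hN : IsIso ((D.weightι S b).app N) := hN
  obtain ⟨T, e, he, c, hc⟩ := W.strict hS f b (f ≫ inv ((D.weightι S b).app N)) (𝟙 M) (by simp)
  have hc0 : c = 0 := (W.isZero_weight_mono hS hM (by omega)).eq_of_tgt _ _
  rw [hc0, zero_comp] at hc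
  rw [← cancel_epi e, comp_zero]
  simpa using hc.symm

/-- By functoriality of the weight filtration, a morphism to a motive of larger weights factors
through a vanishing step. -/
lemma hom_eq_zero_of_lt {M N : D.MM S} {a b : ℤ} (hM : WeightLE M a) (hN : WeightGE N b)
    (hab : a < b) (f : M ⟶ N) : f = 0 := by
  have hM : IsIso ((D.weightι S a).app M) := hM
  rw [← cancel_epi ((D.weightι S a).app M), comp_zero]
  exact ((D.weightι S a).naturality f).symm.trans
      ((congrArg (· ≫ _) ((W.isZero_weight_mono hS hN (by omega)).eq_of_tgt _ 0)).trans zero_comp)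

/-- Strictness for the inclusion shows that `W_n M` has weights at most `n`. -/
lemma weightLE_weight_obj (n : ℤ) (M : D.MM S) : WeightLE ((D.weight S n).obj M) n := by
  have := W.mono hS n M
  have := W.mono hS n ((D.weight S n).obj M)
  obtain ⟨T, e, he, c, hc⟩ := W.strict hS ((D.weightι S n).app M) n (𝟙 _) (𝟙 _) rfl
  have hce : c ≫ (D.weightι S n).app ((D.weight S n).obj M) = e := by
    rw [← cancel_mono ((D.weightι S n).app M), Category.assoc, hc, Category.id_comp]
    rfl
  have : Epi (c ≫ (D.weightι S n).app ((D.weight S n).obj M)) := hce ▸ he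
  have : Epi ((D.weightι S n).app ((D.weight S n).obj M)) := epi_of_epi c _
  exact isIso_of_mono_of_epi _

/-- The quotient `M / W_n M` has weights greater than `n`. -/
lemma weightGE_of_cokernel {n : ℤ} {M Q : D.MM S} (p : M ⟶ Q) [Epi p]
    (hp : (D.weightι S n).app M ≫ p = 0) : WeightGE Q (n + 1) := by
  have := W.mono hS n Q
  unfold WeightGE
  rw [add_sub_cancel_right]
  refine IsZero.of_mono_eq_zero ((D.weightι S n).app Q) ?_
  obtain ⟨T, e, he, c, hc⟩ := W.strict hS p n (pullback.snd p ((D.weightι S n).app Q))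
    (pullback.fst p ((D.weightι S n).app Q)) pullback.condition
  rw [hp, comp_zero] at hc
  have h : e ≫ pullback.snd p ((D.weightι S n).app Q) ≫ (D.weightι S n).app Q = 0 := hc.symm
  rw [← cancel_epi (pullback.snd p ((D.weightι S n).app Q)), ← cancel_epi e, h, comp_zero,
    comp_zero]

end WeightAxioms

/-! ### Weights of geometric motives and exactness of twists -/

namespace TStructuresAndWeights
variable {F : Type} [Field F] [NumberField F] {D : TStructuresAndWeights.{v, u} F} {S S' : Sch F}
variable {M N : D.DM S} {P Q : ℤ → Prop}
open ZeroObject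

/-- The condition on weights may be tested on arbitrary representatives of the cohomology. -/
lemma weights_iff : D.Weights M P ↔ compactObjects _ M ∧
    ∀ (n : ℤ) (K : D.MM S), D.IsCohomology M n K.obj.obj → ∀ w ∈ D.weights K, P (w - n) := by
  constructor
  · rintro ⟨hM, h⟩
    refine ⟨hM, fun n K hK w hw => h n w ?_⟩
    obtain ⟨e⟩ := IsCohomology.pH_iso (M := ⟨M, hM⟩) hK
    rwa [weights_eq_of_iso e]
  · rintro ⟨hM, h⟩
    exact ⟨hM, fun n => h n _ (isCohomology_pH ⟨M, hM⟩ n)⟩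

lemma Weights.imp (h : D.Weights M P) (hPQ : ∀ w, P w → Q w) : D.Weights M Q :=
  ⟨h.1, fun n w hw => hPQ _ (h.2 n w hw)⟩

lemma Weights.of_iso (h : D.Weights M P) (e : M ≅ N) : D.Weights N P := by
  rw [weights_iff] at h ⊢
  exact ⟨(compactObjects _).prop_of_iso e h.1, fun n K hK => h.2 n K (hK.of_iso e.symm (Iso.refl _))⟩

lemma Weights.shift (h : D.Weights M P) (k : ℤ) (hPQ : ∀ w, P w → Q (w + k)) :
    D.Weights (M⟦k⟧) Q := by
  rw [weights_iff] at h ⊢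
  refine ⟨(compactObjects (D.DM S)).le_shift k _ h.1, fun n K hK w hw => ?_⟩
  have := hPQ _ (h.2 (n + k) K ((hK.shift (-k) (n + k) (by omega)).of_iso
    ((shiftEquiv (D.DM S) k).unitIso.app M).symm (Iso.refl _)) w hw)
  rwa [show w - (n + k) + k = w - n by omega] at this

lemma IsMixed.isZero_of_isCohomology {n : ℤ} {K : D.DM S} (hM : D.IsMixed M)
    (h : D.IsCohomology M n K) (hn : n ≠ 0) : IsZero K := by
  rcases lt_or_gt_of_ne hn with hn | hn
  · obtain ⟨e⟩ := h.unique (IsCohomology.of_ge (hM.2.anti (by omega))) (Iso.refl _)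
    exact (isZero_zero _).of_iso e
  · obtain ⟨e⟩ := h.unique (IsCohomology.of_le (hM.1.mono (by omega))) (Iso.refl _)
    exact (isZero_zero _).of_iso e

lemma isZero_obj_iff {K : D.MM S} : IsZero K.obj.obj ↔ IsZero K := by
  refine ⟨fun h => (IsZero.iff_id_eq_zero _).2 ?_, fun h => (IsZero.iff_id_eq_zero _).2 ?_⟩
  · exact ObjectProperty.hom_ext _ (ObjectProperty.hom_ext _ (h.eq_of_src _ _))
  · exact congrArg (fun f => f.hom.hom) (h.eq_of_src (𝟙 K) 0)

end TStructuresAndWeights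

namespace WeightAxioms
open TStructuresAndWeights ZeroObject
variable {F : Type} [Field F] [NumberField F] {D : TStructuresAndWeights.{v, u} F} {S S' : Sch F}
  (W : WeightAxioms D) (hS : IsArithmeticBase S) {M N : D.DM S} {P Q : ℤ → Prop}

include W hS in
lemma weights_of_isZero {K : D.MM S} (h : IsZero K) (w : ℤ) : w ∉ D.weights K := by
  intro hw
  have key : ∀ n, IsZero ((D.weight S n).obj K) := fun n =>
    have := W.mono hS n K
    IsZero.of_mono ((D.weightι S n).app K) h
  exact hw ((key _).isIso (key _) _)

include W hS in
lemma weights_isMixed_iff (hM : D.IsMixed M) :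
    D.Weights M P ↔ ∀ w ∈ D.weights hM.toMM, P w := by
  rw [weights_iff]
  constructor
  · intro h w hw
    simpa using h.2 0 hM.toMM (IsCohomology.of_isMixed hM) w hw
  · refine fun h => ⟨hM.1.1, fun n K hK w hw => ?_⟩
    by_cases hn : n = 0
    · subst hn
      obtain ⟨e⟩ := hK.unique (IsCohomology.of_isMixed hM) (Iso.refl _)
      obtain ⟨e⟩ := mm_iso (N := hM.toMM) e
      rw [sub_zero]
      exact h w (by rwa [← weights_eq_of_iso e])
    · exact absurd hw (W.weights_of_isZero hS
        (isZero_obj_iff.1 (hM.isZero_of_isCohomology hK hn)) w)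

include W hS in
lemma weightLE_toMM_iff (hM : D.IsMixed M) {n : ℤ} :
    WeightLE hM.toMM n ↔ D.Weights M (· ≤ n) := by
  rw [W.weightLE_iff hS, W.weights_isMixed_iff hS hM]

include W hS in
lemma weightGE_toMM_iff (hM : D.IsMixed M) {n : ℤ} :
    WeightGE hM.toMM n ↔ D.Weights M (n ≤ ·) := by
  rw [W.weightGE_iff hS, W.weights_isMixed_iff hS hM]

include W hS in
lemma mixed_hom_eq_zero_of_gt (hM : D.IsMixed M) (hN : D.IsMixed N) {a b : ℤ}
    (hMa : D.Weights M (a ≤ ·)) (hNb : D.Weights N (· ≤ b)) (hab : b < a) (f : M ⟶ N) : f = 0 :=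
  congrArg (fun f => f.hom.hom) (W.hom_eq_zero_of_gt hS ((W.weightGE_toMM_iff hS hM).2 hMa)
    ((W.weightLE_toMM_iff hS hN).2 hNb) hab
    (ObjectProperty.homMk (ObjectProperty.homMk f) : hM.toMM ⟶ hN.toMM))

include W hS in
lemma mixed_hom_eq_zero_of_lt (hM : D.IsMixed M) (hN : D.IsMixed N) {a b : ℤ}
    (hMa : D.Weights M (· ≤ a)) (hNb : D.Weights N (b ≤ ·)) (hab : a < b) (f : M ⟶ N) : f = 0 :=
  congrArg (fun f => f.hom.hom) (W.hom_eq_zero_of_lt hS ((W.weightLE_toMM_iff hS hM).2 hMa)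
    ((W.weightGE_toMM_iff hS hN).2 hNb) hab
    (ObjectProperty.homMk (ObjectProperty.homMk f) : hM.toMM ⟶ hN.toMM))

include W hS in
/-- Twisting preserves mixed motives: by induction along the weight filtration, this reduces to
the pure case. -/
lemma isMixed_twist (hM : D.IsMixed M) (n : ℤ) : D.IsMixed ((D.twist S n).obj M) := by
  -- induction on the number `k + 1` of possible weights: `W_a M` is pure of weight `a`, and `M /
  -- W_a M` has weights in `[a + 1, a + k]`
  have key : ∀ (k : ℕ) (a : ℤ) (M : D.MM S), WeightGE M a → WeightLE M (a + k) →
      D.IsMixed ((D.twist S n).obj M.obj.obj) := by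
    intro k
    induction k with
    | zero =>
      intro a M h₁ h₂
      refine (W.twist hS M.obj.obj (isMixed_obj M) a n ?_).1
      rw [W.weights_isMixed_iff hS (isMixed_obj M)]
      exact fun w hw => le_antisymm (by simpa using (W.weightLE_iff hS).1 h₂ w hw)
        ((W.weightGE_iff hS).1 h₁ w hw)
    | succ k ih =>
      intro a M h₁ h₂
      have := W.mono hS a M
      have hι : Mono ((D.weightι S a).app M) := this
      obtain ⟨Q, p, δ, hT⟩ := exists_triangle_of_mono ((D.weightι S a).app M)
      have hp : Epi p := epi_of_triangle _ p δ hT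
      have hzero : (D.weightι S a).app M ≫ p = 0 :=
        ObjectProperty.hom_ext _ (ObjectProperty.hom_ext _ (comp_distTriang_mor_zero₁₂ _ hT))
      have hQ := ih (a + 1) Q (W.weightGE_of_cokernel hS p hzero)
        (W.weightLE_of_epi hS p (by
          rwa [show a + ((k + 1 : ℕ) : ℤ) = a + 1 + (k : ℤ) by push_cast; ring] at h₂))
      have hL := (W.twist hS ((D.weight S a).obj M).obj.obj (isMixed_obj _) a n (by
        rw [W.weights_isMixed_iff hS (isMixed_obj _)]
        exact fun w hw => le_antisymm ((W.weightLE_iff hS).1 (W.weightLE_weight_obj hS a M) w hw)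
          ((W.weightGE_iff hS).1 (W.weightGE_of_mono hS ((D.weightι S a).app M) h₁) w hw))).1
      obtain ⟨δ', hT'⟩ := map_distinguished (D.twist S n) hT
      exact ⟨LE.obj₂ hT' hL.1 hQ.1, GE.obj₂ hT' hL.2 hQ.2⟩
  -- `W_a = 0` and `W_b` is everything, so the weights lie in `[a + 1, b]`
  obtain ⟨a, b, ha, hb⟩ := W.finite hS hM.toMM
  have ha' : WeightGE hM.toMM (a + 1) := by
    unfold WeightGE
    rwa [add_sub_cancel_right]
  exact key (b - (a + 1)).toNat (a + 1) hM.toMM ha' (W.weightLE_mono hS hb (by omega))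

end WeightAxioms

namespace TStructureAxioms
open TStructuresAndWeights ZeroObject
variable {F : Type} [Field F] [NumberField F] {D : TStructuresAndWeights.{v, u} F} {S S' : Sch F}
  (A : TStructureAxioms D)
include A

/-- Geometric motives have bounded cohomology. -/
lemma exists_bounds (hS : IsArithmeticBase S) {M : D.DM S} (hM : compactObjects _ M) :
    ∃ a b : ℤ, D.GE M a ∧ D.LE M b := by
  obtain ⟨a, b, ha, hb⟩ := A.bounded hS ⟨M, hM⟩
  exact ⟨a, b, ⟨hM, ha⟩, ⟨hM, hb⟩⟩

omit A in
/-- A motive with cohomology in degrees `[b - d - 1, b]` is an extension of one with cohomology in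
degrees `[b - d, b]` by its lowest cohomology. -/
lemma exists_lowest {M : D.DM S} {b : ℤ} {d : ℕ} (h₁ : D.GE M (b - (d + 1 : ℕ)))
    (h₂ : D.LE M b) : ∃ (K B : D.DM S) (f : K⟦-(b - (d + 1 : ℕ))⟧ ⟶ M) (g : M ⟶ B)
      (h : B ⟶ K⟦-(b - (d + 1 : ℕ))⟧⟦(1 : ℤ)⟧), Triangle.mk f g h ∈ distTriang (D.DM S) ∧
        D.IsMixed K ∧ D.GE B (b - d) ∧ D.LE B b := by
  obtain ⟨A, B, f, g, h, hT, hA, hB⟩ := D.exists_truncation h₁.1 (b - (d + 1 : ℕ))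
  have hA' : D.GE A (b - (d + 1 : ℕ)) := GE.obj₁ hT h₁ (hB.anti (by omega))
  have hB' : D.LE B b := LE.obj₃ hT (hA.mono (by omega)) h₂
  let e : A⟦b - (d + 1 : ℕ)⟧⟦-(b - (d + 1 : ℕ))⟧ ≅ A :=
    (shiftEquiv (D.DM S) (b - (d + 1 : ℕ))).unitIso.symm.app A
  obtain ⟨h', hT'⟩ := distinguished_of_iso hT e.symm (Iso.refl M) (Iso.refl B) (e.hom ≫ f) g
    (by simp) (by simp)
  exact ⟨A⟦b - (d + 1 : ℕ)⟧, B, _, _, h', hT',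
    ⟨hA.shift _ _ (by omega), hA'.shift _ _ (by omega)⟩, hB.anti (by push_cast; omega), hB'⟩

omit A in
lemma exists_mixed_iso {M : D.DM S} {b : ℤ} (h₁ : D.GE M b) (h₂ : D.LE M b) :
    ∃ K : D.DM S, D.IsMixed K ∧ Nonempty (M ≅ K⟦-b⟧) :=
  ⟨M⟦b⟧, ⟨h₂.shift _ _ (by omega), h₁.shift _ _ (by omega)⟩,
    ⟨(shiftEquiv (D.DM S) b).unitIso.app M⟩⟩

/-- A triangulated functor which preserves mixed motives is exact. -/
lemma amplitude_of_isMixed (hS : IsArithmeticBase S) (G : D.DM S ⥤ D.DM S') [G.CommShift ℤ]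
    [G.IsTriangulated] (hG : ∀ K, D.IsMixed K → D.IsMixed (G.obj K)) : D.Amplitude G 0 0 := by
  have key₀ : ∀ (K : D.DM S) (b : ℤ), D.IsMixed K →
      D.GE (G.obj (K⟦-b⟧)) b ∧ D.LE (G.obj (K⟦-b⟧)) b := fun K b hK =>
    ⟨((hG K hK).2.shift (-b) b (by omega)).of_iso ((G.commShiftIso (-b)).symm.app K),
      ((hG K hK).1.shift (-b) b (by omega)).of_iso ((G.commShiftIso (-b)).symm.app K)⟩
  -- induction on the length of the range of degrees, splitting off the lowest cohomology
  have key : ∀ (d : ℕ) (M : D.DM S) (b : ℤ), D.GE M (b - d) → D.LE M b →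
      D.GE (G.obj M) (b - d) ∧ D.LE (G.obj M) b := by
    intro d
    induction d with
    | zero =>
      intro M b h₁ h₂
      obtain ⟨K, hK, ⟨e⟩⟩ := exists_mixed_iso (by simpa using h₁) h₂
      have := key₀ K b hK
      exact ⟨by simpa using this.1.of_iso (G.mapIso e.symm), this.2.of_iso (G.mapIso e.symm)⟩
    | succ d ih =>
      intro M b h₁ h₂
      obtain ⟨K, B, f, g, h, hT, hK, hB₁, hB₂⟩ := exists_lowest h₁ h₂
      obtain ⟨δ, hT'⟩ := map_distinguished G hT
      have h := key₀ K (b - (d + 1 : ℕ)) hK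
      have h' := ih B b hB₁ hB₂
      exact ⟨GE.obj₂ hT' h.1 (h'.1.anti (by push_cast; omega)),
        LE.obj₂ hT' (h.2.mono (by push_cast; omega)) h'.2⟩
  intro M n
  refine ⟨fun h => ?_, fun h => ?_⟩
  · obtain ⟨a, b, -, hb⟩ := A.exists_bounds hS h.1
    have := (key (max b n - n).toNat M (max b n) (h.anti (by omega)) (hb.mono (by omega))).1
    exact this.anti (by omega)
  · obtain ⟨a, b, ha, -⟩ := A.exists_bounds hS h.1
    exact ((key (n - min a n).toNat M n (ha.anti (by omega)) h).2).mono (by omega)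

/-- Twists are exact, since they preserve mixed motives. -/
lemma amplitude_twist (W : WeightAxioms D) (hS : IsArithmeticBase S) (n : ℤ) :
    D.Amplitude (D.twist S n) 0 0 :=
  A.amplitude_of_isMixed hS _ fun _ hK => W.isMixed_twist hS hK n

end TStructureAxioms

/-! ### Projective morphisms -/

section Projective

/-- The point `(1 : 1 : ⋯ : 1)` of projective space. -/
lemma exists_point_projSpaceZ (n : ℕ) : Nonempty (Spec (CommRingCat.of ℤ) ⟶ projSpaceZ n) := by
  let _ := MvPolynomial.gradedAlgebra (σ := Fin (n + 1)) (R := ℤ)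
  let 𝒜 := MvPolynomial.homogeneousSubmodule (Fin (n + 1)) ℤ
  let f : MvPolynomial (Fin (n + 1)) ℤ := MvPolynomial.X 0
  have hf : f ∈ 𝒜 1 := MvPolynomial.isHomogeneous_X _ _
  have hu : IsUnit ((MvPolynomial.eval (fun _ : Fin (n + 1) => (1 : ℤ))) f) := by simp [f]
  let φ : HomogeneousLocalization.Away 𝒜 f →+* ℤ :=
    (IsLocalization.Away.lift (S := Localization.Away f) f hu).comp
      (algebraMap (HomogeneousLocalization.Away 𝒜 f) (Localization.Away f))
  exact ⟨Spec.map (CommRingCat.ofHom φ) ≫ Proj.awayι 𝒜 f hf one_pos⟩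

/-- `ℙⁿ_S` has a section over `S`. -/
lemma exists_section_projSpace (n : ℕ) (S : Scheme.{0}) :
    ∃ s : S ⟶ (projSpace n S).left, s ≫ (projSpace n S).hom = 𝟙 S := by
  obtain ⟨p⟩ := exists_point_projSpaceZ n
  exact ⟨pullback.lift (𝟙 S) (specZIsTerminal.from S ≫ p) (terminal.hom_ext _ _),
    pullback.lift_fst _ _ _⟩

/-- Projective space is `Proj` of a polynomial ring `A` over `ℤ`, which is proper over `A₀ = ℤ`. -/
lemma isProper_projSpaceZ (n : ℕ) : IsProper (terminal.from (projSpaceZ n)) := by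
  let _ := MvPolynomial.gradedAlgebra (σ := Fin (n + 1)) (R := ℤ)
  let 𝒜 := MvPolynomial.homogeneousSubmodule (Fin (n + 1)) ℤ
  have h0 : Function.Bijective (algebraMap ℤ (𝒜 0)) := by
    constructor
    · intro a b hab
      have := congrArg (fun x : 𝒜 0 => (x : MvPolynomial (Fin (n + 1)) ℤ)) hab
      exact MvPolynomial.C_injective _ _ this
    · rintro ⟨x, hx⟩
      refine ⟨MvPolynomial.coeff 0 x, Subtype.ext ?_⟩
      have hx : x.IsHomogeneous 0 := hx
      exact (MvPolynomial.totalDegree_eq_zero_iff_eq_C.1 (by simpa using hx.totalDegree_le)).symm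
  have h : ((algebraMap (𝒜 0) (MvPolynomial (Fin (n + 1)) ℤ)).comp
      (algebraMap ℤ (𝒜 0))).FiniteType := by
    rw [RingHom.ext_int (RingHom.comp _ _) (algebraMap ℤ (MvPolynomial (Fin (n + 1)) ℤ)),
      RingHom.finiteType_algebraMap]
    infer_instance
  have : Algebra.FiniteType (𝒜 0) (MvPolynomial (Fin (n + 1)) ℤ) :=
    RingHom.finiteType_algebraMap.1 (RingHom.FiniteType.of_comp_finiteType h)
  have e : terminal.from (projSpaceZ n) = Proj.toSpecZero 𝒜 ≫
      Spec.map (CommRingCat.ofHom (algebraMap ℤ (𝒜 0))) ≫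
        terminalIsTerminal.from (Spec (CommRingCat.of ℤ)) := terminal.hom_ext _ _
  have : IsIso (Spec.map (CommRingCat.ofHom (algebraMap ℤ (𝒜 0)))) := by
    have : IsIso (CommRingCat.ofHom (algebraMap ℤ (𝒜 0))) :=
      (ConcreteCategory.isIso_iff_bijective _).2 h0
    infer_instance
  have : IsIso (terminalIsTerminal.from (Spec (CommRingCat.of ℤ))) :=
    isIso_of_isTerminal specZIsTerminal terminalIsTerminal _
  have h₁ : IsProper (Proj.toSpecZero 𝒜) := inferInstance
  rw [e]
  exact MorphismProperty.comp_mem _ _ _ h₁ (MorphismProperty.comp_mem _ _ _ inferInstance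
    inferInstance)

instance (n : ℕ) (S : Scheme.{0}) : IsProper (projSpace n S).hom :=
  have := isProper_projSpaceZ n
  inferInstanceAs (IsProper (pullback.fst (terminal.from S) (terminal.from (projSpaceZ n))))

variable {X Y Z : Scheme.{0}}

lemma IsProjectiveHom.isProper {f : X ⟶ Y} (h : IsProjectiveHom f) : IsProper f := by
  obtain ⟨n, i, hi, rfl⟩ := h
  infer_instance

lemma IsProjectiveHom.quasiProjective {f : X ⟶ Y} (h : IsProjectiveHom f) :
    IsQuasiProjectiveHom f := by
  obtain ⟨n, i, hi, rfl⟩ := h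
  exact ⟨n, i, inferInstance, rfl⟩

/-- An immersion is quasi-projective: it factors through a section of `ℙ⁰`. -/
lemma IsQuasiProjectiveHom.of_isImmersion (f : X ⟶ Y) [IsImmersion f] :
    IsQuasiProjectiveHom f := by
  obtain ⟨s, hs⟩ := exists_section_projSpace 0 Y
  have : IsImmersion (s ≫ (projSpace 0 Y).hom) := by rw [hs]; infer_instance
  have : IsImmersion s := IsImmersion.of_comp s (projSpace 0 Y).hom
  exact ⟨0, f ≫ s, inferInstance, by rw [Category.assoc, hs, Category.comp_id]⟩

/-- A closed immersion is projective: it factors through a section of `ℙ⁰`. -/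
lemma IsProjectiveHom.of_isClosedImmersion (f : X ⟶ Y) [IsClosedImmersion f] :
    IsProjectiveHom f := by
  obtain ⟨s, hs⟩ := exists_section_projSpace 0 Y
  have : IsClosedImmersion (s ≫ (projSpace 0 Y).hom) := by rw [hs]; infer_instance
  have : IsClosedImmersion s := IsClosedImmersion.of_comp s (projSpace 0 Y).hom
  exact ⟨0, f ≫ s, inferInstance, by rw [Category.assoc, hs, Category.comp_id]⟩

lemma IsProjectiveHom.comp_isClosedImmersion (i : X ⟶ Y) [IsClosedImmersion i] {f : Y ⟶ Z}
    (h : IsProjectiveHom f) : IsProjectiveHom (i ≫ f) := by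
  obtain ⟨n, k, hk, rfl⟩ := h
  exact ⟨n, i ≫ k, inferInstance, Category.assoc _ _ _⟩

lemma isPullback_projSpace (n : ℕ) {S T : Scheme.{0}} (g : T ⟶ S) :
    IsPullback (pullback.lift ((projSpace n T).hom ≫ g)
      (pullback.snd (terminal.from T) (terminal.from (projSpaceZ n))) (terminal.hom_ext _ _) :
        (projSpace n T).left ⟶ (projSpace n S).left) (projSpace n T).hom (projSpace n S).hom g := by
  refine IsPullback.of_right (h₁₂ := pullback.snd _ _) (v₁₃ := terminal.from _)
    (h₂₂ := terminal.from S) ?_ (pullback.lift_fst _ _ _) (IsPullback.of_hasPullback _ _).flip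
  have := (IsPullback.of_hasPullback (terminal.from T) (terminal.from (projSpaceZ n))).flip
  convert! this using 1
  · exact pullback.lift_snd _ _ _
  · exact terminal.hom_ext _ _

lemma IsProjectiveHom.of_isPullback {P S : Scheme.{0}} {fst : P ⟶ X} {snd : P ⟶ Y} {f : X ⟶ S}
    {g : Y ⟶ S} (hP : IsPullback fst snd f g) (h : IsProjectiveHom f) : IsProjectiveHom snd := by
  obtain ⟨n, i, hi, rfl⟩ := h
  let k := (isPullback_projSpace n g).lift (fst ≫ i) snd ((Category.assoc fst i _).trans hP.w)
  have hk : IsPullback fst k i _ := IsPullback.of_bot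
    (v₂₁ := (projSpace n Y).hom) (v₂₂ := (projSpace n S).hom) (h₃₁ := g)
    (by
      rw [show k ≫ (projSpace n Y).hom = snd from (isPullback_projSpace n g).lift_snd _ _ _]
      exact hP)
    ((isPullback_projSpace n g).lift_fst _ _ _).symm (isPullback_projSpace n g)
  exact ⟨n, k, MorphismProperty.of_isPullback hk hi, (isPullback_projSpace n g).lift_snd _ _ _⟩

end Projective

/-! ### The relative dimension of a smooth morphism -/

section RelativeDimension

/-- Near a maximal ideal, both relative dimensions are the rank of the module of Kähler
differentials of a common nonzero localization. -/
lemma RingHom.Locally.relativeDimension_unique {R B : Type} [CommRing R] [CommRing B] [Nontrivial B]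
    {φ : R →+* B} {d e : ℕ} (hd : RingHom.Locally (RingHom.IsStandardSmoothOfRelativeDimension d) φ)
    (he : RingHom.Locally (RingHom.IsStandardSmoothOfRelativeDimension e) φ) : d = e := by
  obtain ⟨S, hS, hS'⟩ := hd
  obtain ⟨T, hT, hT'⟩ := he
  obtain ⟨m, hm⟩ := Ideal.exists_maximal B
  have key : ∀ S : Set B, Ideal.span S = ⊤ → ∃ s ∈ S, s ∉ m := by
    intro S hS
    by_contra! h
    exact hm.ne_top (top_le_iff.1 (hS ▸ Ideal.span_le.2 h))
  obtain ⟨s, hs, hsm⟩ := key S hS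
  obtain ⟨t, ht, htm⟩ := key T hT
  let C₁ := Localization.Away (algebraMap B (Localization.Away s) t)
  let C₂ := Localization.Away (algebraMap B (Localization.Away t) s)
  have : IsLocalization.Away (s * t) C₁ := IsLocalization.Away.mul' (Localization.Away s) C₁ s t
  have : IsLocalization.Away (s * t) C₂ := by
    rw [mul_comm]
    exact IsLocalization.Away.mul' (Localization.Away t) C₂ t s
  have : Nontrivial C₁ := by
    rw [← not_subsingleton_iff_nontrivial,
      IsLocalization.subsingleton_iff (M := Submonoid.powers (s * t))]
    rintro ⟨n, hn⟩
    have := hm.isPrime.mem_of_pow_mem n (show (s * t) ^ n ∈ m by simp_all)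
    exact (hm.isPrime.mem_or_mem this).elim hsm htm
  have h₁ := (RingHom.isStandardSmoothOfRelativeDimension_stableUnderCompositionWithLocalizationAway
    d).right C₁ (algebraMap B (Localization.Away s) t)
    ((algebraMap B (Localization.Away s)).comp φ) (hS' s hs)
  have h₂ := (RingHom.isStandardSmoothOfRelativeDimension_stableUnderCompositionWithLocalizationAway
    e).right C₂ (algebraMap B (Localization.Away t) s)
    ((algebraMap B (Localization.Away t)).comp φ) (hT' t ht)
  let E : C₂ ≃ₐ[B] C₁ := IsLocalization.algEquiv (Submonoid.powers (s * t)) C₂ C₁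
  have h₂' := RingHom.isStandardSmoothOfRelativeDimension_respectsIso.1 _ E.toRingEquiv h₂
  have hEq : E.toRingEquiv.toRingHom.comp ((algebraMap (Localization.Away t) C₂).comp
      ((algebraMap B (Localization.Away t)).comp φ)) = (algebraMap (Localization.Away s) C₁).comp
      ((algebraMap B (Localization.Away s)).comp φ) := by
    ext x
    simp only [RingHom.comp_apply, ← IsScalarTower.algebraMap_apply]
    exact E.commutes (φ x)
  rw [hEq] at h₂'
  let _ : Algebra R C₁ := ((algebraMap (Localization.Away s) C₁).comp
      ((algebraMap B (Localization.Away s)).comp φ)).toAlgebra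
  have i₁ : Algebra.IsStandardSmoothOfRelativeDimension d R C₁ := h₁
  have i₂ : Algebra.IsStandardSmoothOfRelativeDimension e R C₁ := h₂'
  have r₁ := Algebra.IsStandardSmoothOfRelativeDimension.rank_kaehlerDifferential
    (R := R) (S := C₁) d
  have r₂ := Algebra.IsStandardSmoothOfRelativeDimension.rank_kaehlerDifferential
    (R := R) (S := C₁) e
  exact_mod_cast r₁.symm.trans r₂

variable {X Y Z : Scheme.{0}}

lemma SmoothOfRelativeDimension.comp_open {d : ℕ} (j : Z ⟶ X) [IsOpenImmersion j] (f : X ⟶ Y)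
    (h : SmoothOfRelativeDimension d f) : SmoothOfRelativeDimension d (j ≫ f) := by
  have := smoothOfRelativeDimension_comp 0 d j f
  rwa [zero_add] at this

lemma SmoothOfRelativeDimension.unique [Nonempty X] {f : X ⟶ Y} {d e : ℕ}
    (hd : SmoothOfRelativeDimension d f) (he : SmoothOfRelativeDimension e f) : d = e := by
  obtain ⟨x⟩ := ‹Nonempty X›
  obtain ⟨U, hU, V, hV, hx, h, -⟩ := hd.exists_isStandardSmoothOfRelativeDimension x
  have : Nonempty V := ⟨⟨x, hx⟩⟩
  have : Nontrivial Γ(X, V) := Scheme.component_nontrivial X V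
  exact RingHom.Locally.relativeDimension_unique
    (HasRingHomProperty.appLE (P := @SmoothOfRelativeDimension d) f hd ⟨U, hU⟩ ⟨V, hV⟩ h)
    (HasRingHomProperty.appLE (P := @SmoothOfRelativeDimension e) f he ⟨U, hU⟩ ⟨V, hV⟩ h)

/-- The open locus where a smooth morphism has relative dimension `d`. -/
def relDimLocus (f : X ⟶ Y) (d : ℕ) : X.Opens :=
  sSup {V : X.Opens | SmoothOfRelativeDimension d (V.ι ≫ f)}

lemma mem_relDimLocus {f : X ⟶ Y} {d : ℕ} {x : X} :
    x ∈ relDimLocus f d ↔ ∃ V : X.Opens, x ∈ V ∧ SmoothOfRelativeDimension d (V.ι ≫ f) := by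
  simp [relDimLocus, TopologicalSpace.Opens.mem_sSup, and_comm]

lemma smoothOfRelativeDimension_relDimLocus (f : X ⟶ Y) (d : ℕ) :
    SmoothOfRelativeDimension d ((relDimLocus f d).ι ≫ f) := by
  have : IsZariskiLocalAtSource (@SmoothOfRelativeDimension d) :=
    HasRingHomProperty.instIsZariskiLocalAtSource
      (Q := RingHom.Locally (RingHom.IsStandardSmoothOfRelativeDimension d))
  refine (IsZariskiLocalAtSource.iff_of_iSup_eq_top (P := @SmoothOfRelativeDimension d)
    (fun V : {V : X.Opens | SmoothOfRelativeDimension d (V.ι ≫ f)} =>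
      (relDimLocus f d).ι ⁻¹ᵁ V.1) ?_).2 ?_
  · refine top_le_iff.1 fun x _ => ?_
    obtain ⟨V, hV, h⟩ := mem_relDimLocus.1 x.2
    exact TopologicalSpace.Opens.mem_iSup.2 ⟨⟨V, h⟩, hV⟩
  · rintro ⟨V, hV⟩
    rw [← Category.assoc, ← morphismRestrict_ι, Category.assoc]
    exact SmoothOfRelativeDimension.comp_open _ _ hV

lemma exists_mem_relDimLocus (f : X ⟶ Y) [Smooth f] (x : X) : ∃ d, x ∈ relDimLocus f d := by
  obtain ⟨U, hU, V, hV, hx, e, h⟩ := Smooth.exists_isStandardSmooth f x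
  obtain ⟨ι, σ, h₁, h₂, ⟨P⟩⟩ := h
  let := (f.appLE U V e).hom.toAlgebra
  have h : RingHom.IsStandardSmoothOfRelativeDimension P.dimension (f.appLE U V e).hom :=
    ⟨ι, σ, h₁, h₂, P, rfl⟩
  have h' : SmoothOfRelativeDimension P.dimension (f.resLE U V e) := by
    have : IsAffine _ := hU
    have : IsAffine _ := hV
    rw [HasRingHomProperty.iff_of_isAffine (P := @SmoothOfRelativeDimension P.dimension)]
    exact ((RingHom.locally_respectsIso
      RingHom.isStandardSmoothOfRelativeDimension_respectsIso).arrow_mk_iso_iff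
        (arrowResLEAppIso f U V e)).mpr
        (RingHom.locally_of RingHom.isStandardSmoothOfRelativeDimension_respectsIso _ h)
  refine ⟨P.dimension, mem_relDimLocus.2 ⟨V, hx, ?_⟩⟩
  rw [← Scheme.Hom.resLE_comp_ι f e]
  exact smoothOfRelativeDimension_comp P.dimension 0 _ _

lemma disjoint_relDimLocus (f : X ⟶ Y) {d e : ℕ} (x : X) (hd : x ∈ relDimLocus f d)
    (he : x ∈ relDimLocus f e) : d = e := by
  obtain ⟨V, hV, h⟩ := mem_relDimLocus.1 hd
  obtain ⟨W, hW, h'⟩ := mem_relDimLocus.1 he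
  have : Nonempty (V ⊓ W : X.Opens) := ⟨⟨x, hV, hW⟩⟩
  have h₁ := SmoothOfRelativeDimension.comp_open (X.homOfLE (inf_le_left : V ⊓ W ≤ V)) _ h
  have h₂ := SmoothOfRelativeDimension.comp_open (X.homOfLE (inf_le_right : V ⊓ W ≤ W)) _ h'
  rw [Scheme.homOfLE_ι_assoc] at h₁ h₂
  exact SmoothOfRelativeDimension.unique h₁ h₂

lemma preimage_relDimLocus_le (j : Z ⟶ X) [IsOpenImmersion j] (f : X ⟶ Y) (d : ℕ) :
    j ⁻¹ᵁ relDimLocus f d ≤ relDimLocus (j ≫ f) d := by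
  intro z hz
  obtain ⟨V, hV, h⟩ := mem_relDimLocus.1 hz
  refine mem_relDimLocus.2 ⟨j ⁻¹ᵁ V, hV, ?_⟩
  rw [← Category.assoc, ← morphismRestrict_ι, Category.assoc]
  exact SmoothOfRelativeDimension.comp_open _ _ h

/-- The complement of a locus of fixed relative dimension is the union of the other such loci. -/
lemma isClosed_relDimLocus (f : X ⟶ Y) [Smooth f] (d : ℕ) : IsClosed (relDimLocus f d : Set X) := by
  have : (relDimLocus f d : Set X)ᶜ = ⋃ e ∈ {e : ℕ | e ≠ d}, (relDimLocus f e : Set X) := by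
    ext x
    simp only [Set.mem_compl_iff, Set.mem_iUnion]
    constructor
    · intro hx
      obtain ⟨e, he⟩ := exists_mem_relDimLocus f x
      exact ⟨e, fun h => hx (h ▸ he), he⟩
    · rintro ⟨e, hne, he⟩ hx
      exact hne (disjoint_relDimLocus f x he hx)
  rw [← isOpen_compl_iff, this]
  exact isOpen_biUnion fun e _ => (relDimLocus f e).isOpen

end RelativeDimension

/-! ### Points and open subschemes of `Spec 𝓞 F` -/

namespace Sch
variable {F : Type} [Field F]

/-- A morphism over `Spec 𝓞 F`. -/
def homMk {X Y : Sch F} (f : X.toScheme ⟶ Y.toScheme) (w : f ≫ Y.obj.hom = X.obj.hom) : X ⟶ Y :=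
  ObjectProperty.homMk (Over.homMk f w)

@[simp] lemma mor_comp {X Y Z : Sch F} (f : X ⟶ Y) (g : Y ⟶ Z) : mor (f ≫ g) = mor f ≫ mor g := rfl

lemma hom_ext {X Y : Sch F} {f g : X ⟶ Y} (h : mor f = mor g) : f = g :=
  ObjectProperty.hom_ext _ (Over.OverMorphism.ext h)

lemma mor_w {X Y : Sch F} (f : X ⟶ Y) : mor f ≫ Y.obj.hom = X.obj.hom := Over.w f.hom

/-- A separated scheme of finite type over `X`. -/
def ofHom (X : Sch F) {Z : Scheme.{0}} (g : Z ⟶ X.toScheme) [IsSeparated g] [QuasiCompact g]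
    [LocallyOfFiniteType g] : Sch F :=
  ⟨Over.mk (g ≫ X.obj.hom), by
    obtain ⟨h₁, h₂, h₃⟩ := X.property
    refine ⟨?_, ?_, ?_⟩
    · dsimp; infer_instance
    · dsimp; infer_instance
    · rcases h₃ with h | ⟨k, hk, h⟩
      · exact Or.inl (by dsimp; infer_instance)
      · exact Or.inr ⟨g ≫ k, by rw [Category.assoc, hk]; rfl, by dsimp; infer_instance⟩⟩

/-- The structural morphism of `ofHom`. -/
def ofHomπ (X : Sch F) {Z : Scheme.{0}} (g : Z ⟶ X.toScheme) [IsSeparated g] [QuasiCompact g]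
    [LocallyOfFiniteType g] : ofHom X g ⟶ X := homMk g rfl

/-- Base change of separated morphisms of finite type. -/
lemma exists_cartesian {X S S' : Sch F} (f : X ⟶ S) (s : S' ⟶ S) [IsSeparated (mor f)]
    [QuasiCompact (mor f)] [LocallyOfFiniteType (mor f)] :
    ∃ (X' : Sch F) (a : X' ⟶ X) (f' : X' ⟶ S'), a ≫ f = f' ≫ s ∧ Cartesian a f' f s := by
  have h₁ : IsSeparated (pullback.snd (mor f) (mor s)) := inferInstance
  have h₂ : QuasiCompact (pullback.snd (mor f) (mor s)) := inferInstance
  have h₃ : LocallyOfFiniteType (pullback.snd (mor f) (mor s)) := inferInstance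
  have hP := IsPullback.of_hasPullback (mor f) (mor s)
  refine ⟨ofHom S' (pullback.snd (mor f) (mor s)), homMk (pullback.fst (mor f) (mor s)) ?_,
    ofHomπ S' _, hom_ext ?_, hP⟩
  · rw [← mor_w f]
    exact (Category.assoc _ _ _).symm.trans ((congrArg (· ≫ S.obj.hom) hP.w).trans
      ((Category.assoc _ _ _).trans (congrArg (_ ≫ ·) (mor_w s))))
  · exact hP.w

/-- The point of `Spec 𝓞 F` given by a nonzero prime ideal. -/
def point (p : IsDedekindDomain.HeightOneSpectrum (𝓞 F)) : specO F :=
  (⟨p.asIdeal, p.isPrime⟩ : PrimeSpectrum (𝓞 F))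

variable (F) in
/-- The generic point of `Spec 𝓞 F`. -/
def genPoint : specO F := (⟨⊥, Ideal.isPrime_bot⟩ : PrimeSpectrum (𝓞 F))

lemma genPoint_or_point (x : specO F) : x = genPoint F ∨ ∃ p, x = point p := by
  by_cases h : (show PrimeSpectrum (𝓞 F) from x).asIdeal = ⊥
  · exact Or.inl (PrimeSpectrum.ext h)
  · exact Or.inr ⟨⟨_, (show PrimeSpectrum (𝓞 F) from x).isPrime, h⟩, rfl⟩

lemma genPoint_mem {U : (specO F).Opens} (hU : U ≠ ⊥) : genPoint F ∈ U := by
  obtain ⟨x, hx⟩ := (TopologicalSpace.Opens.ne_bot_iff_nonempty U).1 hU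
  have h : (genPoint F : PrimeSpectrum (𝓞 F)) ⤳ x :=
    (PrimeSpectrum.le_iff_specializes _ _).1 (bot_le (a := (show PrimeSpectrum (𝓞 F) from x).asIdeal))
  exact h.mem_open U.isOpen hx

lemma genericPt_apply (x : Spec (CommRingCat.of F)) : genericPt F x = genPoint F := by
  refine PrimeSpectrum.ext ?_
  change Ideal.comap (algebraMap (𝓞 F) F) (show PrimeSpectrum F from x).asIdeal = ⊥
  have : (show PrimeSpectrum F from x).asIdeal = ⊥ :=
    (Ideal.eq_bot_or_top _).resolve_right (show PrimeSpectrum F from x).isPrime.ne_top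
  rw [this, ← RingHom.ker_eq_comap_bot, (RingHom.injective_iff_ker_eq_bot _).1
    (FaithfulSMul.algebraMap_injective (𝓞 F) F)]

lemma point_injective : Function.Injective (point (F := F)) := fun _ _ h =>
  IsDedekindDomain.HeightOneSpectrum.ext (congrArg PrimeSpectrum.asIdeal h)

lemma point_ne_genPoint (p : IsDedekindDomain.HeightOneSpectrum (𝓞 F)) : point p ≠ genPoint F :=
  fun h => p.ne_bot (congrArg PrimeSpectrum.asIdeal h)

variable [NumberField F]

/-- Open subschemes of `Spec 𝓞 F` are subobjects of the final object. -/
lemma op_hom_ext {X : Sch F} {U : (specO F).Opens} (f g : X ⟶ op U) : f = g := by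
  refine hom_ext ((cancel_mono U.ι).1 ?_)
  exact (mor_w f).trans (mor_w g).symm

instance (U : (specO F).Opens) : IsOpenImmersion (op U).obj.hom :=
  inferInstanceAs (IsOpenImmersion U.ι)

instance (p : IsDedekindDomain.HeightOneSpectrum (𝓞 F)) : IsClosedImmersion (pt p).obj.hom :=
  IsClosedImmersion.spec_of_surjective _ Ideal.Quotient.mk_surjective

instance {V U : (specO F).Opens} (j : op V ⟶ op U) : IsOpenImmersion (mor j) := by
  have : IsOpenImmersion (mor j ≫ (op U).obj.hom) := by rw [mor_w]; infer_instance
  exact IsOpenImmersion.of_comp _ (op U).obj.hom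

instance {p : IsDedekindDomain.HeightOneSpectrum (𝓞 F)} {U : (specO F).Opens} (i : pt p ⟶ op U) :
    IsClosedImmersion (mor i) := by
  have : IsClosedImmersion (mor i ≫ (op U).obj.hom) := by rw [mor_w]; infer_instance
  exact IsClosedImmersion.of_comp _ (op U).obj.hom

lemma quotient_apply (p : IsDedekindDomain.HeightOneSpectrum (𝓞 F))
    (x : Spec (CommRingCat.of (𝓞 F ⧸ p.asIdeal))) :
    Spec.map (CommRingCat.ofHom (Ideal.Quotient.mk p.asIdeal)) x = point p := by
  refine PrimeSpectrum.ext ?_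
  change Ideal.comap (Ideal.Quotient.mk p.asIdeal)
    (show PrimeSpectrum (𝓞 F ⧸ p.asIdeal) from x).asIdeal = p.asIdeal
  have hmax := p.isPrime.isMaximal p.ne_bot
  let _ := Ideal.Quotient.field p.asIdeal
  have : (show PrimeSpectrum (𝓞 F ⧸ p.asIdeal) from x).asIdeal = ⊥ :=
    (Ideal.eq_bot_or_top _).resolve_right
      (show PrimeSpectrum (𝓞 F ⧸ p.asIdeal) from x).isPrime.ne_top
  rw [this, ← RingHom.ker_eq_comap_bot, Ideal.mk_ker]

/-- The generic point of a nonempty open subscheme. -/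
lemma exists_gen {U : (specO F).Opens} (hU : U ≠ ⊥) : Nonempty (gen F ⟶ op U) := by
  have h : Set.range (genericPt F) ⊆ Set.range U.ι := by
    rintro _ ⟨x, rfl⟩
    rw [genericPt_apply, Scheme.Opens.range_ι]
    exact genPoint_mem hU
  exact ⟨homMk (IsOpenImmersion.lift (op U).obj.hom (genericPt F) h) (IsOpenImmersion.lift_fac _ _ _)⟩

lemma nonempty_pt_iff {p : IsDedekindDomain.HeightOneSpectrum (𝓞 F)} {U : (specO F).Opens} :
    Nonempty (pt p ⟶ op U) ↔ point p ∈ U := by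
  have hmax := p.isPrime.isMaximal p.ne_bot
  let _ := Ideal.Quotient.field p.asIdeal
  constructor
  · rintro ⟨i⟩
    let x : Spec (CommRingCat.of (𝓞 F ⧸ p.asIdeal)) :=
      (⟨⊥, Ideal.isPrime_bot⟩ : PrimeSpectrum (𝓞 F ⧸ p.asIdeal))
    have h := congrArg (fun f => f x) (mor_w i)
    change U.ι (mor i x) = Spec.map (CommRingCat.ofHom (Ideal.Quotient.mk p.asIdeal)) x at h
    rw [quotient_apply] at h
    rw [← h]
    exact (mor i x).2
  · intro hp
    have h : Set.range (Spec.map (CommRingCat.ofHom (Ideal.Quotient.mk p.asIdeal))) ⊆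
        Set.range U.ι := by
      rintro _ ⟨x, rfl⟩
      rw [quotient_apply, Scheme.Opens.range_ι]
      exact hp
    exact ⟨homMk (IsOpenImmersion.lift (op U).obj.hom _ h) (IsOpenImmersion.lift_fac _ _ _)⟩

lemma exists_op {V U : (specO F).Opens} (h : V ≤ U) : Nonempty (op V ⟶ op U) :=
  ⟨homMk ((specO F).homOfLE h) (Scheme.homOfLE_ι _ _)⟩

lemma isClosed_point (p : IsDedekindDomain.HeightOneSpectrum (𝓞 F)) :
    IsClosed ({point p} : Set (specO F)) :=
  (PrimeSpectrum.isClosed_singleton_iff_isMaximal _).2 (p.isPrime.isMaximal p.ne_bot)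

/-- The open complement of a finite set of closed points. -/
def compl (T : Finset (IsDedekindDomain.HeightOneSpectrum (𝓞 F))) : (specO F).Opens :=
  ⟨(⋃ p ∈ T, {point p})ᶜ, by
    rw [isOpen_compl_iff]
    exact T.finite_toSet.isClosed_biUnion fun p _ => isClosed_point p⟩

lemma point_mem_compl {T : Finset (IsDedekindDomain.HeightOneSpectrum (𝓞 F))}
    {p : IsDedekindDomain.HeightOneSpectrum (𝓞 F)} : point p ∈ compl T ↔ p ∉ T := by
  change point p ∈ (⋃ p ∈ T, {point p})ᶜ ↔ _
  simp [point_injective.eq_iff]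

lemma genPoint_mem_compl (T : Finset (IsDedekindDomain.HeightOneSpectrum (𝓞 F))) :
    genPoint F ∈ compl T := by
  change genPoint F ∈ (⋃ p ∈ T, {point p})ᶜ
  simp [fun p => (point_ne_genPoint (F := F) p).symm]

lemma range_pt {p : IsDedekindDomain.HeightOneSpectrum (𝓞 F)} {U : (specO F).Opens}
    (i : pt p ⟶ op U) : Set.range (mor i) = U.ι ⁻¹' {point p} := by
  have h₁ : ∀ x, U.ι (mor i x) = point p := fun x =>
    (congrArg (fun f => f x) (mor_w i)).trans (quotient_apply p x)
  ext z
  constructor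
  · rintro ⟨x, rfl⟩
    exact h₁ x
  · intro hz
    have hmax := p.isPrime.isMaximal p.ne_bot
    let _ := Ideal.Quotient.field p.asIdeal
    let x : Spec (CommRingCat.of (𝓞 F ⧸ p.asIdeal)) :=
      (⟨⊥, Ideal.isPrime_bot⟩ : PrimeSpectrum (𝓞 F ⧸ p.asIdeal))
    exact ⟨x, U.ι.injective ((h₁ x).trans (Set.mem_singleton_iff.1 hz).symm)⟩

lemma range_op {V U : (specO F).Opens} (j : op V ⟶ op U) : Set.range (mor j) = U.ι ⁻¹' V := by
  have h₁ : ∀ x, U.ι (mor j x) = V.ι x := fun x => congrArg (fun f => f x) (mor_w j)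
  ext z
  constructor
  · rintro ⟨x, rfl⟩
    change U.ι (mor j x) ∈ V
    rw [h₁]
    exact x.2
  · intro hz
    exact ⟨⟨U.ι z, hz⟩, U.ι.injective (h₁ _)⟩

/-- The open complement of a closed point of an open subscheme. -/
lemma exists_isOpenComplement {p : IsDedekindDomain.HeightOneSpectrum (𝓞 F)}
    {U : (specO F).Opens} (i : pt p ⟶ op U) :
    ∃ j : op (U ⊓ compl {p}) ⟶ op U, IsOpenComplement j i := by
  obtain ⟨j⟩ := exists_op (inf_le_left : U ⊓ compl {p} ≤ U)
  refine ⟨j, inferInstance, inferInstance, ?_⟩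
  rw [range_pt, range_op]
  ext z
  change (U.ι z ∈ U ∧ U.ι z ∈ (⋃ q ∈ ({p} : Finset _), {point q})ᶜ) ↔ ¬ (U.ι z = point p)
  simp only [Finset.mem_singleton, Set.iUnion_iUnion_eq_left, Set.mem_compl_iff,
    Set.mem_singleton_iff, and_iff_right_iff_imp]
  exact fun _ => z.2

/-! ### Regularity of open subschemes and closed points -/

/-- The local rings of an open subscheme of `Spec 𝓞 F` are localizations of `𝓞 F`. -/
lemma stalk_op (U : (specO F).Opens) (x : (op U).toScheme) :
    Nonempty (Localization.AtPrime (show PrimeSpectrum (𝓞 F) from (op U).obj.hom x).asIdeal ≃+*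
      (op U).toScheme.presheaf.stalk x) := by
  let e := (asIso ((op U).obj.hom.stalkMap x)).commRingCatIsoToRingEquiv
  let k : Algebra (𝓞 F) ((specO F).presheaf.stalk ((op U).obj.hom x)) :=
    StructureSheaf.stalkAlgebra (𝓞 F) _
  have : IsLocalization.AtPrime ((specO F).presheaf.stalk ((op U).obj.hom x))
    (show PrimeSpectrum (𝓞 F) from (op U).obj.hom x).asIdeal :=
    StructureSheaf.IsLocalization.to_stalk (𝓞 F) _
  exact ⟨(IsLocalization.algEquiv (show PrimeSpectrum (𝓞 F) from
    (op U).obj.hom x).asIdeal.primeCompl _ _).toRingEquiv.trans e⟩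

lemma isRegularScheme_op (U : (specO F).Opens) : IsRegularScheme (op U).toScheme := fun x =>
  (stalk_op U x).elim fun e => IsRegularLocalRing.of_ringEquiv e

lemma stalk_pt (p : IsDedekindDomain.HeightOneSpectrum (𝓞 F)) (x : (pt p).toScheme) :
    Nonempty ((𝓞 F ⧸ p.asIdeal) ≃+* (pt p).toScheme.presheaf.stalk x) := by
  have hmax := p.isPrime.isMaximal p.ne_bot
  let k : Algebra (𝓞 F ⧸ p.asIdeal) ((pt p).toScheme.presheaf.stalk x) :=
    StructureSheaf.stalkAlgebra (𝓞 F ⧸ p.asIdeal) _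
  have : IsLocalization.AtPrime ((pt p).toScheme.presheaf.stalk x)
    (show PrimeSpectrum (𝓞 F ⧸ p.asIdeal) from x).asIdeal :=
    StructureSheaf.IsLocalization.to_stalk (𝓞 F ⧸ p.asIdeal) _
  let _ := Ideal.Quotient.field p.asIdeal
  have hx : (show PrimeSpectrum (𝓞 F ⧸ p.asIdeal) from x).asIdeal = ⊥ :=
    (Ideal.eq_bot_or_top _).resolve_right
      (show PrimeSpectrum (𝓞 F ⧸ p.asIdeal) from x).isPrime.ne_top
  refine ⟨(IsLocalization.atUnits (𝓞 F ⧸ p.asIdeal)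
    (show PrimeSpectrum (𝓞 F ⧸ p.asIdeal) from x).asIdeal.primeCompl ?_).toRingEquiv⟩
  intro a ha
  exact IsUnit.mk0 a fun h => ha (by rw [h]; exact Ideal.zero_mem _)

lemma isRegularScheme_pt (p : IsDedekindDomain.HeightOneSpectrum (𝓞 F)) :
    IsRegularScheme (pt p).toScheme := fun x => by
  obtain ⟨e⟩ := stalk_pt p x
  have hmax := p.isPrime.isMaximal p.ne_bot
  let _ := Ideal.Quotient.field p.asIdeal
  exact IsRegularLocalRing.of_ringEquiv e

lemma hasCodim_pt {p : IsDedekindDomain.HeightOneSpectrum (𝓞 F)} {U : (specO F).Opens}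
    (i : pt p ⟶ op U) : HasCodim (mor i) 1 := by
  intro z
  obtain ⟨e⟩ := stalk_op U (mor i z)
  obtain ⟨e'⟩ := stalk_pt p z
  have hmax := p.isPrime.isMaximal p.ne_bot
  have h : (op U).obj.hom (mor i z) = point p :=
    (congrArg (fun f => f z) (mor_w i)).trans (quotient_apply p z)
  have h0 : ringKrullDim (𝓞 F ⧸ p.asIdeal) = 0 :=
    ringKrullDim_eq_zero_of_isField
      ((Ideal.Quotient.maximal_ideal_iff_isField_quotient _).1 hmax)
  rw [← ringKrullDim_eq_of_ringEquiv e, ← ringKrullDim_eq_of_ringEquiv e', h0]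
  have : IsDiscreteValuationRing (Localization.AtPrime p.asIdeal) :=
    IsLocalization.AtPrime.isDiscreteValuationRing_of_dedekind_domain (𝓞 F) p.ne_bot _
  have key : ∀ x : PrimeSpectrum (𝓞 F), x = point p →
      ringKrullDim (Localization.AtPrime x.asIdeal) = 1 := by
    rintro _ rfl
    exact IsDiscreteValuationRing.ringKrullDim_eq_one (Localization.AtPrime p.asIdeal)
  rw [key _ h]
  rfl

end Sch

/-! ### Projective models -/

section Image
variable {X Y Z S T : Scheme.{0}}

/-- A quasi-compact morphism has trivial kernel onto its scheme-theoretic image. -/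
lemma isSchemeTheoreticallyDominant_toImage (f : X ⟶ Y) [QuasiCompact f] :
    IsSchemeTheoreticallyDominant f.toImage := by
  constructor
  refine Scheme.IdealSheafData.ext_of_iSup_eq_top
    (fun U : Y.affineOpens => ⟨f.imageι ⁻¹ᵁ U, U.2.preimage _⟩) ?_ ?_
  · rw [← top_le_iff]
    intro x _
    obtain ⟨_, ⟨U, hU, rfl⟩, hxU, -⟩ := Y.isBasis_affineOpens.exists_subset_of_mem_open
      (Set.mem_univ (f.imageι x)) isOpen_univ
    exact TopologicalSpace.Opens.mem_iSup.2 ⟨⟨U, hU⟩, hxU⟩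
  · intro U
    rw [Scheme.Hom.ker_apply]
    simpa [RingHom.injective_iff_ker_eq_bot] using f.toImage_app_injective U

/-- The scheme-theoretic image of an immersion into the fibre of `X` over a flat monomorphism
`T ⟶ S` has that immersion as its fibre, provided that the latter is closed. -/
lemma isPullback_toImage {P : Scheme.{0}} (k : Z ⟶ P) [IsClosedImmersion k] (q : P ⟶ Y) [Mono q]
    [Flat q] [QuasiCompact q] : IsPullback (k ≫ q).toImage k (k ≫ q).imageι q := by
  let W := pullback (k ≫ q).imageι q
  let l : Z ⟶ W := pullback.lift (k ≫ q).toImage k (by simp)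
  have hl : l ≫ pullback.snd _ _ = k := pullback.lift_snd _ _ _
  have hl' : l ≫ pullback.fst _ _ = (k ≫ q).toImage := pullback.lift_fst _ _ _
  have : IsClosedImmersion (l ≫ pullback.snd (k ≫ q).imageι q) := by rw [hl]; infer_instance
  have : IsClosedImmersion l := IsClosedImmersion.of_comp _ (pullback.snd (k ≫ q).imageι q)
  have hP : IsPullback (𝟙 Z) l (k ≫ q).toImage (pullback.fst (k ≫ q).imageι q) := by
    have h := (IsPullback.of_vert_isIso (fst := l) (snd := 𝟙 Z) (f := 𝟙 W) (g := l)
      ⟨by simp⟩).paste_horiz (IsKernelPair.id_of_mono (pullback.fst (k ≫ q).imageι q))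
    rw [Category.comp_id, hl'] at h
    exact h.flip
  have := isSchemeTheoreticallyDominant_toImage (k ≫ q)
  have := IsSchemeTheoreticallyDominant.of_isPullback hP
  have : IsIso l := IsClosedImmersion.isIso_iff_ker_eq_bot.2 l.ker_eq_bot
  exact (IsPullback.of_hasPullback _ _).of_iso (asIso l).symm (Iso.refl _) (Iso.refl _)
    (Iso.refl _) (by simp [← hl']) (by simp [← hl]) (by simp) (by simp)

lemma LocallyOfFinitePresentation.of_locallyOfFiniteType (f : X ⟶ Y) [LocallyOfFiniteType f]
    [IsLocallyNoetherian Y] : LocallyOfFinitePresentation f := by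
  constructor
  intro U hU V hV e
  have : IsNoetherianRing Γ(Y, U) := IsLocallyNoetherian.component_noetherian ⟨U, hU⟩
  exact RingHom.FinitePresentation.of_finiteType.1 (f.finiteType_appLE hU hV e)

end Image

/-- A flat local homomorphism is faithfully flat, hence injective. -/
lemma isIso_stalkMap_of_flat {X Y : Scheme.{0}} (f : X ⟶ Y) [Flat f] [SurjectiveOnStalks f]
    (x : X) : IsIso (f.stalkMap x) := by
  refine (ConcreteCategory.isIso_iff_bijective _).2 ⟨?_, f.stalkMap_surjective x⟩
  have h : (f.stalkMap x).hom.Flat := Flat.stalkMap f x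
  let _ := (f.stalkMap x).hom.toAlgebra
  have : Module.Flat (Y.presheaf.stalk (f x)) (X.presheaf.stalk x) := h
  have : IsLocalHom (algebraMap (Y.presheaf.stalk (f x)) (X.presheaf.stalk x)) :=
    inferInstanceAs (IsLocalHom (f.stalkMap x).hom)
  have : Module.FaithfullyFlat (Y.presheaf.stalk (f x)) (X.presheaf.stalk x) :=
    Module.FaithfullyFlat.of_flat_of_isLocalHom
  exact FaithfulSMul.algebraMap_injective (Y.presheaf.stalk (f x)) (X.presheaf.stalk x)

section Models
variable {F : Type} [Field F] [NumberField F]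
open Sch

instance : IsPreimmersion (genericPt F) :=
  IsPreimmersion.of_isLocalization (nonZeroDivisors (𝓞 F))

instance : Flat (genericPt F) := by
  have h : Module.Flat (𝓞 F) F := IsLocalization.flat F (nonZeroDivisors (𝓞 F))
  rw [Flat.SpecMap_iff]
  exact RingHom.flat_algebraMap_iff.2 h

instance : Mono (mor (gen F).struct) :=
  inferInstanceAs (Mono (genericPt F ≫ (specO F).topIso.inv))

instance : Flat (mor (gen F).struct) :=
  inferInstanceAs (Flat (genericPt F ≫ (specO F).topIso.inv))

instance : QuasiCompact (mor (gen F).struct) :=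
  inferInstanceAs (QuasiCompact (genericPt F ≫ (specO F).topIso.inv))

/-- The scheme-theoretic closure of a projective scheme over `F` in projective space over `𝓞 F` is a
projective model. -/
lemma exists_projectiveModel {Y : Sch F} (y : Y ⟶ gen F) (hy : IsProjectiveHom (mor y)) :
    Nonempty (MixedMotives.ProjectiveModel y) := by
  obtain ⟨n, k, hk, hky⟩ := hy
  obtain ⟨q, hP⟩ : ∃ q, IsPullback q (projSpace n (gen F).toScheme).hom
      (projSpace n (top F).toScheme).hom (mor (gen F).struct) := ⟨_, isPullback_projSpace n _⟩
  have : Mono q := MorphismProperty.of_isPullback (P := MorphismProperty.monomorphisms _) hP.flip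
    inferInstance
  have : Flat q := MorphismProperty.of_isPullback hP.flip inferInstance
  have : QuasiCompact q := MorphismProperty.of_isPullback hP.flip inferInstance
  have hQ := (isPullback_toImage k q).paste_vert hP
  let f := (k ≫ q).imageι ≫ (projSpace n (top F).toScheme).hom
  have hf : IsProjectiveHom f := ⟨n, (k ≫ q).imageι, inferInstance, rfl⟩
  have := hf.isProper
  rw [hky] at hQ
  have e₁ : (k ≫ q).toImage ≫ f = mor y ≫ mor (gen F).struct := hQ.w
  exact ⟨{
    X := ofHom (top F) f
    f := ofHomπ (top F) f
    a := homMk (k ≫ q).toImage ((Category.assoc _ _ _).symm.trans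
      ((congrArg (· ≫ (top F).obj.hom) e₁).trans (mor_w (y ≫ (gen F).struct))))
    comm := op_top_hom_ext _ _
    projective := hf
    cartesian := hQ }⟩

variable {Y : Sch F} {y : Y ⟶ gen F} (m : MixedMotives.ProjectiveModel y)

/-- The model is smooth at the points of its generic fibre. -/
lemma MixedMotives.ProjectiveModel.mem_smoothLocus [Smooth (mor y)]
    [LocallyOfFinitePresentation m.X.obj.hom] (z : Y.toScheme) :
    mor m.a z ∈ m.X.obj.hom.smoothLocus := by
  have : Flat (gen F).obj.hom := inferInstanceAs (Flat (genericPt F))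
  have : SurjectiveOnStalks (gen F).obj.hom := inferInstanceAs (SurjectiveOnStalks (genericPt F))
  have hy : ((mor y ≫ (gen F).obj.hom).stalkMap z).hom.FormallySmooth := by
    have h : z ∈ (mor y).smoothLocus := by rw [(mor y).smoothLocus_eq_top]; trivial
    have := isIso_stalkMap_of_flat (gen F).obj.hom (mor y z)
    rw [Scheme.Hom.stalkMap_comp]
    exact (RingHom.FormallySmooth.respectsIso.cancel_left_isIso _ _).2
      ((mor y).mem_smoothLocus.1 h)
  have e : mor y ≫ (gen F).obj.hom = mor m.a ≫ m.X.obj.hom := (mor_w y).trans (mor_w m.a).symm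
  have : Flat (mor m.a) := MorphismProperty.of_isPullback (P := @Flat) m.cartesian.flip inferInstance
  have : SurjectiveOnStalks (mor (gen F).struct) :=
    inferInstanceAs (SurjectiveOnStalks (genericPt F ≫ (specO F).topIso.inv))
  have : SurjectiveOnStalks (mor m.a) :=
    MorphismProperty.of_isPullback (P := @SurjectiveOnStalks) m.cartesian.flip this
  have ha := isIso_stalkMap_of_flat (mor m.a) z
  rw [e] at hy
  rw [Scheme.Hom.stalkMap_comp] at hy
  rw [Scheme.Hom.mem_smoothLocus]
  exact (RingHom.FormallySmooth.respectsIso.cancel_right_isIso _ ((mor m.a).stalkMap z)).1 hy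

include m in
/-- A smooth and projective scheme over `F` extends to a smooth and projective scheme over a
nonempty open subscheme of `Spec 𝓞 F`. -/
lemma MixedMotives.ProjectiveModel.exists_smooth [Smooth (mor y)] :
    ∃ (U : (specO F).Opens) (_ : U ≠ ⊥) (e : gen F ⟶ op U) (X : Sch F) (f : X ⟶ op U) (a : Y ⟶ X),
      Smooth (mor f) ∧ IsProjectiveHom (mor f) ∧ a ≫ f = y ≫ e ∧ Cartesian a y f e := by
  have := m.projective.isProper
  have hx : m.X.obj.hom = mor m.f ≫ (top F).obj.hom := (mor_w m.f).symm
  have hi : IsIso (top F).obj.hom := inferInstanceAs (IsIso (specO F).topIso.hom)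
  have : IsProper m.X.obj.hom := by rw [hx]; infer_instance
  have : LocallyOfFinitePresentation m.X.obj.hom :=
    LocallyOfFinitePresentation.of_locallyOfFiniteType (Y := specO F) m.X.obj.hom
  -- `U` is the complement of the image of the closed set where the model is not smooth
  let U : (specO F).Opens := ⟨(m.X.obj.hom '' (m.X.obj.hom.smoothLocus : Set _)ᶜ)ᶜ,
    (m.X.obj.hom.isClosedMap _ m.X.obj.hom.smoothLocus.isOpen.isClosed_compl).isOpen_compl⟩
  -- a point of the model over the generic point lies in the generic fibre, where the model is
  -- smooth
  have hgen : genPoint F ∈ U := by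
    rintro ⟨x, hx, hx'⟩
    let t : (gen F).toScheme := (⟨⊥, Ideal.isPrime_bot⟩ : PrimeSpectrum F)
    have h : mor m.f x = mor (gen F).struct t := by
      refine (top F).obj.hom.injective ?_
      have h₁ : (top F).obj.hom (mor m.f x) = m.X.obj.hom x := congrArg (fun f => f x) (mor_w m.f)
      have h₂ : (top F).obj.hom (mor (gen F).struct t) = genericPt F t :=
        congrArg (fun f => f t) (mor_w (gen F).struct)
      exact (h₁.trans hx').trans (h₂.trans (genericPt_apply _)).symm
    obtain ⟨z, hz, -⟩ := Scheme.Pullback.exists_preimage_pullback _ _ h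
    refine hx ?_
    have := m.mem_smoothLocus (m.cartesian.isoPullback.inv z)
    rwa [← Scheme.Hom.comp_apply, m.cartesian.isoPullback_inv_fst, hz] at this
  have hU : U ≠ ⊥ := fun h => by
    rw [h] at hgen
    exact hgen
  obtain ⟨e⟩ := exists_gen hU
  obtain ⟨j⟩ := exists_op (le_top : U ≤ ⊤)
  obtain ⟨X, b, f, w, hc⟩ := exists_cartesian m.f j
  have hb : IsOpenImmersion (mor b) :=
    MorphismProperty.of_isPullback (P := @IsOpenImmersion) hc.flip inferInstance
  have e₁ : mor b ≫ m.X.obj.hom = mor f ≫ (op U).obj.hom := (mor_w b).trans (mor_w f).symm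
  have hs : Smooth (mor b ≫ m.X.obj.hom) := by
    rw [← Scheme.Hom.smoothLocus_eq_top_iff, ← Scheme.Hom.preimage_smoothLocus_eq, ← top_le_iff]
    intro z _
    by_contra h
    have h₁ : (mor b ≫ m.X.obj.hom) z = (mor f ≫ (op U).obj.hom) z := by rw [e₁]
    have h₂ : (op U).obj.hom (mor f z) ∈ U := (mor f z).2
    exact h₂ ⟨mor b z, h, h₁⟩
  rw [e₁] at hs
  have hsm : Smooth (mor f) := by
    have h := (IsPullback.of_vert_isIso (fst := mor f) (snd := 𝟙 _) (f := 𝟙 _) (g := mor f)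
      ⟨by simp⟩).paste_horiz (IsKernelPair.id_of_mono (op U).obj.hom)
    rw [Category.comp_id] at h
    exact MorphismProperty.of_isPullback (P := @Smooth) h.flip hs
  have he : e ≫ j = (gen F).struct := op_hom_ext _ _
  have hQ : IsPullback (mor m.a) (mor y) (mor m.f) (mor e ≫ mor j) := by
    rw [← mor_comp, he]
    exact m.cartesian
  let a := hc.lift (mor m.a) (mor y ≫ mor e) (by rw [hQ.w, Category.assoc])
  have ha : a ≫ mor b = mor m.a := hc.lift_fst _ _ _
  have ha' : a ≫ mor f = mor y ≫ mor e := hc.lift_snd _ _ _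
  exact ⟨U, hU, e, X, f, homMk a (by rw [← mor_w b, ← Category.assoc, ha, mor_w]), hsm,
    IsProjectiveHom.of_isPullback hc m.projective, op_hom_ext _ _,
    IsPullback.of_right (h₁₁ := a) (by rwa [ha]) ha' hc⟩

end Models

/-! ### Invertible twists and the projection formula -/

section Tensor
open Functor.LaxMonoidal Functor.OplaxMonoidal
variable {C : Type*} [Category C] [MonoidalCategory C]

/-- Tensoring on the right with an invertible object is an equivalence. -/
def tensorRightEquivalence {L L' : C} (e : L ⊗ L' ≅ 𝟙_ C) (e' : L' ⊗ L ≅ 𝟙_ C) : C ≌ C :=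
  CategoryTheory.Equivalence.mk (tensorRight L) (tensorRight L')
    (NatIso.ofComponents (fun X => (ρ_ X).symm ≪≫ whiskerLeftIso X e.symm ≪≫ (α_ X L L').symm)
      (fun {X Y} f => by
        change f ≫ (ρ_ Y).inv ≫ Y ◁ e.inv ≫ (α_ Y L L').inv =
          ((ρ_ X).inv ≫ X ◁ e.inv ≫ (α_ X L L').inv) ≫ f ▷ L ▷ L'
        rw [rightUnitor_inv_naturality_assoc, ← whisker_exchange_assoc]; simp))
    (NatIso.ofComponents (fun X => α_ X L' L ≪≫ whiskerLeftIso X e' ≪≫ ρ_ X)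
      (fun {X Y} f => by
        change f ▷ L' ▷ L ≫ (α_ Y L' L).hom ≫ Y ◁ e'.hom ≫ (ρ_ Y).hom =
          ((α_ X L' L).hom ≫ X ◁ e'.hom ≫ (ρ_ X).hom) ≫ f
        simp only [Category.assoc, ← rightUnitor_naturality, whisker_exchange_assoc]; simp))

lemma nonempty_tensorPower_inverse [SymmetricCategory C] {A B : C} (e : A ⊗ B ≅ 𝟙_ C) (n : ℕ) :
    Nonempty (tensorPower A n ⊗ tensorPower B n ≅ 𝟙_ C) := by
  induction n with
  | zero => exact ⟨λ_ _⟩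
  | succ n ih =>
    obtain ⟨f⟩ := ih
    exact ⟨⟨tensorμ _ _ _ _, tensorδ _ _ _ _, tensorμ_tensorδ _ _ _ _, tensorδ_tensorμ _ _ _ _⟩ ≪≫
      MonoidalCategory.tensorIso f e ≪≫ λ_ _⟩

variable {D : Type*} [Category D] [MonoidalCategory D] {P : C ⥤ D} {G : D ⥤ C} (adj : P ⊣ G)
  [P.Monoidal] {L L' : C}

/-- The projection formula for tensor products with invertible objects. -/
def projectionFormula (e : L ⊗ L' ≅ 𝟙_ C) (e' : L' ⊗ L ≅ 𝟙_ C) (f : P.obj L ⊗ P.obj L' ≅ 𝟙_ D)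
    (f' : P.obj L' ⊗ P.obj L ≅ 𝟙_ D) : G ⋙ tensorRight L ≅ tensorRight (P.obj L) ⋙ G :=
  conjugateIsoEquiv ((tensorRightEquivalence e' e).toAdjunction.comp adj)
    (adj.comp (tensorRightEquivalence f' f).toAdjunction)
    (NatIso.ofComponents (fun X => Functor.Monoidal.μIso P X L') fun g =>
      Functor.LaxMonoidal.μ_natural_left P g L')

/-- For a strong monoidal functor `P` with right adjoint `G` and an invertible object `L`, a
morphism `A ⟶ G B ⊗ L` is determined by its adjoint `P A ⟶ B ⊗ P L`. -/
lemma eq_zero_of_map_comp_counit_eq_zero [Preadditive C] [Preadditive D]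
    [MonoidalPreadditive C] [MonoidalPreadditive D] [P.Additive]
    (e : L ⊗ L' ≅ 𝟙_ C) (e' : L' ⊗ L ≅ 𝟙_ C) {A : C} {B : D} (y : A ⟶ G.obj B ⊗ L)
    (h : P.map y ≫ δ P _ _ ≫ adj.counit.app B ▷ P.obj L = 0) : y = 0 := by
  let g : A ⊗ L' ⟶ G.obj B := y ▷ L' ≫ (α_ _ _ _).hom ≫ G.obj B ◁ e.hom ≫ (ρ_ _).hom
  have hg : g = 0 := by
    apply (adj.homEquiv _ _).symm.injective
    rw [Adjunction.homEquiv_counit, Adjunction.homEquiv_counit, P.map_zero, zero_comp]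
    have key (p : P.obj (G.obj B) ⟶ B) : P.map g ≫ p = δ P A L' ≫
        (P.map y ≫ δ P _ _ ≫ p ▷ P.obj L) ▷ P.obj L' ≫ (α_ _ _ _).hom ≫
          B ◁ (μ P _ _ ≫ P.map e.hom ≫ η P) ≫ (ρ_ B).hom := by
      have h₁ : P.map g = δ P A L' ≫ P.map y ▷ P.obj L' ≫ δ P _ _ ▷ P.obj L' ≫ (α_ _ _ _).hom ≫
          P.obj (G.obj B) ◁ μ P _ _ ≫ P.obj (G.obj B) ◁ P.map e.hom ≫
            P.obj (G.obj B) ◁ η P ≫ (ρ_ _).hom := by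
        simp [g]
      rw [h₁, comp_whiskerRight, comp_whiskerRight, MonoidalCategory.whiskerLeft_comp,
        MonoidalCategory.whiskerLeft_comp]
      simp only [Category.assoc, associator_naturality_left_assoc, ← whisker_exchange_assoc,
        rightUnitor_naturality]
    refine (key _).trans ?_
    rw [h, MonoidalPreadditive.zero_whiskerRight, zero_comp, comp_zero]
  have h₁ : y ▷ L' = 0 := by
    rw [← cancel_mono ((α_ (G.obj B) L L').hom ≫ G.obj B ◁ e.hom ≫ (ρ_ _).hom), zero_comp]
    exact hg
  have : (tensorRight L').Faithful :=
    inferInstanceAs (tensorRightEquivalence e' e).functor.Faithful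
  refine (tensorRight L').map_injective ?_
  exact h₁.trans (MonoidalPreadditive.zero_whiskerRight).symm
end Tensor

namespace TateMotives
variable {F : Type} [Field F] [NumberField F] (D : TateMotives.{v, u} F)

/-- `1(0) ≅ 1`. -/
def tateZero (S : Sch F) : D.tate S 0 ≅ 𝟙_ (D.DM S) :=
  (Functor.Monoidal.εIso (D.pull S.struct)).symm

/-- `M(0) ≅ M`. -/
def twistZero (S : Sch F) (M : D.DM S) : (D.twist S 0).obj M ≅ M :=
  whiskerLeftIso M (D.tateZero S) ≪≫ ρ_ M

end TateMotives

namespace TriangulatedMotives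
open Sch
variable {F : Type} [Field F] [NumberField F] (D : TriangulatedMotives.{v, u} F)

lemma exists_tate_inverse (S : Sch F) (n : ℤ) : Nonempty (D.tate S n ⊗ D.tate S (-n) ≅ 𝟙_ _) := by
  obtain ⟨e⟩ := D.tate_inverse
  have key : Nonempty (D.tateTop n ⊗ D.tateTop (-n) ≅ 𝟙_ _) := by
    obtain n | n := n
    · obtain _ | n := n
      · exact ⟨λ_ _⟩
      · exact nonempty_tensorPower_inverse (β_ _ _ ≪≫ e) (n + 1)
    · exact nonempty_tensorPower_inverse e (n + 1)
  obtain ⟨f⟩ := key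
  exact ⟨Functor.Monoidal.μIso (D.pull S.struct) _ _ ≪≫ (D.pull S.struct).mapIso f ≪≫
    (Functor.Monoidal.εIso _).symm⟩

/-- `1(n) ⊗ 1(-n) ≅ 1`. -/
def tateInverse (S : Sch F) (n : ℤ) : D.tate S n ⊗ D.tate S (-n) ≅ 𝟙_ _ :=
  (D.exists_tate_inverse S n).some

/-- The functor `M ↦ M(n)` is an equivalence. -/
def twistEquivalence (S : Sch F) (n : ℤ) : D.DM S ≌ D.DM S :=
  tensorRightEquivalence (D.tateInverse S n) (β_ _ _ ≪≫ D.tateInverse S n)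

/-- `M(n)(-n) ≅ M`. -/
def twistNeg (S : Sch F) (n : ℤ) (M : D.DM S) :
    (D.twist S (-n)).obj ((D.twist S n).obj M) ≅ M :=
  ((D.twistEquivalence S n).unitIso.app M).symm

/-- `M(-n)(n) ≅ M`. -/
def negTwist (S : Sch F) (n : ℤ) (M : D.DM S) :
    (D.twist S n).obj ((D.twist S (-n)).obj M) ≅ M :=
  (D.twistEquivalence S n).counitIso.app M

/-- `(f_* M)(n) ≅ f_* (M(n))`, naturally in `M`. -/
def pushTwistIso {X Y : Sch F} (f : X ⟶ Y) (n : ℤ) :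
    D.push f ⋙ D.twist Y n ≅ D.twist X n ⋙ D.push f :=
  projectionFormula (D.adj f) (D.tateInverse Y n) (β_ _ _ ≪≫ D.tateInverse Y n)
    (MonoidalCategory.tensorIso (D.pullTate f n) (D.pullTate f (-n)) ≪≫ D.tateInverse X n)
    (MonoidalCategory.tensorIso (D.pullTate f (-n)) (D.pullTate f n) ≪≫ β_ _ _ ≪≫
      D.tateInverse X n) ≪≫
    Functor.isoWhiskerRight ((tensoringRight _).mapIso (D.pullTate f n)) (D.push f)

/-- `(f_* M)(n) ≅ f_* (M(n))`. -/
def pushTwist {X Y : Sch F} (f : X ⟶ Y) (n : ℤ) (M : D.DM X) :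
    (D.twist Y n).obj ((D.push f).obj M) ≅ (D.push f).obj ((D.twist X n).obj M) :=
  (D.pushTwistIso f n).app M

/-- By the projection formula, a morphism `A ⟶ (f_* N)(n)` is determined by its adjoint `f^* A ⟶
N(n)`. -/
lemma eq_zero_of_map_pullTwist_counit {X S : Sch F} (f : X ⟶ S) (n : ℤ) {N : D.DM X} {A : D.DM S}
    (y : A ⟶ (D.twist S n).obj ((D.push f).obj N))
    (h : (D.pull f).map y ≫ (D.pullTwist f n _).hom ≫
      (D.twist X n).map ((D.adj f).counit.app N) = 0) : y = 0 := by
  refine eq_zero_of_map_comp_counit_eq_zero (D.adj f) (D.tateInverse S n)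
    (β_ _ _ ≪≫ D.tateInverse S n) y ?_
  rw [← cancel_mono (N ◁ (D.pullTate f n).hom), zero_comp, ← h]
  simp only [TateMotives.pullTwist, Iso.trans_hom, Iso.symm_hom, Category.assoc]
  congr 2
  exact (whisker_exchange _ _).symm

end TriangulatedMotives

/-! ### Functors attached to immersions -/

lemma Sch.genPoint_mem_of_hom {F : Type} [Field F] [NumberField F] {U : (specO F).Opens}
    (e : gen F ⟶ op U) : genPoint F ∈ U := by
  let x : (gen F).toScheme := (⟨⊥, Ideal.isPrime_bot⟩ : PrimeSpectrum F)
  have h : (op U).obj.hom (mor e x) = genPoint F :=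
    (congrArg (fun f => f x) (mor_w e)).trans (genericPt_apply _)
  rw [← h]
  exact (mor e x).2

namespace TriangulatedMotives
open Sch
variable {F : Type} [Field F] [NumberField F] (D : TriangulatedMotives.{v, u} F)

/-- `f_! ≅ f_*` for projective `f`. -/
def shriekIsoPush {X Y : Sch F} (f : X ⟶ Y) (hf : IsProjectiveHom (mor f)) :
    D.shriek f ≅ D.push f :=
  have := D.forget_isIso f hf
  asIso (D.forget f)

/-- `i_! ≅ i_*` for a closed immersion `i`. -/
def shriekIsoPushOfClosed {X Y : Sch F} (i : X ⟶ Y) [IsClosedImmersion (mor i)] :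
    D.shriek i ≅ D.push i :=
  D.shriekIsoPush i (.of_isClosedImmersion _)

/-- `f_* ⊣ f^!` for projective `f`. -/
def pushAdj {X Y : Sch F} (f : X ⟶ Y) (hf : IsProjectiveHom (mor f)) : D.push f ⊣ D.upper f :=
  (D.shriekAdj f).ofNatIsoLeft (D.shriekIsoPush f hf)

/-- `g^! ⋙ f^! ≅ (f ≫ g)^!`. -/
def upperComp {X Y Z : Sch F} {f : X ⟶ Y} {g : Y ⟶ Z} {h : X ⟶ Z} (w : f ≫ g = h)
    (hf : IsQuasiProjectiveHom (mor f)) (hg : IsQuasiProjectiveHom (mor g)) :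
    D.upper g ⋙ D.upper f ≅ D.upper h :=
  conjugateIsoEquiv ((D.shriekAdj f).comp (D.shriekAdj g)) (D.shriekAdj h)
    (D.shriekComp w hf hg).symm

/-- `i^! f_* ≅ g_* a^!` for a cartesian square. -/
def upperPush {P X Y S : Sch F} {a : P ⟶ Y} {g : P ⟶ X} {i : X ⟶ S} {f : Y ⟶ S}
    (w : g ≫ i = a ≫ f) (hc : Cartesian g a i f) (hi : IsQuasiProjectiveHom (mor i)) :
    D.push f ⋙ D.upper i ≅ D.upper a ⋙ D.push g :=
  conjugateIsoEquiv ((D.shriekAdj i).comp (D.adj f)) ((D.adj g).comp (D.shriekAdj a))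
    (D.baseChange w hc hi).symm

/-- `f^! (M(n)) ≅ (f^! M)(n)` for projective `f`. -/
def upperTwist {X Y : Sch F} (f : X ⟶ Y) (hf : IsProjectiveHom (mor f)) (n : ℤ) (M : D.DM Y) :
    (D.upper f).obj ((D.twist Y n).obj M) ≅ (D.twist X n).obj ((D.upper f).obj M) :=
  (conjugateIsoEquiv
    ((D.pushAdj f hf).comp (D.twistEquivalence Y n).symm.toAdjunction)
    ((D.twistEquivalence X n).symm.toAdjunction.comp (D.pushAdj f hf))
    (D.pushTwistIso f (-n)).symm).app M

lemma pull_id_isEquivalence (X : Sch F) : (D.pull (𝟙 X)).IsEquivalence :=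
  Functor.isEquivalence_of_iso (D.pullId X).symm

/-- For an open immersion `j`, the map `j^* j_! M → j^* j_* M` is an isomorphism. -/
lemma isIso_pull_map_forget {V X : Sch F} (j : V ⟶ X) [IsOpenImmersion (mor j)] (M : D.DM V) :
    IsIso ((D.pull j).map ((D.forget j).app M)) := by
  have hw : 𝟙 V ≫ j = 𝟙 V ≫ j := rfl
  have hc : Cartesian (𝟙 V) (𝟙 V) j j := IsKernelPair.id_of_mono (mor j)
  have hj := IsQuasiProjectiveHom.of_isImmersion (mor j)
  have h := D.baseChange_forget hw hc hj M
  have : IsClosedImmersion (mor (𝟙 V)) := inferInstanceAs (IsClosedImmersion (𝟙 _))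
  have := D.forget_isIso (𝟙 V) (.of_isClosedImmersion _)
  have := D.open_counit j inferInstance
  have := D.pull_id_isEquivalence V
  have : IsIso (D.exchange hw M) := by
    rw [InverseImages.exchange, Adjunction.homEquiv_unit]
    infer_instance
  have h₂ : IsIso ((D.pull j).map ((D.forget j).app M) ≫ D.exchange hw M) := by
    rw [← h]
    infer_instance
  exact IsIso.of_isIso_comp_right _ (D.exchange hw M)

variable {D}

/-- By adjunction, `i^! j_* = 0` follows from `j^* i_* = 0`. -/
lemma isZero_upper_push {V Z X : Sch F} {j : V ⟶ X} {i : Z ⟶ X} [IsClosedImmersion (mor i)]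
    (h : ∀ M, IsZero ((D.pull j).obj ((D.push i).obj M))) (M : D.DM V) :
    IsZero ((D.upper i).obj ((D.push j).obj M)) := by
  rw [IsZero.iff_id_eq_zero]
  apply ((D.shriekAdj i).homEquiv _ _).symm.injective
  apply ((D.adj j).homEquiv _ _).symm.injective
  exact ((h _).of_iso ((D.pull j).mapIso ((D.shriekIsoPushOfClosed i).app _))).eq_of_src _ _

/-- By adjunction, `i^* j_! = 0` follows from `j^* i_* = 0`. -/
lemma isZero_pull_shriek {V Z X : Sch F} {j : V ⟶ X} {i : Z ⟶ X} [IsOpenImmersion (mor j)]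
    (h : ∀ M, IsZero ((D.pull j).obj ((D.push i).obj M))) (M : D.DM V) :
    IsZero ((D.pull i).obj ((D.shriek j).obj M)) := by
  rw [IsZero.iff_id_eq_zero]
  apply ((D.adj i).homEquiv _ _).injective
  apply ((D.shriekAdj j).homEquiv _ _).injective
  exact ((h _).of_iso ((D.openIso j inferInstance).symm.app _)).eq_of_tgt _ _

section Point
variable {p : IsDedekindDomain.HeightOneSpectrum (𝓞 F)} {U V : (specO F).Opens} (i : pt p ⟶ op U)
  (j : op V ⟶ op U) (h : point p ∉ V)

lemma isZero_pull_push_of_factor {W X : Sch F} {k : W ⟶ X} {i : pt p ⟶ X} {V : Sch F} {j : V ⟶ X}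
    (l : W ⟶ V) (w : l ≫ j = k) (hj : IsOpenComplement j i) (M) :
    IsZero ((D.pull k).obj ((D.push i).obj M)) :=
  ((D.pull l).map_isZero (D.open_closed_zero j i hj M)).of_iso ((D.pullComp w).symm.app _)

include h in
lemma isZero_pull_push_pt (M : D.DM (pt p)) : IsZero ((D.pull j).obj ((D.push i).obj M)) := by
  obtain ⟨j', hj'⟩ := exists_isOpenComplement i
  have hV : V ≤ U ⊓ compl {p} := by
    intro x hx
    refine ⟨?_, ?_⟩
    · have h₁ : (op U).obj.hom (mor j ⟨x, hx⟩) = x := congrArg (fun f => f ⟨x, hx⟩) (mor_w j)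
      rw [← h₁]
      exact (mor j ⟨x, hx⟩).2
    · obtain rfl | ⟨q, rfl⟩ := genPoint_or_point x
      · exact genPoint_mem_compl _
      · rw [SetLike.mem_coe, point_mem_compl, Finset.mem_singleton]
        rintro rfl
        exact h hx
  obtain ⟨l⟩ := exists_op hV
  exact isZero_pull_push_of_factor l (op_hom_ext _ _) hj' M

include h in
lemma isZero_upper_push_pt (M : D.DM (op V)) : IsZero ((D.upper i).obj ((D.push j).obj M)) :=
  isZero_upper_push (isZero_pull_push_pt i j h) M

include h in
lemma isZero_pull_shriek_pt (M : D.DM (op V)) : IsZero ((D.pull i).obj ((D.shriek j).obj M)) :=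
  isZero_pull_shriek (isZero_pull_push_pt i j h) M

end Point

end TriangulatedMotives

/-! ### Extension of morphisms from the generic point -/

section Pretriangulated
variable {C : Type u} [Category.{v} C] [Preadditive C] [HasZeroObject C] [HasShift C ℤ]
  [∀ n : ℤ, (shiftFunctor C n).Additive] [Pretriangulated C]
  {X Y Z A : C} {f : X ⟶ Y} {g : Y ⟶ Z} {h : Z ⟶ X⟦(1 : ℤ)⟧}
  (hT : Triangle.mk f g h ∈ distTriang C)
include hT

lemma exists_lift₂ (φ : A ⟶ Y) (hφ : φ ≫ g = 0) : ∃ ψ : A ⟶ X, φ = ψ ≫ f :=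
  Triangle.coyoneda_exact₂ _ hT φ hφ

lemma exists_lift₃ (φ : A ⟶ Z) (hφ : φ ≫ h = 0) : ∃ ψ : A ⟶ Y, φ = ψ ≫ g :=
  Triangle.coyoneda_exact₃ _ hT φ hφ

lemma exists_desc₂ (φ : Y ⟶ A) (hφ : f ≫ φ = 0) : ∃ ψ : Z ⟶ A, φ = g ≫ ψ :=
  Triangle.yoneda_exact₂ _ hT φ hφ

lemma exists_desc₃ (φ : Z ⟶ A) (hφ : g ≫ φ = 0) : ∃ ψ : X⟦(1 : ℤ)⟧ ⟶ A, φ = h ≫ ψ :=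
  Triangle.yoneda_exact₃ _ hT φ hφ

lemma comp_distinguished₁₂ : f ≫ g = 0 := comp_distTriang_mor_zero₁₂ _ hT

lemma map_distinguished' {E : Type*} [Category* E] [Preadditive E] [HasZeroObject E] [HasShift E ℤ]
    [∀ n : ℤ, (shiftFunctor E n).Additive] [Pretriangulated E] (G : C ⥤ E) [G.CommShift ℤ]
    [G.IsTriangulated] : Triangle.mk (G.map f) (G.map g)
      (G.map h ≫ (G.commShiftIso (1 : ℤ)).hom.app X) ∈ distTriang E :=
  G.map_distinguished _ hT

end Pretriangulated

namespace TriangulatedMotives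
open Sch
variable {F : Type} [Field F] [NumberField F] {D : TriangulatedMotives.{v, u} F}

instance {X Y : Sch F} (f : X ⟶ Y) : (D.push f).CommShift ℤ := (D.adj f).rightAdjointCommShift ℤ

instance {X Y : Sch F} (f : X ⟶ Y) : (D.adj f).CommShift ℤ := (D.adj f).commShift_of_leftAdjoint ℤ

instance {X Y : Sch F} (f : X ⟶ Y) : (D.push f).IsTriangulated :=
  (D.adj f).isTriangulated_rightAdjoint

instance {X Y : Sch F} (f : X ⟶ Y) : (D.upper f).CommShift ℤ :=
  (D.shriekAdj f).rightAdjointCommShift ℤ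

instance {X Y : Sch F} (f : X ⟶ Y) : (D.shriekAdj f).CommShift ℤ :=
  (D.shriekAdj f).commShift_of_leftAdjoint ℤ

instance {X Y : Sch F} (f : X ⟶ Y) : (D.upper f).IsTriangulated :=
  (D.shriekAdj f).isTriangulated_rightAdjoint

section Generic
variable {U : (specO F).Opens} (e : gen F ⟶ op U) {M E : D.DM (op U)}
  (hM : compactObjects _ M) (hE : compactObjects _ E)

lemma hom_shriek_eq_zero {p : IsDedekindDomain.HeightOneSpectrum (𝓞 F)} (i : pt p ⟶ op U)
    {N : D.DM (pt p)} (h : ∀ g : (D.pull i).obj M ⟶ N, g = 0) (g : M ⟶ (D.shriek i).obj N) :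
    g = 0 := by
  rw [← cancel_mono ((D.shriekIsoPushOfClosed i).hom.app N), zero_comp]
  apply ((D.adj i).homEquiv _ _).symm.injective
  rw [h (((D.adj i).homEquiv _ _).symm _), h (((D.adj i).homEquiv _ _).symm 0)]

include hM hE in
/-- A morphism that vanishes over the generic point comes from the closed points. -/
lemma eq_zero_of_generic (f : M ⟶ E) (hf : (D.pull e).map f = 0)
    (h : ∀ (p : IsDedekindDomain.HeightOneSpectrum (𝓞 F)) (i : pt p ⟶ op U)
      (g : (D.pull i).obj M ⟶ (D.upper i).obj E), g = 0) : f = 0 := by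
  obtain ⟨c, hc, a, δ, -, hT⟩ := D.genericTriangle U e E hE
  have h₁ : f ≫ (D.adj e).unit.app E = 0 := by
    refine ((D.adj e).unit.naturality f).trans ?_
    dsimp
    rw [hf, Functor.map_zero, comp_zero]
  obtain ⟨g, rfl⟩ := exists_lift₂ hT f h₁
  obtain ⟨s, g, rfl⟩ := hM _ _ c hc g
  rw [Finset.sum_eq_zero, zero_comp]
  intro p _
  rw [hom_shriek_eq_zero p.2.some (h p.1 _) (g p), zero_comp]

include hM hE in
/-- The obstruction to extending a morphism over the generic point is, because `M` is compact, a
finite sum of contributions of closed points. -/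
lemma exists_generic_obstruction (α : (D.pull e).obj M ⟶ (D.pull e).obj E) :
    ∃ (c : D.DM (op U)) (a : c ⟶ E) (δ : (D.push e).obj ((D.pull e).obj E) ⟶ c⟦(1 : ℤ)⟧)
      (s : Finset {p // Nonempty (pt p ⟶ op U)})
      (g : ∀ p, M ⟶ ((D.shriek p.2.some).obj ((D.upper p.2.some).obj E))⟦(1 : ℤ)⟧)
      (k : ∀ p : {p // Nonempty (pt p ⟶ op U)}, (D.shriek p.2.some).obj
        ((D.upper p.2.some).obj E) ⟶ c),
      Triangle.mk a ((D.adj e).unit.app E) δ ∈ distTriang _ ∧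
      (D.adj e).homEquiv _ _ α ≫ δ = ∑ p ∈ s, g p ≫ (k p)⟦1⟧' := by
  obtain ⟨c, hc, a, δ, -, hT⟩ := D.genericTriangle U e E hE
  let c' : Cofan (fun p : {p // Nonempty (pt p ⟶ op U)} =>
      ((D.shriek p.2.some).obj ((D.upper p.2.some).obj E))⟦(1 : ℤ)⟧) :=
    Cofan.mk (c.pt⟦(1 : ℤ)⟧) (fun j => (c.inj j)⟦1⟧')
  have hc' : IsColimit c' :=
    (isColimitMapCoconeCofanMkEquiv (shiftFunctor (D.DM (op U)) (1 : ℤ)) _ _).toFun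
      (isColimitOfPreserves _ hc)
  obtain ⟨s, g, hg⟩ := hM _ _ c' hc' ((D.adj e).homEquiv _ _ α ≫ δ)
  exact ⟨c.pt, a, δ, s, g, c.inj, hT, hg⟩

include hM hE in
/-- A morphism over the generic point extends if there are no obstructions at the closed points. -/
lemma exists_extension_of_generic (α : (D.pull e).obj M ⟶ (D.pull e).obj E)
    (h : ∀ (p : IsDedekindDomain.HeightOneSpectrum (𝓞 F)) (i : pt p ⟶ op U)
      (g : (D.pull i).obj M ⟶ ((D.upper i).obj E)⟦(1 : ℤ)⟧), g = 0) :
    ∃ f : M ⟶ E, (D.pull e).map f = α := by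
  obtain ⟨c, a, δ, s, g, k, hT, hg⟩ := exists_generic_obstruction e hM hE α
  rw [Finset.sum_eq_zero] at hg
  · obtain ⟨f, hf⟩ := exists_lift₃ hT ((D.adj e).homEquiv _ _ α) hg
    refine ⟨f, ((D.adj e).homEquiv _ _).injective ?_⟩
    rw [hf, Adjunction.homEquiv_unit]
    exact ((D.adj e).unit.naturality f).symm
  · intro p _
    have : g p = 0 := by
      rw [← cancel_mono (((D.shriek p.2.some).commShiftIso (1 : ℤ)).inv.app _), zero_comp]
      exact hom_shriek_eq_zero p.2.some (h p.1 _) _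
    rw [this, zero_comp]

include hM hE in
/-- A morphism over the generic point extends over the complement of finitely many closed
points. -/
lemma exists_spread (α : (D.pull e).obj M ⟶ (D.pull e).obj E) :
    ∃ T : Finset (IsDedekindDomain.HeightOneSpectrum (𝓞 F)),
      ∀ (V : (specO F).Opens) (j : op V ⟶ op U) (e' : gen F ⟶ op V) (w : e' ≫ j = e),
        V ≤ compl T → ∃ f : (D.pull j).obj M ⟶ (D.pull j).obj E,
          (D.pull e').map f ≫ (D.pullComp w).hom.app E = (D.pullComp w).hom.app M ≫ α := by
  classical
  obtain ⟨c, a, δ, s, g, k, hT, hg⟩ := exists_generic_obstruction e hM hE α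
  refine ⟨s.image Subtype.val, fun V j e' w hV => ?_⟩
  have h₀ : (D.pull j).map ((D.adj e).homEquiv _ _ α ≫ δ) = 0 := by
    rw [hg, Functor.map_sum]
    refine Finset.sum_eq_zero fun p hp => ?_
    have hp' : point p.1 ∉ V := fun hpV => point_mem_compl.1 (hV hpV) (Finset.mem_image_of_mem _ hp)
    have hz : IsZero ((D.pull j).obj
        (((D.shriek p.2.some).obj ((D.upper p.2.some).obj E))⟦(1 : ℤ)⟧)) :=
      ((shiftFunctor _ (1 : ℤ)).map_isZero ((isZero_pull_push_pt p.2.some j hp' _).of_iso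
        ((D.pull j).mapIso ((D.shriekIsoPushOfClosed _).app _)))).of_iso
          (((D.pull j).commShiftIso (1 : ℤ)).app _)
    rw [Functor.map_comp, hz.eq_of_tgt ((D.pull j).map (g p)) 0, zero_comp]
  obtain ⟨f, hf⟩ := exists_lift₃ (map_distinguished' hT (D.pull j))
    ((D.pull j).map ((D.adj e).homEquiv _ _ α)) (by
      rw [Functor.map_comp] at h₀
      rw [reassoc_of% h₀, zero_comp])
  refine ⟨f, ?_⟩
  have h₁ : (D.pull e').map f ≫ (D.pull e').map ((D.pull j).map ((D.adj e).unit.app E)) =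
      (D.pull e').map ((D.pull j).map ((D.adj e).homEquiv _ _ α)) := by
    rw [hf, Functor.map_comp]
  have n₁ := (D.pullComp w).hom.naturality ((D.adj e).unit.app E)
  have n₂ := (D.pullComp w).hom.naturality ((D.adj e).homEquiv _ _ α)
  dsimp at n₁ n₂
  have h₂ : (D.pull e').map f ≫ (D.pullComp w).hom.app E ≫ (D.pull e).map ((D.adj e).unit.app E) =
      (D.pullComp w).hom.app M ≫ (D.pull e).map ((D.adj e).homEquiv _ _ α) := by
    rw [← n₁, reassoc_of% h₁, n₂]
  have h₃ := congrArg (· ≫ (D.adj e).counit.app _) h₂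
  dsimp at h₃
  simp only [Category.assoc] at h₃
  rw [(D.adj e).left_triangle_components] at h₃
  rw [← (D.adj e).homEquiv_counit, Equiv.symm_apply_apply] at h₃
  refine Eq.trans ?_ h₃
  congr 1
  exact (Category.comp_id _).symm

end Generic

end TriangulatedMotives

/-! ### Retracts, split triangles and cohomological dimension -/

namespace TStructuresAndWeights
open Sch
variable {F : Type} [Field F] [NumberField F] {D : TStructuresAndWeights.{v, u} F} {S S' : Sch F}
  {M N X Y Z : D.DM S} {n a : ℤ}

lemma LE.of_retract (h : D.LE M n) (hX : compactObjects _ X) (r : Retract X M) : D.LE X n := by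
  obtain ⟨A, B, f, g, δ, hT, hA, hB⟩ := exists_truncation D hX n
  have hg : g = 0 := by
    rw [← Category.id_comp g, ← r.retract, Category.assoc,
      hom_eq_zero h hB (by omega) (r.r ≫ g), comp_zero]
  obtain ⟨ψ, hψ⟩ := exists_desc₃ hT (𝟙 B) (by rw [hg, zero_comp])
  rw [hom_eq_zero (hA.shift 1 (n - 1) (by omega)) hB (by omega) ψ, comp_zero] at hψ
  exact LE.obj₂ hT hA (LE.of_isZero ((IsZero.iff_id_eq_zero _).2 hψ))

lemma Weights.le_of_retract (W : WeightAxioms D) (hS : IsArithmeticBase S)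
    (h : D.Weights M (· ≤ a)) (hX : compactObjects _ X) (r : Retract X M) :
    D.Weights X (· ≤ a) := by
  obtain ⟨hM, h⟩ := h
  refine ⟨hX, fun n w hw => ?_⟩
  let ρ : Retract (⟨X, hX⟩ : D.Gm S) ⟨M, hM⟩ := ⟨ObjectProperty.homMk r.i, ObjectProperty.homMk r.r,
    ObjectProperty.hom_ext _ r.retract⟩
  have : WeightLE (D.pH ⟨X, hX⟩ n) (a + n) :=
    W.weightLE_of_mono hS (ρ.map (D.pHFunctor S n)).i
      ((W.weightLE_iff hS).2 fun w hw => by have := h n w hw; omega)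
  have := (W.weightLE_iff hS).1 this w hw
  omega

lemma PreservesNonpos.le {G : D.DM S ⥤ D.DM S'} [G.CommShift ℤ] (hG : D.PreservesNonpos G)
    (h : D.Weights M (· ≤ a)) : D.Weights (G.obj M) (· ≤ a) :=
  ((hG _ (h.shift (-a) fun w hw => by omega)).shift (Q := (· ≤ a)) a
    fun w hw => by omega).of_iso ((shiftFunctor _ a).mapIso ((G.commShiftIso (-a)).app M) ≪≫
      ((shiftEquiv (D.DM S') (-a)).unitIso.app _ ≪≫ eqToIso (by simp [shiftEquiv])).symm)

lemma PreservesNonneg.ge {G : D.DM S ⥤ D.DM S'} [G.CommShift ℤ] (hG : D.PreservesNonneg G)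
    (h : D.Weights M (a ≤ ·)) : D.Weights (G.obj M) (a ≤ ·) :=
  ((hG _ (h.shift (-a) fun w hw => by omega)).shift (Q := (a ≤ ·)) a
    fun w hw => by omega).of_iso ((shiftFunctor _ a).mapIso ((G.commShiftIso (-a)).app M) ≪≫
      ((shiftEquiv (D.DM S') (-a)).unitIso.app _ ≪≫ eqToIso (by simp [shiftEquiv])).symm)

section Triangle
variable {f : X ⟶ Y} {g : Y ⟶ Z} {h : Z ⟶ X⟦(1 : ℤ)⟧} (hT : Triangle.mk f g h ∈ distTriang (D.DM S))
include hT

/-- If `X ⟶ Y` has a section, `X` has cohomology in degrees at most `n` and the third vertex of the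
triangle has cohomology in degrees at least `n`, then the third vertex is zero. -/
lemma isZero₃_of_splitEpi (hX : D.LE X n) (hZ : D.GE Z n) (r : Y ⟶ X) (hr : r ≫ f = 𝟙 Y) :
    IsZero Z := by
  have hg : g = 0 := by
    rw [← Category.id_comp g, ← hr, Category.assoc, comp_distinguished₁₂ hT, comp_zero]
  obtain ⟨ψ, hψ⟩ := exists_desc₃ hT (𝟙 Z) (by rw [hg, zero_comp])
  rw [hom_eq_zero (hX.shift 1 (n - 1) (by omega)) hZ (by omega) ψ, comp_zero] at hψ
  exact (IsZero.iff_id_eq_zero _).2 hψ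

lemma isIso₁_of_isZero₃ (hZ : IsZero Z) : IsIso f := (Triangle.isZero₃_iff_isIso₁ _ hT).1 hZ

lemma isIso₂_of_isZero₁ (hX : IsZero X) : IsIso g := (Triangle.isZero₁_iff_isIso₂ _ hT).1 hX

/-- If a composition `V ⟶ X ⟶ Y` is invertible, `X` has cohomology in degrees at most `n` and the
third vertex of the triangle has cohomology in degrees at least `n`, then `X ⟶ Y` is invertible. -/
lemma isIso_of_comp_of_triangle (hX : D.LE X n) (hZ : D.GE Z n) {V : D.DM S} (v : V ⟶ X)
    [IsIso (v ≫ f)] : IsIso f ∧ IsZero Z := by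
  have hZ : IsZero Z := isZero₃_of_splitEpi hT hX hZ (inv (v ≫ f) ≫ v) (by simp)
  exact ⟨isIso₁_of_isZero₃ hT hZ, hZ⟩

end Triangle

end TStructuresAndWeights

namespace TStructureAxioms
open Sch TStructuresAndWeights
variable {F : Type} [Field F] [NumberField F] {D : TStructuresAndWeights.{v, u} F} {S S' : Sch F}
  (A : TStructureAxioms D)
include A

/-- Cohomological dimension, for motives concentrated in sufficiently low degrees. -/
lemma eq_zero_of_cohDim (hS : IsArithmeticBase S) {M X : D.DM S} {c : ℤ}
    (hM : ∀ K, D.IsMixed K → ∀ i, c < i → ∀ f : M ⟶ K⟦i⟧, f = 0) (hX : D.LE X (-c - 1))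
    (f : M ⟶ X) : f = 0 := by
  have key : ∀ (d : ℕ) (X : D.DM S), D.GE X (-c - 1 - d) → D.LE X (-c - 1) →
      ∀ f : M ⟶ X, f = 0 := by
    intro d
    induction d with
    | zero =>
      intro X h₁ h₂ f
      obtain ⟨K, hK, ⟨e⟩⟩ := exists_mixed_iso (h₁.anti (by simp)) h₂
      rw [← cancel_mono e.hom, hM K hK _ (by omega) (f ≫ e.hom), zero_comp]
    | succ d ih =>
      intro X h₁ h₂ f
      obtain ⟨K, B, g, q, δ, hT, hK, hB, hB'⟩ := exists_lowest h₁ h₂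
      obtain ⟨ψ, rfl⟩ := exists_lift₂ hT f (ih B hB hB' _)
      rw [hM K hK _ (by omega) ψ, zero_comp]
  obtain ⟨a, b, ha, -⟩ := A.exists_bounds hS hX.1
  exact key (-c - 1 - a).toNat X (ha.anti (by omega)) hX f

lemma eq_zero_pt {p : IsDedekindDomain.HeightOneSpectrum (𝓞 F)} {X : D.DM (pt p)}
    (hX : D.LE X (-1)) (f : 𝟙_ (D.DM (pt p)) ⟶ X) : f = 0 :=
  A.eq_zero_of_cohDim (.pt p) (c := 0) (fun K hK i hi f => A.cohDim_pt p _ _ (A.unit_pt p) hK i hi f)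
    (by simpa using hX) f

lemma eq_zero_gen {X : D.DM (gen F)}
    (hX : D.LE X (-2)) (f : 𝟙_ (D.DM (gen F)) ⟶ X) : f = 0 :=
  A.eq_zero_of_cohDim .gen (c := 1) (fun K hK i hi f => A.cohDim_gen _ _ A.unit_gen hK i hi f)
    (by simpa using hX) f

end TStructureAxioms

/-! ### Motives supported in closed points -/

namespace TriangulatedMotives
open Sch
variable {F : Type} [Field F] [NumberField F] {D : TriangulatedMotives.{v, u} F}
  {U : (specO F).Opens} (e : gen F ⟶ op U) {K : D.DM (op U)}

/-- `i^* i_! N ≅ N` for a closed immersion `i`. -/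
def pullShriekIso {X Y : Sch F} (i : X ⟶ Y) [IsClosedImmersion (mor i)] (N : D.DM X) :
    (D.pull i).obj ((D.shriek i).obj N) ≅ N :=
  have := D.closed_counit i inferInstance
  (D.pull i).mapIso ((D.shriekIsoPushOfClosed i).app N) ≪≫ (asIso (D.adj i).counit).app N

/-- A motive `K` supported in closed points is the direct sum of the motives `i_* i^! K`, so that
`i^! K` is a direct summand of `i^* K`. -/
lemma nonempty_retract_of_generic_isZero (hK : compactObjects _ K)
    (h : IsZero ((D.pull e).obj K)) {p : IsDedekindDomain.HeightOneSpectrum (𝓞 F)}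
    (i : pt p ⟶ op U) : Nonempty (Retract ((D.upper i).obj K) ((D.pull i).obj K)) := by
  classical
  obtain ⟨c, hc, a, δ, -, hT⟩ := D.genericTriangle U e K hK
  have : IsIso a := (Triangle.isZero₃_iff_isIso₁ _ hT).1 ((D.push e).map_isZero h)
  let q : {p // Nonempty (pt p ⟶ op U)} := ⟨p, ⟨i⟩⟩
  let π : c.pt ⟶ (D.shriek q.2.some).obj ((D.upper q.2.some).obj K) :=
    Cofan.IsColimit.desc hc fun k => if h : k = q then eqToHom (by rw [h]) else 0
  have hπ : c.inj q ≫ π = 𝟙 _ := (Cofan.IsColimit.fac hc _ q).trans (by simp)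
  rw [op_hom_ext i q.2.some]
  let φ := pullShriekIso q.2.some ((D.upper q.2.some).obj K)
  exact ⟨{
    i := φ.inv ≫ (D.pull _).map (c.inj q ≫ a)
    r := (D.pull _).map (inv a ≫ π) ≫ φ.hom
    retract := by
      rw [Category.assoc, ← (D.pull q.2.some).map_comp_assoc, Category.assoc, IsIso.hom_inv_id_assoc,
        hπ, CategoryTheory.Functor.map_id, Category.id_comp, Iso.inv_hom_id] }⟩

end TriangulatedMotives

namespace TStructureAxioms
open Sch TStructuresAndWeights
variable {F : Type} [Field F] [NumberField F] {D : TStructuresAndWeights.{v, u} F}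
  (A : TStructureAxioms D) {U : (specO F).Opens} (e : gen F ⟶ op U) {K M : D.DM (op U)} {n : ℤ}
include A

lemma pull_LE {p : IsDedekindDomain.HeightOneSpectrum (𝓞 F)} (i : pt p ⟶ op U) (hM : D.LE M n) :
    D.LE ((D.pull i).obj M) n := by
  simpa using (A.closed_pull i M n).2 hM

lemma upper_GE {p : IsDedekindDomain.HeightOneSpectrum (𝓞 F)} (i : pt p ⟶ op U) (hM : D.GE M n) :
    D.GE ((D.upper i).obj M) n := by
  simpa using (A.closed_upper i M n).1 hM

/-- For a motive supported in closed points, `i^!` is exact. -/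
lemma upper_LE_of_generic_isZero (h : IsZero ((D.pull e).obj K))
    {p : IsDedekindDomain.HeightOneSpectrum (𝓞 F)} (i : pt p ⟶ op U) (hK : D.LE K n) :
    D.LE ((D.upper i).obj K) n := by
  obtain ⟨r⟩ := TriangulatedMotives.nonempty_retract_of_generic_isZero e hK.1 h i
  exact (A.pull_LE i hK).of_retract ((A.closed_upper i K n).2 hK).1 r

lemma unit_op_LE (U : (specO F).Opens) : D.LE (𝟙_ (D.DM (op U))) 1 :=
  LE.of_shift 1 0 (A.unit_op U).1 (by omega)

omit A in
/-- Morphisms from `i^* 1` may be replaced by morphisms from `1`. -/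
lemma eq_zero_of_forall_pt {p : IsDedekindDomain.HeightOneSpectrum (𝓞 F)} (i : pt p ⟶ op U)
    {N : D.DM (pt p)} (h : ∀ f : 𝟙_ (D.DM (pt p)) ⟶ N, f = 0)
    (g : (D.pull i).obj (𝟙_ (D.DM (op U))) ⟶ N) : g = 0 := by
  rw [← cancel_epi (Functor.Monoidal.εIso (D.pull i)).hom, h (_ ≫ g), comp_zero]

/-- The cohomology of a mixed motive supported in closed points is concentrated in degree `0`. -/
lemma H_eq_zero_of_generic_isZero (h : IsZero ((D.pull e).obj K)) (hK : D.IsMixed K) {k : ℤ}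
    (hk : k ≠ 0) (x : D.H K k) : x = 0 := by
  have hz : IsZero ((D.pull e).obj (K⟦k⟧)) :=
    ((shiftFunctor _ k).map_isZero h).of_iso (((D.pull e).commShiftIso k).app K)
  have h₁ := hK.1.shift k (-k) (by omega)
  have h₂ := hK.2.shift k (-k) (by omega)
  refine TriangulatedMotives.eq_zero_of_generic e (D.unit_compact _) h₁.1 x (hz.eq_of_tgt _ _)
    fun p i g => eq_zero_of_forall_pt i (fun f => ?_) g
  rcases lt_or_gt_of_ne hk with hk | hk
  · exact hom_eq_zero (A.unit_pt p).1 (A.upper_GE i h₂) (by omega) f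
  · exact A.eq_zero_pt ((A.upper_LE_of_generic_isZero e hz i h₁).mono (by omega)) f

/-- For a motive supported in closed points, classes in degree `0` are sums of morphisms from the
unit, which is pure of weight `0`, to the motives `i^! K`. -/
lemma H_eq_zero_of_weights (W : WeightAxioms D) (h : IsZero ((D.pull e).obj K)) (hK : D.IsMixed K)
    (hw : D.Weights K (· ≤ -1)) (x : D.H K 0) : x = 0 := by
  rw [← cancel_mono ((shiftFunctorZero (D.DM (op U)) ℤ).hom.app K), zero_comp]
  refine TriangulatedMotives.eq_zero_of_generic e (D.unit_compact _) hK.1.1 _ (h.eq_of_tgt _ _)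
    fun p i g => eq_zero_of_forall_pt i (fun f => ?_) g
  have h₁ := A.upper_LE_of_generic_isZero e h i hK.1
  obtain ⟨r⟩ := TriangulatedMotives.nonempty_retract_of_generic_isZero e hK.1.1 h i
  exact W.mixed_hom_eq_zero_of_gt (.pt p) (A.unit_pt p) ⟨h₁, A.upper_GE i hK.2⟩
    ((W.unit (.pt p)).imp fun w hw => (by omega : 0 ≤ w))
    (((W.closed_pull i).le hw).le_of_retract W (.pt p) h₁.1 r) (by omega) f

/-- If the motives `i^* M` are concentrated in degrees `< 0`, then `M` has no quotients supported in
closed points. -/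
lemma hom_to_eq_zero (h : IsZero ((D.pull e).obj K)) (hK : D.GE K 0) (hM : compactObjects _ M)
    (h' : ∀ (p : IsDedekindDomain.HeightOneSpectrum (𝓞 F)) (i : pt p ⟶ op U),
      D.LE ((D.pull i).obj M) (-1)) (f : M ⟶ K) : f = 0 :=
  TriangulatedMotives.eq_zero_of_generic e hM hK.1 _ (h.eq_of_tgt _ _)
    fun p i g => hom_eq_zero (h' p i) (A.upper_GE i hK) (by omega) g

/-- If the motives `i^! M` are concentrated in degrees `> 0`, then `M` has no subobjects supported
in closed points. -/
lemma hom_from_eq_zero (h : IsZero ((D.pull e).obj K)) (hK : D.LE K 0) (hM : compactObjects _ M)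
    (h' : ∀ (p : IsDedekindDomain.HeightOneSpectrum (𝓞 F)) (i : pt p ⟶ op U),
      D.GE ((D.upper i).obj M) 1) (f : K ⟶ M) : f = 0 :=
  TriangulatedMotives.eq_zero_of_generic e hK.1 hM _ (h.eq_of_src _ _)
    fun p i g => hom_eq_zero (A.pull_LE i hK) (h' p i) (by omega) g

/-- A morphism of mixed motives that is invertible over the generic point has kernel and
cokernel supported in closed points. -/
lemma exists_factorization (M N : D.MM (op U)) (u : M.obj.obj ⟶ N.obj.obj)
    (_ : IsIso ((D.pull e).map u)) : ∃ (K I C : D.MM (op U)) (k : K ⟶ M) (q : M ⟶ I) (m : I ⟶ N)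
      (c : N ⟶ C) (δ : I.obj.obj ⟶ K.obj.obj⟦(1 : ℤ)⟧) (δ' : C.obj.obj ⟶ I.obj.obj⟦(1 : ℤ)⟧),
      Triangle.mk k.hom.hom q.hom.hom δ ∈ distTriang (D.DM (op U)) ∧
      Triangle.mk m.hom.hom c.hom.hom δ' ∈ distTriang (D.DM (op U)) ∧
      q.hom.hom ≫ m.hom.hom = u ∧ Epi q ∧ Mono m ∧ Epi c ∧ IsZero ((D.pull e).obj K.obj.obj) ∧
      IsZero ((D.pull e).obj C.obj.obj) ∧ IsIso ((D.pull e).map q.hom.hom) ∧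
      IsIso ((D.pull e).map m.hom.hom) := by
  let _ := (D.t (op U)).heartAbelian
  -- `K` is the kernel, `I` the image and `C` the cokernel of `u`
  let f : M ⟶ N := ObjectProperty.homMk (ObjectProperty.homMk u)
  obtain ⟨K, k, δ, hT⟩ := exists_triangle_of_epi (factorThruImage f)
  obtain ⟨C, c, δ', hT'⟩ := exists_triangle_of_mono (image.ι f)
  have hf : (factorThruImage f).hom.hom ≫ (image.ι f).hom.hom = u :=
    congrArg (fun f => f.hom.hom) (image.fac f)
  obtain ⟨ε, h₁⟩ := map_distinguished (D.pull e) hT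
  obtain ⟨ε', h₂⟩ := map_distinguished (D.pull e) hT'
  have hη : ∀ L : D.MM (op U), D.LE ((D.pull e).obj L.obj.obj) (-1) ∧
      D.GE ((D.pull e).obj L.obj.obj) (-1) := fun L =>
    ⟨by simpa using (A.generic_pull e _ _).2 (isMixed_obj L).1,
      by simpa using (A.generic_pull e _ _).1 (isMixed_obj L).2⟩
  have hi : IsIso ((D.pull e).map (factorThruImage f).hom.hom ≫
      (D.pull e).map (image.ι f).hom.hom) := by
    rw [← Functor.map_comp, hf]
    infer_instance
  -- over the generic point, `M ⟶ I ⟶ N` is invertible and `I ⟶ N` is a monomorphism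
  obtain ⟨h₃, h₄⟩ := isIso_of_comp_of_triangle h₂ (hη _).1 (hη _).2
    ((D.pull e).map (factorThruImage f).hom.hom)
  have h₅ : IsIso ((D.pull e).map (factorThruImage f).hom.hom) :=
    IsIso.of_isIso_comp_right _ ((D.pull e).map (image.ι f).hom.hom)
  exact ⟨K, _, C, k, factorThruImage f, image.ι f, c, δ, δ', hT, hT', hf, inferInstance,
    inferInstance, epi_of_triangle _ _ _ hT', (Triangle.isZero₁_iff_isIso₂ _ h₁).2 h₅, h₄, h₅, h₃⟩

end TStructureAxioms

/-! ### Local behaviour of intermediate extensions -/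

namespace MixedMotives
open Sch TStructuresAndWeights TriangulatedMotives
variable {F : Type} [Field F] [NumberField F] {ℓ : ℕ} [Fact ℓ.Prime] {D : MixedMotives.{v, u} F ℓ}

lemma isMixed_open {V U : (specO F).Opens} (j : op V ⟶ op U) {M : D.DM (op U)} (h : D.IsMixed M) :
    D.IsMixed ((D.pull j).obj M) := D.isMixed_of_amplitude (D.tAxioms.open_pull j) h

/-- For a smooth mixed motive `M`, the motive `i^! M ≅ i^* M(-1)[-2]` has cohomology only in degrees
at least `1`. -/
lemma IsSmoothMotive.upper_GE {U : (specO F).Opens} {M : D.DM (op U)} (h : D.IsSmoothMotive M)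
    (hM : D.IsMixed M) {p : IsDedekindDomain.HeightOneSpectrum (𝓞 F)} (i : pt p ⟶ op U) :
    D.GE ((D.upper i).obj M) 1 := by
  obtain ⟨f⟩ := h p i
  have h₁ : D.GE ((D.pull i).obj M) (-1) := (D.tAxioms.closed_pull i M 0).1 hM.2
  have h₂ : D.GE ((D.twist _ (-1)).obj ((D.pull i).obj M)) (-1) := by
    simpa using (D.tAxioms.amplitude_twist D.wAxioms (.pt p) (-1) _ _).1 h₁
  exact (h₂.shift (-2) 1 (by omega)).of_iso f.symm

/-- For a smooth mixed motive `M`, the motive `i^* M ≅ i^! M(1)[2]` has cohomology only in degrees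
at most `-1`. -/
lemma IsSmoothMotive.pull_LE {U : (specO F).Opens} {M : D.DM (op U)} (h : D.IsSmoothMotive M)
    (hM : D.IsMixed M) {p : IsDedekindDomain.HeightOneSpectrum (𝓞 F)} (i : pt p ⟶ op U) :
    D.LE ((D.pull i).obj M) (-1) := by
  obtain ⟨f⟩ := h p i
  have h₁ : D.LE ((D.upper i).obj M) 1 := (D.tAxioms.closed_upper i M 0).2 hM.1
  have h₂ : D.LE ((D.twist _ (-1)).obj ((D.pull i).obj M)) (-1) :=
    LE.of_shift (-2) 1 (h₁.of_iso f) (by omega)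
  have h₃ := (D.tAxioms.amplitude_twist D.wAxioms (.pt p) (-(-1)) _ _).2 h₂
  simpa using h₃.of_iso (D.twistNeg (pt p) (-1) _)

namespace GenericIntermediateExtension
variable {N : D.DM (gen F)} (e : D.GenericIntermediateExtension N)

lemma isMixed : D.IsMixed e.obj := isMixed_obj e.image.F.I

/-- The inclusion `η_{!*} N ⟶ j_* j^* M`. -/
def emb : e.obj ⟶ (D.push e.j).obj ((D.pull e.j).obj e.M) := e.image.F.m.hom.hom

/-- The projection `j_! j^* M ⟶ η_{!*} N`. -/
def proj : (D.shriek e.j).obj ((D.pull e.j).obj e.M) ⟶ e.obj := e.image.F.e.hom.hom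

lemma proj_emb : e.proj ≫ e.emb = (D.forget e.j).app ((D.pull e.j).obj e.M) :=
  congrArg (fun f => f.hom.hom) e.image.F.fac

lemma exists_triangle_emb : ∃ (C : D.MM (top F)) (c : _ ⟶ C.obj.obj) (δ : _),
    Triangle.mk e.emb c δ ∈ distTriang (D.DM (top F)) := by
  obtain ⟨C, c, δ, hT⟩ := exists_triangle_of_mono e.image.F.m
  exact ⟨C, c.hom.hom, δ, hT⟩

lemma exists_triangle_proj : ∃ (K : D.MM (top F)) (k : K.obj.obj ⟶ _) (δ : _),
    Triangle.mk k e.proj δ ∈ distTriang (D.DM (top F)) := by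
  let _ := (D.t (top F)).heartAbelian
  have : Epi e.image.F.e := by
    have h := IsImage.e_isoExt_hom (Image.isImage (D.forgetSupports e.j
      (D.isMixed_of_amplitude (D.tAxioms.open_pull e.j) e.mixed))) e.image.isImage
    rw [← h]
    have : Epi (Image.monoFactorisation (D.forgetSupports e.j
      (D.isMixed_of_amplitude (D.tAxioms.open_pull e.j) e.mixed))).e :=
      inferInstanceAs (Epi (factorThruImage _))
    infer_instance
  obtain ⟨C, c, δ, hT⟩ := exists_triangle_of_epi e.image.F.e
  exact ⟨C, c.hom.hom, δ, hT⟩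

instance : IsIso ((D.pull e.j).map e.emb) := by
  obtain ⟨C, c, δ, hT⟩ := e.exists_triangle_emb
  obtain ⟨ε, h₁⟩ := map_distinguished (D.pull e.j) hT
  have hi : IsIso ((D.pull e.j).map e.proj ≫ (D.pull e.j).map e.emb) := by
    rw [← Functor.map_comp, e.proj_emb]
    exact D.isIso_pull_map_forget e.j _
  exact (isIso_of_comp_of_triangle h₁ (isMixed_open e.j e.isMixed).1
    (isMixed_open e.j (isMixed_obj _)).2 ((D.pull e.j).map e.proj)).1

/-- The restriction of `η_{!*} N` to `U`. -/
def pullIso : (D.pull e.j).obj e.obj ≅ (D.pull e.j).obj e.M :=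
  have := D.open_counit e.j inferInstance
  asIso ((D.pull e.j).map e.emb) ≪≫ (asIso (D.adj e.j).counit).app _

instance : IsIso e.toGeneric := by
  have := D.open_counit e.j inferInstance
  have h : IsIso ((D.pull (gen F).struct).map e.emb) := by
    let w : e.ηU ≫ e.j = (gen F).struct := op_top_hom_ext _ _
    have : IsIso ((D.pull e.j ⋙ D.pull e.ηU).map e.emb) := by
      rw [Functor.comp_map]; infer_instance
    exact (NatIso.isIso_map_iff (D.pullComp w) e.emb).1 this
  have h₁ : e.toGeneric = (D.pull _).map e.emb ≫ (D.pullComp (op_top_hom_ext _ _)).inv.app _ ≫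
      (D.pull e.ηU).map ((D.adj e.j).counit.app _) ≫
      (D.pullComp (op_top_hom_ext (e.ηU ≫ e.j) _)).hom.app _ ≫ e.genericIso.hom := rfl
  rw [h₁]
  infer_instance

section Point
variable {p : IsDedekindDomain.HeightOneSpectrum (𝓞 F)} (i : pt p ⟶ top F)

lemma exists_factor (hp : point p ∈ e.U) : ∃ i' : pt p ⟶ op e.U, i' ≫ e.j = i := by
  obtain ⟨i'⟩ := nonempty_pt_iff.2 hp
  exact ⟨i', op_top_hom_ext _ _⟩

/-- The motives `i^! η_{!*} N` have no cohomology in degrees at most `0`. -/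
lemma upper_GE : D.GE ((D.upper i).obj e.obj) 1 := by
  by_cases hp : point p ∈ e.U
  · obtain ⟨i', w⟩ := e.exists_factor i hp
    refine (e.smooth.upper_GE (isMixed_open e.j e.mixed) i').of_iso ?_
    exact (D.upper i').mapIso (e.pullIso.symm ≪≫ (D.openIso e.j inferInstance).app _) ≪≫
      (D.upperComp w (.of_isImmersion _) (.of_isImmersion _)).app _
  · obtain ⟨C, c, δ, hT⟩ := e.exists_triangle_emb
    obtain ⟨ε, h₁⟩ := map_distinguished (D.upper i) hT
    exact GE.obj₁ h₁ (GE.of_isZero (isZero_upper_push_pt i e.j hp _))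
      (D.tAxioms.upper_GE i (isMixed_obj C).2)

/-- The motives `i^* η_{!*} N` have no cohomology in degrees at least `0`. -/
lemma pull_LE : D.LE ((D.pull i).obj e.obj) (-1) := by
  by_cases hp : point p ∈ e.U
  · obtain ⟨i', w⟩ := e.exists_factor i hp
    refine (e.smooth.pull_LE (isMixed_open e.j e.mixed) i').of_iso ?_
    exact (D.pull i').mapIso e.pullIso.symm ≪≫ (D.pullComp w).app _
  · obtain ⟨C, c, δ, hT⟩ := e.exists_triangle_proj
    obtain ⟨ε, h₁⟩ := map_distinguished (D.pull i) hT
    exact LE.obj₃ h₁ (D.tAxioms.pull_LE i (isMixed_obj C).1)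
      (LE.of_isZero (isZero_pull_shriek_pt i e.j hp _))

end Point

end GenericIntermediateExtension
end MixedMotives

/-! ### Motivic cohomology and morphisms invertible over the generic point -/

namespace InverseImages
variable {F : Type} [Field F] [NumberField F] {D : InverseImages.{v, u} F} {X Y : Sch F}
  (f : X ⟶ Y) {M M' : D.DM Y} {N : D.DM X} (φ : (D.pull f).obj M ⟶ N) (k : ℤ)
open Functor.LaxMonoidal Functor.OplaxMonoidal

lemma pullH_apply (x : D.H M k) : D.pullH f φ k x =
    ε (D.pull f) ≫ (D.pull f).map x ≫ ((D.pull f).commShiftIso k).hom.app M ≫ φ⟦k⟧' :=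
  rfl

lemma pullH_comp (g : M' ⟶ M) (x : D.H M' k) :
    D.pullH f φ k (x ≫ g⟦k⟧') = D.pullH f ((D.pull f).map g ≫ φ) k x := by
  simp only [pullH_apply, Functor.map_comp, Category.assoc]
  have h := ((D.pull f).commShiftIso k).hom.naturality g
  dsimp at h
  rw [reassoc_of% h]

lemma pullH_comp_right {N' : D.DM X} (g : N ⟶ N') (x : D.H M k) :
    D.pullH f (φ ≫ g) k x = D.pullH f φ k x ≫ g⟦k⟧' := by
  simp only [pullH_apply, Functor.map_comp, Category.assoc]

lemma map_eq_zero_of_pullH [IsIso φ] {x : D.H M k} (h : D.pullH f φ k x = 0) :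
    (D.pull f).map x = 0 := by
  rw [pullH_apply, ← cancel_epi (Functor.Monoidal.εIso (D.pull f)).inv] at h
  rw [← cancel_mono (((D.pull f).commShiftIso k).hom.app M ≫ φ⟦k⟧'), zero_comp]
  simpa using h

lemma pullH_surjective [IsIso φ]
    (h : ∀ α : (D.pull f).obj (𝟙_ _) ⟶ (D.pull f).obj (M⟦k⟧), ∃ x, (D.pull f).map x = α) :
    Function.Surjective (D.pullH f φ k) := fun y => by
  obtain ⟨x, hx⟩ := h ((Functor.Monoidal.εIso (D.pull f)).inv ≫ y ≫
    inv (((D.pull f).commShiftIso k).hom.app M ≫ φ⟦k⟧'))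
  refine ⟨x, ?_⟩
  rw [pullH_apply, hx]
  simp

end InverseImages

namespace TStructuresAndWeights
open Sch ZeroObject
variable {F : Type} [Field F] [NumberField F] {D : TStructuresAndWeights.{v, u} F} {S : Sch F}

/-- The lowest step of the truncation of a motive in degrees at least `0` is its cohomology in
degree `0`. -/
lemma isCohomology_of_GE {A B X : D.DM S} {f : A ⟶ X} {g : X ⟶ B} {h : B ⟶ A⟦(1 : ℤ)⟧}
    (hT : Triangle.mk f g h ∈ distTriang (D.DM S)) (hA : D.IsMixed A) (hB : D.GE B 1) :
    D.IsCohomology X 0 A := by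
  obtain ⟨δ, hT'⟩ := distinguished_of_iso (contractible_distinguished₁ A) (Iso.refl 0)
    (Iso.refl A) ((shiftFunctorZero (D.DM S) ℤ).symm.app A) 0
    ((shiftFunctorZero (D.DM S) ℤ).inv.app A) (by simp) (by simp)
  exact ⟨hA, A, B, 0, f, g, h, 0, _, δ, hT, hT', hB, LE.of_isZero (isZero_zero _)⟩

/-- Morphisms from a mixed motive to a motive in degrees at least `0` factor through the cohomology
of the latter in degree `0`. -/
lemma hom_eq_zero_of_GE (W : WeightAxioms D) (hS : IsArithmeticBase S) {M X : D.DM S}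
    {P : ℤ → Prop} (hM : D.IsMixed M) (hX : D.GE X 0) (hw : D.Weights X P)
    (h : ∀ K, D.IsMixed K → D.Weights K P → ∀ f : M ⟶ K, f = 0) (f : M ⟶ X) : f = 0 := by
  obtain ⟨A, B, a, b, δ, hT, hA, hB⟩ := exists_truncation D hX.1 0
  have hA' : D.IsMixed A := ⟨hA, GE.obj₁ hT hX (hB.anti (by omega))⟩
  obtain ⟨ψ, rfl⟩ := exists_lift₂ hT f (hom_eq_zero hM.1 hB (by omega) _)
  rw [h A hA' ?_ ψ, zero_comp]
  rw [weights_iff] at hw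
  refine (W.weights_isMixed_iff hS hA').2 fun w hw' => ?_
  simpa using hw.2 0 hA'.toMM (isCohomology_of_GE hT hA' hB) w hw'

/-- Motives with nonnegative cohomology and positive weights have no cohomology in degree `0`. -/
lemma eq_zero_of_GE_of_weights (A : TStructureAxioms D) (W : WeightAxioms D)
    {p : IsDedekindDomain.HeightOneSpectrum (𝓞 F)} {X : D.DM (pt p)} (hX : D.GE X 0)
    (hw : D.Weights X (1 ≤ ·)) (f : 𝟙_ (D.DM (pt p)) ⟶ X) : f = 0 :=
  hom_eq_zero_of_GE W (.pt p) (A.unit_pt p) hX hw (fun _ hK hw f =>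
    W.mixed_hom_eq_zero_of_lt (.pt p) (A.unit_pt p) hK (a := 0)
      ((W.unit (.pt p)).imp fun w hw => (by omega : w ≤ 0)) hw (by omega) f) f

end TStructuresAndWeights

namespace TStructureAxioms
open Sch TStructuresAndWeights TriangulatedMotives
variable {F : Type} [Field F] [NumberField F] {D : TStructuresAndWeights.{v, u} F}
  (A : TStructureAxioms D) {U : (specO F).Opens}
include A

/-- A morphism from a mixed motive without subobjects supported in closed points which is
invertible over the generic point is a monomorphism. -/
lemma exists_triangle_of_generic (e : gen F ⟶ op U) (M N : D.MM (op U)) (u : M.obj.obj ⟶ N.obj.obj)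
    (_ : IsIso ((D.pull e).map u))
    (hM : ∀ (p : IsDedekindDomain.HeightOneSpectrum (𝓞 F)) (i : pt p ⟶ op U),
      D.GE ((D.upper i).obj M.obj.obj) 1) :
    ∃ (C : D.MM (op U)) (c : N ⟶ C) (δ : C.obj.obj ⟶ M.obj.obj⟦(1 : ℤ)⟧),
      Triangle.mk u c.hom.hom δ ∈ distTriang (D.DM (op U)) ∧ Epi c ∧
      IsZero ((D.pull e).obj C.obj.obj) ∧
      Mono (ObjectProperty.homMk (ObjectProperty.homMk u) : M ⟶ N) := by
  let _ := (D.t (op U)).heartAbelian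
  obtain ⟨K, I, C, k, q, m, c, δ, δ', hT, hT', hu, hq, hm, hc, hK, hC, -, -⟩ :=
    A.exists_factorization e M N u inferInstance
  have hk : k.hom.hom = 0 :=
    A.hom_from_eq_zero e hK (isMixed_obj K).1 (isMixed_obj M).1.1 hM k.hom.hom
  have : Mono q := Preadditive.mono_of_cancel_zero _ fun {L} g hg => by
    obtain ⟨ψ, hψ⟩ := exists_lift₂ hT g.hom.hom (congrArg (fun f => f.hom.hom) hg)
    rw [hk, comp_zero] at hψ
    exact ObjectProperty.hom_ext _ (ObjectProperty.hom_ext _ hψ)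
  have : IsIso q := isIso_of_mono_of_epi q
  have h : (ObjectProperty.homMk (ObjectProperty.homMk u) : M ⟶ N) = q ≫ m :=
    ObjectProperty.hom_ext _ (ObjectProperty.hom_ext _ hu.symm)
  let q' : M.obj.obj ≅ I.obj.obj := (compactObjects _).ι.mapIso ((D.t _).heart.ι.mapIso (asIso q))
  have hq' : q'.inv ≫ q.hom.hom = 𝟙 _ := q'.inv_hom_id
  obtain ⟨ε, h₁⟩ := distinguished_of_iso hT' q'.symm (Iso.refl _) (Iso.refl _) u c.hom.hom
    (by
      rw [← hu]
      exact (Category.comp_id _).trans ((Category.id_comp _).symm.trans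
        ((congrArg (· ≫ m.hom.hom) hq'.symm).trans (Category.assoc _ _ _))))
    ((Category.comp_id _).trans (Category.id_comp _).symm)
  refine ⟨C, c, ε, h₁, hc, hC, ?_⟩
  rw [h]
  infer_instance

omit A in
/-- The unit `Q ⟶ j_* j^* Q` is invertible over `V`. -/
lemma isIso_pull_unit {V : (specO F).Opens} (j : op V ⟶ op U) (Q : D.DM (op U)) :
    IsIso ((D.pull j).map ((D.adj j).unit.app Q)) := by
  have := D.open_counit j inferInstance
  have h₀ := (D.adj j).left_triangle_components Q
  have : IsIso ((D.pull j).map ((D.adj j).unit.app Q) ≫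
      (D.adj j).counit.app ((D.pull j).obj Q)) := by
    rw [h₀]; exact IsIso.id _
  exact IsIso.of_isIso_comp_right _ ((D.adj j).counit.app ((D.pull j).obj Q))

omit A in
/-- The unit `Q ⟶ j_* j^* Q` is invertible over the generic point. -/
lemma isIso_generic_unit (e : gen F ⟶ op U) {V : (specO F).Opens} (j : op V ⟶ op U)
    (hV : genPoint F ∈ V) (Q : D.DM (op U)) :
    IsIso ((D.pull e).map ((D.adj j).unit.app Q)) := by
  obtain ⟨e'⟩ := exists_gen (U := V) fun h => by rw [h] at hV; exact hV
  have w : e' ≫ j = e := op_hom_ext _ _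
  have := isIso_pull_unit j Q
  refine (NatIso.isIso_map_iff (D.pullComp w) _).1 ?_
  rw [Functor.comp_map]
  infer_instance

omit A in
/-- Two motives that are isomorphic over the generic point can be compared over an open
subscheme. -/
lemma exists_hom_push (e : gen F ⟶ op U) {E Q : D.DM (op U)}
    (hE : compactObjects _ E) (hQ : compactObjects _ Q) (α : (D.pull e).obj E ≅ (D.pull e).obj Q) :
    ∃ (V : (specO F).Opens) (j : op V ⟶ op U) (u : E ⟶ (D.push j).obj ((D.pull j).obj Q)),
      IsIso ((D.pull e).map ((D.adj j).unit.app Q)) ∧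
      (D.pull e).map u = α.hom ≫ (D.pull e).map ((D.adj j).unit.app Q) := by
  -- `V` is the complement of the finitely many points that obstruct the extension of `α`, and `u`
  -- is adjoint to the extension of `α` over `V`
  obtain ⟨T, hT⟩ := exists_spread e hE hQ α.hom
  obtain ⟨j⟩ := exists_op (inf_le_left : U ⊓ compl T ≤ U)
  have hV : genPoint F ∈ U ⊓ compl T := ⟨genPoint_mem_of_hom e, genPoint_mem_compl _⟩
  obtain ⟨e'⟩ := exists_gen (U := U ⊓ compl T) fun h => by rw [h] at hV; exact hV
  have w : e' ≫ j = e := op_hom_ext _ _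
  obtain ⟨f, hf⟩ := hT _ j e' w inf_le_right
  let c := D.pullComp w
  let u := (D.adj j).homEquiv _ _ f
  have := D.open_counit j inferInstance
  have hu : (D.pull j).map u ≫ (D.adj j).counit.app _ = f :=
    ((D.adj j).homEquiv_counit _ _ u).symm.trans (Equiv.symm_apply_apply _ _)
  have h₀ := (D.adj j).left_triangle_components Q
  have h₁ : (D.pull j).map u = f ≫ (D.pull j).map ((D.adj j).unit.app Q) := by
    rw [← cancel_mono ((D.adj j).counit.app ((D.pull j).obj Q)), hu, Category.assoc, h₀]
    exact (Category.comp_id _).symm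
  have n₁ := c.hom.naturality u
  have n₂ := c.hom.naturality ((D.adj j).unit.app Q)
  refine ⟨_, j, u, isIso_generic_unit e j hV Q, ?_⟩
  rw [← cancel_epi (c.hom.app E), ← n₁, ← reassoc_of% hf, Functor.comp_map, h₁, Functor.map_comp,
    Category.assoc]
  exact congrArg ((D.pull e').map f ≫ ·) n₂

end TStructureAxioms

/-! ### Restriction of classes of intermediate extensions -/

namespace TStructureAxioms
open Sch TStructuresAndWeights TriangulatedMotives
variable {F : Type} [Field F] [NumberField F] {D : TStructuresAndWeights.{v, u} F}
  (A : TStructureAxioms D) (W : WeightAxioms D) {U : (specO F).Opens} (e : gen F ⟶ op U)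
  {M N : D.DM (op U)} (hM : D.IsMixed M) (hN : D.IsMixed N) (u : M ⟶ N)
include A W hM hN

/-- The image of a morphism of mixed motives that is invertible over the generic point. The kernel
and the cokernel are supported in closed points, and weights are bounded above on quotients and
below on subobjects. -/
lemma exists_image (hu : IsIso ((D.pull e).map u)) :
    ∃ (K I C : D.DM (op U)) (k : K ⟶ M) (q : M ⟶ I) (m : I ⟶ N) (c : N ⟶ C) (δ : I ⟶ K⟦(1 : ℤ)⟧)
      (δ' : C ⟶ I⟦(1 : ℤ)⟧), D.IsMixed K ∧ D.IsMixed I ∧ D.IsMixed C ∧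
      Triangle.mk k q δ ∈ distTriang (D.DM (op U)) ∧
      Triangle.mk m c δ' ∈ distTriang (D.DM (op U)) ∧ q ≫ m = u ∧
      IsZero ((D.pull e).obj K) ∧ IsZero ((D.pull e).obj C) ∧
      IsIso ((D.pull e).map q) ∧ IsIso ((D.pull e).map m) ∧
      (∀ a : ℤ, D.Weights M (· ≤ a) → D.Weights I (· ≤ a)) ∧
      ∀ a : ℤ, D.Weights M (a ≤ ·) → D.Weights K (a ≤ ·) := by
  obtain ⟨K, I, C, k, q, m, c, δ, δ', hT, hT', hu, hq, -, -, hK, hC, hiq, him⟩ :=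
    A.exists_factorization e hM.toMM hN.toMM u hu
  refine ⟨_, _, _, _, _, _, _, δ, δ', isMixed_obj K, isMixed_obj I, isMixed_obj C, hT, hT', hu, hK,
    hC, hiq, him, fun a h => (W.weightLE_toMM_iff (.op _) (isMixed_obj I)).1
      (W.weightLE_of_epi (.op _) q ((W.weightLE_toMM_iff (.op _) hM).2 h)), fun a h => ?_⟩
  have := mono_of_triangle k q δ hT
  exact (W.weightGE_toMM_iff (.op _) (isMixed_obj K)).1
    (W.weightGE_of_mono (.op _) k ((W.weightGE_toMM_iff (.op _) hM).2 h))

/-- The cokernel of a morphism of mixed motives that is invertible over the generic point and whose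
source has no subobjects supported in closed points. The morphism is a monomorphism, so that lower
bounds for the weights pass from the target to the source. -/
lemma exists_cokernel (hu : IsIso ((D.pull e).map u))
    (hM' : ∀ (p : IsDedekindDomain.HeightOneSpectrum (𝓞 F)) (i : pt p ⟶ op U),
      D.GE ((D.upper i).obj M) 1) :
    ∃ (C : D.DM (op U)) (c : N ⟶ C) (δ : C ⟶ M⟦(1 : ℤ)⟧), D.IsMixed C ∧
      Triangle.mk u c δ ∈ distTriang (D.DM (op U)) ∧ IsZero ((D.pull e).obj C) ∧
      (∀ a : ℤ, D.Weights N (· ≤ a) → D.Weights C (· ≤ a)) ∧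
      ∀ a : ℤ, D.Weights N (a ≤ ·) → D.Weights M (a ≤ ·) := by
  obtain ⟨C, c, δ, hT, hc, hC, hm⟩ := A.exists_triangle_of_generic e hM.toMM hN.toMM u hu hM'
  exact ⟨_, _, δ, isMixed_obj C, hT, hC,
    fun a h => (W.weightLE_toMM_iff (.op _) (isMixed_obj C)).1
      (W.weightLE_of_epi (.op _) c ((W.weightLE_toMM_iff (.op _) hN).2 h)),
    fun a h => (W.weightGE_toMM_iff (.op _) hM).1
      (W.weightGE_of_mono (.op _) (M := hM.toMM) (N := hN.toMM)
        (ObjectProperty.homMk (ObjectProperty.homMk u)) ((W.weightGE_toMM_iff (.op _) hN).2 h))⟩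

end TStructureAxioms

namespace MixedMotives.GenericIntermediateExtension
open Sch TStructuresAndWeights TriangulatedMotives TStructureAxioms InverseImages
variable {F : Type} [Field F] [NumberField F] {ℓ : ℕ} [Fact ℓ.Prime] {D : MixedMotives.{v, u} F ℓ}
  {N : D.DM (gen F)} (e : D.GenericIntermediateExtension N)

lemma upper_shift_GE {p : IsDedekindDomain.HeightOneSpectrum (𝓞 F)} (i : pt p ⟶ top F) (k : ℤ) :
    D.GE ((D.upper i).obj (e.obj⟦k⟧)) (1 - k) :=
  ((e.upper_GE i).shift k (1 - k) (by omega)).of_iso (((D.upper i).commShiftIso k).symm.app _)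

/-- A class that vanishes over the generic point comes from the groups `H^k(i^! η_{!*} N)`, which
vanish for `k ≤ 0`. -/
lemma restrict_injective {k : ℤ} (hk : k ≤ 0) : Function.Injective (e.restrict k) := by
  rw [injective_iff_map_eq_zero]
  intro x hx
  exact eq_zero_of_generic (gen F).struct (D.unit_compact _)
    ((compactObjects (D.DM (top F))).le_shift k _ e.isMixed.1.1) x (map_eq_zero_of_pullH _ _ k hx)
    fun p i g => eq_zero_of_forall_pt i (fun f =>
      hom_eq_zero (D.tAxioms.unit_pt p).1 (e.upper_shift_GE i k) (by omega) f) g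

/-- The obstructions to extending a class of degree `-1` from the generic fibre lie in the groups
`H^0(i^! η_{!*} N)`, which vanish. -/
lemma restrict_bijective : Function.Bijective (e.restrict (-1)) := by
  refine ⟨e.restrict_injective (by omega), pullH_surjective _ _ _ fun α => ?_⟩
  exact exists_extension_of_generic (gen F).struct (D.unit_compact _)
    ((compactObjects (D.DM (top F))).le_shift (-1) _ e.isMixed.1.1) α
    fun p i g => eq_zero_of_forall_pt i (fun f =>
      hom_eq_zero (D.tAxioms.unit_pt p).1
        ((e.upper_shift_GE i (-1)).shift 1 1 (by omega)) (by omega) f) g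

variable {Q : D.DM (top F)} (hQ : D.IsMixed Q) (γ : (D.pull (gen F).struct).obj Q ≅ N)
include hQ γ

/-- If `N` extends to a mixed motive of weights `≥ 0`, then `η_{!*} N` has weights `≥ 0`. -/
lemma weights_nonneg (hw : D.Weights Q (0 ≤ ·)) : D.Weights e.obj (0 ≤ ·) := by
  obtain ⟨V, j, u, h₁, h₂⟩ := exists_hom_push (gen F).struct e.isMixed.1.1 hQ.1.1
    (asIso e.toGeneric ≪≫ γ.symm)
  have hG : D.IsMixed ((D.push j).obj ((D.pull j).obj Q)) :=
    D.isMixed_of_amplitude (D.tAxioms.open_push j) (isMixed_open j hQ)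
  have hi : IsIso ((D.pull (gen F).struct).map u) := by rw [h₂]; infer_instance
  obtain ⟨-, -, -, -, -, -, -, h⟩ := D.tAxioms.exists_cokernel D.wAxioms (gen F).struct
    e.isMixed hG u hi fun _ i => e.upper_GE i
  exact h 0 (D.wAxioms.open_push j _ ((D.wAxioms.open_pull j).2 _ hw))

/-- If `N` extends to a mixed motive of weights `≥ 0`, then every class in degree `0` extends. -/
lemma restrict_surjective (hw : D.Weights Q (0 ≤ ·)) : Function.Surjective (e.restrict 0) := by
  refine pullH_surjective _ _ _ fun α => ?_
  refine exists_extension_of_generic (gen F).struct (D.unit_compact _)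
    ((compactObjects (D.DM (top F))).le_shift 0 _ e.isMixed.1.1) α
    fun p i g => eq_zero_of_forall_pt i (fun f => ?_) g
  have h₁ : D.Weights (e.obj⟦(0 : ℤ)⟧) (0 ≤ ·) :=
    (e.weights_nonneg hQ γ hw).of_iso ((shiftFunctorZero (D.DM (top F)) ℤ).symm.app _)
  exact eq_zero_of_GE_of_weights D.tAxioms D.wAxioms
    ((e.upper_shift_GE i 0).shift 1 0 (by omega))
    ((D.wAxioms.closed_upper i _ h₁).shift 1 fun w hw => by omega) f

/-- If `N` extends to a mixed motive `Q` of weights `< 0`, then `η_{!*} N` and `Q` have the same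
classes over the generic point, because they differ only by motives of weights `< 0` supported in
closed points. -/
lemma range_restrict (hw : D.Weights Q (· ≤ -1)) :
    LinearMap.range (e.restrict 0) = LinearMap.range (D.pullH (gen F).struct γ.hom 0) := by
  obtain ⟨V, j, u, h₁, h₂⟩ := exists_hom_push (gen F).struct e.isMixed.1.1 hQ.1.1
    (asIso e.toGeneric ≪≫ γ.symm)
  have W := D.wAxioms
  have hG : D.IsMixed ((D.push j).obj ((D.pull j).obj Q)) :=
    D.isMixed_of_amplitude (D.tAxioms.open_push j) (isMixed_open j hQ)
  -- `I` is the image of `Q ⟶ j_* j^* Q`; as a quotient of `Q` it has weights `< 0`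
  obtain ⟨K, I, C, k, q, m, c, δ, δ', mK, mI, mC, hT, hT', hu, hK, hC, hiq, him, hwI, -⟩ :=
    D.tAxioms.exists_image W (gen F).struct hQ hG ((D.adj j).unit.app Q) h₁
  -- `u` factors through `I`, because the cokernel of `I ⟶ j_* j^* Q` is supported in closed points
  obtain ⟨v, rfl⟩ := exists_lift₂ hT' u
    (D.tAxioms.hom_to_eq_zero (gen F).struct hC mC.2 e.isMixed.1.1 (fun _ i => e.pull_LE i) _)
  have hv : (D.pull (gen F).struct).map v =
      (asIso e.toGeneric ≪≫ γ.symm).hom ≫ (D.pull (gen F).struct).map q := by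
    rw [← cancel_mono ((D.pull (gen F).struct).map m), ← Functor.map_comp, h₂, Category.assoc,
      ← Functor.map_comp, hu]
  have hiv : IsIso ((D.pull (gen F).struct).map v) := by rw [hv]; infer_instance
  -- the cokernel `C'` of `η_{!*} N ⟶ I` is supported in closed points and has weights `< 0`
  obtain ⟨C', c', ε, mC', hT₂, hC', hwC, -⟩ := D.tAxioms.exists_cokernel W (gen F).struct
    e.isMixed mI v hiv fun _ i => e.upper_GE i
  let γ' : (D.pull (gen F).struct).obj I ⟶ N :=
    inv ((D.pull (gen F).struct).map q) ≫ γ.hom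
  have hvγ : (D.pull (gen F).struct).map v ≫ γ' = e.toGeneric := by
    rw [hv]
    simp [γ']
  have hqγ : (D.pull (gen F).struct).map q ≫ γ' = γ.hom := by simp [γ']
  obtain ⟨δ₀, hT₀⟩ := shift_distinguished hT 0
  obtain ⟨ε₀, hT₃⟩ := shift_distinguished hT₂ 0
  apply le_antisymm
  -- a class of `η_{!*} N` maps to `I` and lifts to `Q`, since the kernel `K` of `Q ⟶ I` has no
  -- `H^1`
  · rintro _ ⟨x, rfl⟩
    have hz : IsZero ((D.pull (gen F).struct).obj (K⟦(0 : ℤ)⟧)) :=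
      hK.of_iso ((D.pull (gen F).struct).mapIso
        ((shiftFunctorZero (D.DM (top F)) ℤ).app K))
    have hK' : D.IsMixed (K⟦(0 : ℤ)⟧) :=
      mK.of_iso ((shiftFunctorZero (D.DM (top F)) ℤ).symm.app K)
    obtain ⟨y, hy⟩ := exists_lift₃ hT₀ (x ≫ v⟦(0 : ℤ)⟧')
      (D.tAxioms.H_eq_zero_of_generic_isZero _ hz hK' one_ne_zero _)
    refine ⟨y, ?_⟩
    rw [← hqγ, ← pullH_comp, ← hy, pullH_comp, hvγ]
    rfl
  -- a class of `Q` maps to `I` and lifts to `η_{!*} N`, since `C'` has no `H^0`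
  · rintro _ ⟨y, rfl⟩
    obtain ⟨x, hx⟩ := exists_lift₂ hT₃ (y ≫ q⟦(0 : ℤ)⟧')
      (D.tAxioms.H_eq_zero_of_weights _ W hC' mC' (hwC _ (hwI _ hw)) _)
    refine ⟨x, ?_⟩
    rw [← hqγ, ← pullH_comp, hx, pullH_comp, hvγ]
    rfl

end MixedMotives.GenericIntermediateExtension

/-! ### Weights of the motive of a projective scheme -/

namespace InverseImages
variable {F : Type} [Field F] [NumberField F] {D : InverseImages.{v, u} F} {X Y : Sch F}
open Functor.LaxMonoidal Functor.OplaxMonoidal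

lemma pullH_zero (f : X ⟶ Y) {M : D.DM Y} {N : D.DM X} (φ : (D.pull f).obj M ⟶ N)
    (x : 𝟙_ (D.DM Y) ⟶ M) :
    D.pullH f φ 0 (x ≫ (shiftFunctorZero (D.DM Y) ℤ).inv.app M) =
      ε (D.pull f) ≫ (D.pull f).map x ≫ φ ≫ (shiftFunctorZero (D.DM X) ℤ).inv.app N := by
  have h := (shiftFunctorZero (D.DM X) ℤ).inv.naturality φ
  dsimp at h
  rw [pullH_apply, h, Functor.commShiftIso_zero, Functor.CommShift.isoZero_hom_app]
  simp [← Functor.map_comp_assoc]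

end InverseImages

namespace TStructuresAndWeights
open Sch
variable {F : Type} [Field F] [NumberField F] {D : TStructuresAndWeights.{v, u} F} {S : Sch F}

/-- Morphisms to `X` lift to a truncation, if there are no morphisms to the next cohomology. -/
lemma exists_lift_truncation {A B X M K : D.DM S} {m : ℤ} {f : A ⟶ X} {g : X ⟶ B}
    {h : B ⟶ A⟦(1 : ℤ)⟧} (hT : Triangle.mk f g h ∈ distTriang (D.DM S)) (hB : D.GE B (m + 1))
    (hK : D.IsCohomology X (m + 1) K) (hM : D.LE M (m + 1))
    (h₀ : ∀ x : M ⟶ K⟦-(m + 1)⟧, x = 0) (x : M ⟶ X) : ∃ x' : M ⟶ A, x = x' ≫ f := by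
  obtain ⟨-, A', B', C, i, q, δ, j, p, δ', hT₁, hT₂, hB', hC⟩ := hK
  obtain ⟨x₁, rfl⟩ := exists_lift₂ hT₁ x (hom_eq_zero hM hB' (by omega) _)
  obtain ⟨x₂, rfl⟩ := exists_lift₂ hT₂ x₁ (h₀ _)
  obtain ⟨l, hl⟩ := exists_lift₂ hT (j ≫ i) (hom_eq_zero hC hB (by omega) _)
  exact ⟨x₂ ≫ l, by simp [hl]⟩

end TStructuresAndWeights

namespace WeightAxioms
open Sch TStructuresAndWeights
variable {F : Type} [Field F] [NumberField F] {D : TStructuresAndWeights.{v, u} F}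
  (A : TStructureAxioms D) (W : WeightAxioms D) {S X : Sch F} (hS : IsArithmeticBase S)
include A W hS

/-- The unit object, shifted to the heart. -/
lemma exists_unit_shift : ∃ k : ℤ, D.IsMixed ((𝟙_ (D.DM S))⟦k⟧) ∧
    D.Weights ((𝟙_ (D.DM S))⟦k⟧) (· = k) := by
  have key : ∀ k : ℤ, D.Weights ((𝟙_ (D.DM S))⟦k⟧) (· = k) := fun k =>
    (W.unit hS).shift k fun w hw => by omega
  cases hS with
  | gen => exact ⟨0, A.unit_gen.of_iso ((shiftFunctorZero (D.DM _) ℤ).symm.app _), key 0⟩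
  | op U => exact ⟨1, A.unit_op U, key 1⟩
  | pt p => exact ⟨0, (A.unit_pt p).of_iso ((shiftFunctorZero (D.DM _) ℤ).symm.app _), key 0⟩

omit A in
/-- Twisting by `(n)` lowers weights by `2n`, also for motives that are mixed up to a shift. -/
lemma weights_twist {M : D.DM S} {k w : ℤ} (hM : D.IsMixed (M⟦k⟧))
    (hw : D.Weights M (· = w)) (n : ℤ) : D.IsMixed (((D.twist S n).obj M)⟦k⟧) ∧
      D.Weights ((D.twist S n).obj M) (· = w - 2 * n) := by
  obtain ⟨h₁, h₂⟩ := W.twist hS _ hM (w + k) n (hw.shift k fun w hw => by omega)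
  have e := ((D.twist S n).commShiftIso k).app M
  refine ⟨h₁.of_iso e, (((h₂.of_iso e).shift (Q := (· = w - 2 * n)) (-k)
    fun w hw => by omega)).of_iso ((shiftEquiv (D.DM S) k).unitIso.app _).symm⟩

/-- The motive `M(X)(n)` of a projective scheme `X` has weights at most `-2n`. -/
lemma weights_mot_le (f : X ⟶ S) (hf : IsProjectiveHom (mor f)) (n : ℤ) :
    D.Weights ((D.twist S n).obj (D.mot f)) (· ≤ -2 * n) := by
  obtain ⟨k, hk, -⟩ := W.exists_unit_shift A hS
  have h := (W.weights_twist hS hk (W.unit hS) n).2.imp (Q := (· ≤ -2 * n)) fun w hw => by omega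
  refine ((W.shriek_pull hS f hf.quasiProjective).le h).of_iso ?_
  exact (D.shriek f).mapIso (D.pullTwist f n _) ≪≫ (D.shriekIsoPush f hf).app _ ≪≫
    (D.pushTwist f n _).symm

end WeightAxioms

namespace TStructureAxioms
open Sch TStructuresAndWeights TriangulatedMotives
variable {F : Type} [Field F] [NumberField F] {D : TStructuresAndWeights.{v, u} F}
  (A : TStructureAxioms D)
include A

lemma generic_LE {U : (specO F).Opens} (e : gen F ⟶ op U) {M : D.DM (op U)} {n m : ℤ}
    (h : D.LE M n) (hm : m + 1 = n) : D.LE ((D.pull e).obj M) m := by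
  obtain rfl : m = n + -1 := by omega
  exact (A.generic_pull e M n).2 h

lemma generic_GE {U : (specO F).Opens} (e : gen F ⟶ op U) {M : D.DM (op U)} {n m : ℤ}
    (h : D.GE M n) (hm : m + 1 = n) : D.GE ((D.pull e).obj M) m := by
  obtain rfl : m = n + -1 := by omega
  exact (A.generic_pull e M n).1 h

/-- There are no morphisms from the unit over `Spec 𝓞 F` to motives in degrees at most `-2`: by
cohomological dimension, there are none over the generic point, nor at the closed points. -/
lemma eq_zero_top {X : D.DM (top F)} (hX : D.LE X (-2)) (f : 𝟙_ (D.DM (top F)) ⟶ X) : f = 0 := by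
  refine eq_zero_of_generic (gen F).struct (D.unit_compact _) hX.1 f ?_ fun p i g =>
    eq_zero_of_forall_pt i (A.eq_zero_pt ((A.closed_upper i _ _).2 hX)) g
  rw [← cancel_epi (Functor.Monoidal.εIso (D.pull (gen F).struct)).hom,
    A.eq_zero_gen ((A.generic_LE (m := -3) _ hX (by omega)).mono (by omega)) (_ ≫ _), comp_zero]

end TStructureAxioms

/-! ### The edge map and the truncation map -/

namespace MixedMotives
open Sch TStructuresAndWeights TriangulatedMotives TStructureAxioms InverseImages
variable {F : Type} [Field F] [NumberField F] {ℓ : ℕ} [Fact ℓ.Prime] (D : MixedMotives.{v, u} F ℓ)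
  {Y : Sch F} (y : Y ⟶ gen F) [LocallyOfFiniteType (mor y)] (i n : ℤ)

/-- `τ_{≤ i-1} M(Y)(n)`. -/
abbrev trunc : D.DM (gen F) := (((D.t _).truncLE (i - 1)).obj (D.gm y n)).obj

/-- `h^{i-1}(Y, n)[1]`. -/
abbrev hShift : D.DM (gen F) := (D.h y (i - 1) n).obj.obj⟦(1 : ℤ)⟧

/-- The inclusion `τ_{≤ i-1} M(Y)(n) ⟶ M(Y)(n)`. -/
abbrev truncι : D.trunc y i n ⟶ (D.gm y n).obj := (((D.t _).truncLEι (i - 1)).app (D.gm y n)).hom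

/-- The projection of `(τ_{≤ i-1} M(Y)(n))[i]` to its lowest cohomology `h^{i-1}(Y, n)[1]`. -/
def edge : (D.trunc y i n)⟦i⟧ ⟶ D.hShift y i n :=
  (((D.t _).truncGEπ (i - 1)).app (((D.t _).truncLE (i - 1)).obj (D.gm y n))).hom⟦i⟧' ≫
    (shiftFunctorAdd' (D.DM (gen F)) (i - 1) 1 i (by omega)).hom.app _ ≫
    (((compactObjects (D.DM (gen F))).ι.commShiftIso (i - 1)).inv.app _)⟦(1 : ℤ)⟧'

lemma edgeMap_apply (w : D.H (D.trunc y i n) i) :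
    D.edgeMap y i n w = w ≫ D.edge y i n ≫ (shiftFunctorZero (D.DM (gen F)) ℤ).inv.app _ := by
  change w ≫ _ ≫ _ ≫ _ ≫ _ = w ≫ (_ ≫ _ ≫ _) ≫ _
  simp only [Category.assoc]
  rfl

lemma truncMap_apply (w : D.H (D.trunc y i n) i) :
    D.truncMap y i n w = w ≫ (D.truncι y i n)⟦i⟧' := rfl

lemma trunc_LE : D.LE (D.trunc y i n) (i - 1) :=
  ⟨(((D.t _).truncLE (i - 1)).obj (D.gm y n)).property,
    inferInstanceAs ((D.t _).IsLE (((D.t _).truncLE (i - 1)).obj (D.gm y n)) (i - 1))⟩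

lemma hShift_GE : D.GE (D.hShift y i n) (-1) :=
  (isMixed_obj (D.h y (i - 1) n)).2.shift 1 _ (by omega)

lemma exists_triangle_trunc : ∃ (B : D.DM (gen F)) (q : (D.gm y n).obj ⟶ B) (δ : _),
    Triangle.mk (D.truncι y i n) q δ ∈ distTriang (D.DM (gen F)) ∧ D.GE B i := by
  obtain ⟨δ, hT⟩ := triangle_ι _ ((D.t (gen F)).triangleLEGE_distinguished (i - 1) i (by omega)
    (D.gm y n))
  exact ⟨_, _, δ, hT, ⟨((D.t _).truncGE i).obj (D.gm y n) |>.property,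
    inferInstanceAs ((D.t _).IsGE (((D.t _).truncGE i).obj (D.gm y n)) i)⟩⟩

lemma exists_triangle_edge : ∃ (C : D.DM (gen F)) (j : C ⟶ (D.trunc y i n)⟦i⟧) (δ : _),
    Triangle.mk j (D.edge y i n) δ ∈ distTriang (D.DM (gen F)) ∧ D.LE C (-2) := by
  let T := ((D.t (gen F)).truncLE (i - 1)).obj (D.gm y n)
  obtain ⟨δ, hT⟩ := triangle_ι _ ((D.t (gen F)).triangleLEGE_distinguished (i - 2) (i - 1) (by omega) T)
  obtain ⟨δ, hT⟩ := shift_distinguished hT i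
  let e : (((D.t (gen F)).truncGE (i - 1)).obj T).obj⟦i⟧ ≅ D.hShift y i n :=
    (shiftFunctorAdd' (D.DM (gen F)) (i - 1) 1 i (by omega)).app _ ≪≫
      (shiftFunctor _ (1 : ℤ)).mapIso
        (((compactObjects (D.DM (gen F))).ι.commShiftIso (i - 1)).symm.app _)
  obtain ⟨δ, hT⟩ := distinguished_of_iso hT (Iso.refl _) (Iso.refl _) e _ (D.edge y i n)
    ((Category.comp_id _).trans (Category.id_comp _).symm) (Category.id_comp _).symm
  have h : D.LE (((D.t (gen F)).truncLE (i - 2)).obj T).obj (i - 2) :=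
    ⟨(((D.t _).truncLE (i - 2)).obj T).property,
      inferInstanceAs ((D.t _).IsLE (((D.t _).truncLE (i - 2)).obj T) (i - 2))⟩
  exact ⟨_, _, δ, hT, h.shift i (-2) (by omega)⟩

/-- The edge map is bijective because the unit over `F` has cohomological dimension `1` and the
fibre of the edge morphism is concentrated in degrees at most `-2`. -/
lemma edgeMap_bijective : Function.Bijective (D.edgeMap y i n) := by
  obtain ⟨C, j, δ, hT, hC⟩ := D.exists_triangle_edge y i n
  constructor
  · rw [injective_iff_map_eq_zero]
    intro w hw
    rw [edgeMap_apply, ← Category.assoc] at hw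
    obtain ⟨x, rfl⟩ := exists_lift₂ hT w
      ((cancel_mono ((shiftFunctorZero (D.DM (gen F)) ℤ).inv.app (D.hShift y i n))).1
        (hw.trans zero_comp.symm))
    rw [D.tAxioms.eq_zero_gen hC x, zero_comp]
  · intro x
    obtain ⟨w, hw⟩ := exists_lift₃ hT (x ≫ (shiftFunctorZero (D.DM (gen F)) ℤ).hom.app _)
      (D.tAxioms.eq_zero_gen ((hC.shift 1 (-3) (by omega)).mono (by omega)) _)
    refine ⟨w, ?_⟩
    rw [edgeMap_apply, ← Category.assoc, ← hw, Category.assoc, Iso.hom_inv_id_app]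
    exact Category.comp_id _

/-- The truncation `τ_{≥ i}` contributes no classes in degree `i - 1`. -/
lemma truncMap_injective : Function.Injective (D.truncMap y i n) := by
  obtain ⟨B, q, δ, hT, hB⟩ := D.exists_triangle_trunc y i n
  obtain ⟨δ, hT⟩ := shift_distinguished hT i
  rw [injective_iff_map_eq_zero]
  intro w hw
  obtain ⟨x, hx⟩ := exists_lift₂ (inv_rot_of_distTriang _ hT) w hw
  have hx' : x = 0 := hom_eq_zero D.tAxioms.unit_gen.1
    ((hB.shift i 0 (by omega)).shift (-1) 1 (by omega)) (by omega) x
  rw [hx, hx']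
  exact zero_comp

variable {y i n}

/-- The motive of a model, truncated in degree `i`, is compared with the truncation of the motive
of the generic fibre in degree `i - 1`. -/
lemma exists_comparison {P : D.DM (top F)} (hP : compactObjects _ P)
    (φ : (D.pull (gen F).struct).obj P ≅ (D.gm y n).obj) (i : ℤ) :
    ∃ (T Q B C : D.DM (top F)) (a : T ⟶ P) (b : P ⟶ B) (δ : B ⟶ T⟦(1 : ℤ)⟧) (c : C ⟶ T⟦i⟧)
      (κ : T⟦i⟧ ⟶ Q) (δ' : Q ⟶ C⟦(1 : ℤ)⟧) (α : (D.pull (gen F).struct).obj T ⟶ D.trunc y i n)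
      (γ : (D.pull (gen F).struct).obj Q ≅ D.hShift y i n),
      Triangle.mk a b δ ∈ distTriang _ ∧ Triangle.mk c κ δ' ∈ distTriang _ ∧ D.GE B (i + 1) ∧
      D.LE C (-1) ∧ D.IsMixed Q ∧ D.IsCohomology P i Q ∧
      α ≫ D.truncι y i n = (D.pull (gen F).struct).map a ≫ φ.hom ∧
      (D.pull (gen F).struct).map κ ≫ γ.hom =
        ((D.pull (gen F).struct).commShiftIso i).hom.app T ≫ α⟦i⟧' ≫ D.edge y i n := by
  let η := D.pull (gen F).struct
  have A := D.tAxioms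
  let Q := (D.pH ⟨P, hP⟩ i).obj.obj
  have hQ : D.IsMixed Q := isMixed_obj _
  obtain ⟨-, T, B, C, a, b, δ, j, p, δ', hT₁, hT₂, hB, hC⟩ := isCohomology_pH (⟨P, hP⟩ : D.Gm _) i
  have hT := IsCohomology.le hT₂ hQ hC
  obtain ⟨ε, h₁⟩ := map_distinguished η hT₁
  obtain ⟨B', q', ε', h₂, hB'⟩ := D.exists_triangle_trunc y i n
  obtain ⟨α, -, hα, -⟩ := truncation_unique h₁ h₂ (A.generic_LE _ hT (m := i - 1) (by omega))
    (A.generic_GE _ hB (by omega)) (D.trunc_LE y i n) (hB'.anti (by omega)) φ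
  obtain ⟨ε₁, h₃⟩ := shift_distinguished hT₂ i
  let s : Q⟦-i⟧⟦i⟧ ≅ Q := (shiftFunctorCompIsoId (D.DM (top F)) (-i) i (by omega)).app Q
  obtain ⟨ε₂, h₄⟩ := distinguished_of_iso h₃ (Iso.refl _) (Iso.refl _) s (j⟦i⟧') (p⟦i⟧' ≫ s.hom)
    (by simp) (by simp)
  obtain ⟨ε₃, h₅⟩ := map_distinguished η h₄
  obtain ⟨C', j', ε₄, h₆, hC'⟩ := D.exists_triangle_edge y i n
  -- `η^*[-1]` is exact, so the truncation of the model restricts to that of the generic fibre, one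
  -- degree lower
  obtain ⟨-, γ, -, hγ⟩ := truncation_unique (n := -2) h₅ h₆
    (A.generic_LE _ (hC.shift i (-1) (by omega)) (by omega))
    (A.generic_GE _ hQ.2 (by omega)) hC' (D.hShift_GE y i n)
    ((η.commShiftIso i).app T ≪≫ (shiftFunctor _ i).mapIso α)
  exact ⟨T, Q, B, C⟦i⟧, a, b, δ, j⟦i⟧', p⟦i⟧' ≫ s.hom, ε₂, α.hom, γ, hT₁, h₄, hB,
    hC.shift i (-1) (by omega), hQ, isCohomology_pH (⟨P, hP⟩ : D.Gm _) i, hα,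
    hγ.trans (Category.assoc _ _ _)⟩

end MixedMotives

/-! ### The integral part of motivic cohomology -/

namespace TriangulatedMotives
open Sch
variable {F : Type} [Field F] [NumberField F] (D : TriangulatedMotives.{v, u} F)
open Functor.LaxMonoidal Functor.OplaxMonoidal

/-- Proper base change for projective morphisms. -/
lemma isIso_motBaseChange {X X' S S' : Sch F} {f : X ⟶ S} {f' : X' ⟶ S'} {a : X' ⟶ X} {s : S' ⟶ S}
    (w : a ≫ f = f' ≫ s) (hc : Cartesian a f' f s) (hf : IsProjectiveHom (mor f))
    (hf' : IsProjectiveHom (mor f')) : IsIso (D.motBaseChange w) := by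
  have := D.forget_isIso f hf
  have := D.forget_isIso f' hf'
  have : IsIso (D.exchange w ((D.pull f).obj (𝟙_ (D.DM S)))) := by
    have h := D.baseChange_forget w hc hf.quasiProjective ((D.pull f).obj (𝟙_ (D.DM S)))
    have : IsIso ((D.pull s).map ((D.forget f).app ((D.pull f).obj (𝟙_ (D.DM S)))) ≫
        D.exchange w ((D.pull f).obj (𝟙_ (D.DM S)))) := by rw [← h]; infer_instance
    exact IsIso.of_isIso_comp_left ((D.pull s).map ((D.forget f).app _)) _
  rw [InverseImages.motBaseChange]
  infer_instance

/-- `s^*(M(X)(n)) ≅ M(X')(n)` for the base change `X'` of a projective scheme `X`. -/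
def gmBaseChange {X X' S S' : Sch F} {f : X ⟶ S} {f' : X' ⟶ S'} {a : X' ⟶ X} {s : S' ⟶ S}
    (w : a ≫ f = f' ≫ s) (hc : Cartesian a f' f s) (hf : IsProjectiveHom (mor f))
    (hf' : IsProjectiveHom (mor f')) (n : ℤ) :
    (D.pull s).obj ((D.twist S n).obj (D.mot f)) ≅ (D.twist S' n).obj (D.mot f') :=
  D.pullTwist s n _ ≪≫ (D.twist S' n).mapIso
    (@asIso _ _ _ _ (D.motBaseChange w) (D.isIso_motBaseChange w hc hf hf'))

end TriangulatedMotives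

namespace MixedMotives
open Sch TStructuresAndWeights TriangulatedMotives TStructureAxioms InverseImages
variable {F : Type} [Field F] [NumberField F] {ℓ : ℕ} [Fact ℓ.Prime] (D : MixedMotives.{v, u} F ℓ)
  {Y : Sch F} {y : Y ⟶ gen F} [Smooth (mor y)] (hy : IsProjectiveHom (mor y)) {i n : ℤ}
include hy

/-- The integral part of `H^i(Y, n)` for `i < 2n` consists of the images, under the truncation map,
of those classes whose image under the edge map is the restriction of a class of the intermediate
extension of `h^{i-1}(Y, n)[1]`. -/
lemma integralH_eq (hi : i < 2 * n) (m : ProjectiveModel y)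
    (e : D.GenericIntermediateExtension (D.hShift y i n)) :
    D.integralH m i n = (Submodule.comap (D.edgeMap y i n) (LinearMap.range (e.restrict 0))).map
      (D.truncMap y i n) := by
  have : LocallyOfFiniteType (mor m.f) := m.projective.isProper.toLocallyOfFiniteType
  let φ := D.gmBaseChange m.comm m.cartesian m.projective hy n
  obtain ⟨T, Q, B, C, a, b, δ, c, κ, δ', α, γ, hT₁, hT₂, hB, hC, mQ, hQ, hα, hγ⟩ :=
    D.exists_comparison (D.gm m.f n).property φ i
  have hwM := weights_iff.1 (D.wAxioms.weights_mot_le D.tAxioms (.op ⊤) m.f m.projective n)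
  have hwQ : D.Weights Q (· ≤ -1) := (D.wAxioms.weights_isMixed_iff (.op ⊤) mQ).2 fun w hw => by
    have := hwM.2 i mQ.toMM hQ w hw
    omega
  rw [e.range_restrict mQ γ hwQ]
  -- every class of the model lifts to `T`, because there are no morphisms from `1[1]`, pure of
  -- weight `1`, to `ᵖH^{i+1}`, which has weights at most `0`
  have hs₁ : ∀ x : 𝟙_ (D.DM (top F)) ⟶ ((D.twist _ n).obj (D.mot m.f))⟦i⟧,
      ∃ t : 𝟙_ (D.DM (top F)) ⟶ T⟦i⟧, x = t ≫ a⟦i⟧' := fun x => by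
    obtain ⟨ε, hT⟩ := shift_distinguished hT₁ i
    let K := D.h m.f (i + 1) n
    have hK : D.IsCohomology ((D.gm m.f n).obj⟦i⟧) (0 + 1) K.obj.obj :=
      (isCohomology_pH (D.gm m.f n) (i + 1)).shift i _ (by omega)
    have hw : D.Weights K.obj.obj (· ≤ 0) :=
      (D.wAxioms.weights_isMixed_iff (.op ⊤) (isMixed_obj K)).2 fun w hw => by
        have := hwM.2 (i + 1) K (isCohomology_pH (D.gm m.f n) (i + 1)) w hw
        omega
    refine exists_lift_truncation (m := 0) hT (hB.shift i _ (by omega)) hK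
      (D.tAxioms.unit_op_LE ⊤) (fun g => ?_) x
    apply (shiftFunctor (D.DM (top F)) (1 : ℤ)).map_injective
    rw [← cancel_mono ((shiftFunctorCompIsoId (D.DM (top F)) (-(0 + 1)) 1 (by omega)).hom.app _),
      Functor.map_zero, zero_comp]
    refine D.wAxioms.mixed_hom_eq_zero_of_gt (.op ⊤) (D.tAxioms.unit_op ⊤) (isMixed_obj K)
      (((D.wAxioms.unit (.op ⊤)).shift (Q := (1 ≤ ·)) 1 fun w hw => by omega)) hw (by omega) _
  -- every class of `Q` lifts to `T[i]` by cohomological dimension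
  have hs₂ : ∀ x : 𝟙_ (D.DM (top F)) ⟶ Q, ∃ t : 𝟙_ (D.DM (top F)) ⟶ T⟦i⟧, x = t ≫ κ := fun x =>
    exists_lift₃ hT₂ x (D.tAxioms.eq_zero_top (hC.shift 1 _ (by omega)) _)
  -- compatibility of the maps from `H^i(T)` with the truncation map and the edge map
  have h₁ : ∀ t : D.H T i, D.truncMap y i n (D.pullH (gen F).struct α i t) =
      m.restrict D i n (t ≫ a⟦i⟧') := fun t => by
    rw [truncMap_apply, ← pullH_comp_right, hα]
    exact (pullH_comp _ φ.hom i a t).symm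
  have h₂ : ∀ t : D.H T i, D.edgeMap y i n (D.pullH (gen F).struct α i t) =
      D.pullH (gen F).struct γ.hom 0
        ((t ≫ κ) ≫ (shiftFunctorZero (D.DM (top F)) ℤ).inv.app Q) := fun t => by
    rw [edgeMap_apply, pullH_zero, pullH_apply, Functor.map_comp]
    simp only [Category.assoc]
    rw [reassoc_of% hγ]
  ext z
  constructor
  · rintro ⟨x, rfl⟩
    obtain ⟨t, rfl⟩ := hs₁ x
    exact ⟨_, ⟨_, (h₂ t).symm⟩, h₁ t⟩
  · rintro ⟨w, ⟨x, hx⟩, rfl⟩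
    obtain ⟨t, ht⟩ := hs₂ (x ≫ (shiftFunctorZero (D.DM (top F)) ℤ).hom.app Q)
    refine ⟨t ≫ a⟦i⟧', ?_⟩
    rw [← h₁]
    congr 1
    apply (D.edgeMap_bijective y i n).1
    rw [h₂, ← ht, ← hx]
    simp

end MixedMotives

/-! ### Purity for schemes of a fixed relative dimension -/

namespace TriangulatedMotives
open Sch
variable {F : Type} [Field F] [NumberField F] (D : TriangulatedMotives.{v, u} F)

/-- The functor `M ↦ M(-1)[-2]`. -/
abbrev purityShift (S : Sch F) : D.DM S ⥤ D.DM S := D.twist S (-1) ⋙ shiftFunctor _ (-2 : ℤ)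

instance (S : Sch F) (n : ℤ) : (D.twist S n).IsEquivalence :=
  inferInstanceAs (D.twistEquivalence S n).functor.IsEquivalence

/-- Twists commute with each other. -/
def twistTwist (S : Sch F) (n m : ℤ) (M : D.DM S) :
    (D.twist S n).obj ((D.twist S m).obj M) ≅ (D.twist S m).obj ((D.twist S n).obj M) :=
  α_ _ _ _ ≪≫ whiskerLeftIso M (β_ _ _) ≪≫ (α_ _ _ _).symm

/-- `(M(-1)[-2])(n) ≅ M(n)(-1)[-2]`. -/
def twistPurityShift (S : Sch F) (n : ℤ) (M : D.DM S) :
    (D.twist S n).obj ((D.purityShift S).obj M) ≅ (D.purityShift S).obj ((D.twist S n).obj M) :=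
  ((D.twist S n).commShiftIso (-2)).app _ ≪≫
    (shiftFunctor _ (-2 : ℤ)).mapIso (D.twistTwist S n (-1) M)

/-- `f^*(M(-1)[-2]) ≅ (f^* M)(-1)[-2]`. -/
def pullPurityShift {X Y : Sch F} (f : X ⟶ Y) (M : D.DM Y) :
    (D.pull f).obj ((D.purityShift Y).obj M) ≅ (D.purityShift X).obj ((D.pull f).obj M) :=
  ((D.pull f).commShiftIso (-2)).app _ ≪≫
    (shiftFunctor _ (-2 : ℤ)).mapIso (D.pullTwist f (-1) M)

/-- `f_*(M(-1)[-2]) ≅ (f_* M)(-1)[-2]`. -/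
def pushPurityShift {X Y : Sch F} (f : X ⟶ Y) (M : D.DM X) :
    (D.push f).obj ((D.purityShift X).obj M) ≅ (D.purityShift Y).obj ((D.push f).obj M) :=
  ((D.push f).commShiftIso (-2)).app _ ≪≫
    (shiftFunctor _ (-2 : ℤ)).mapIso (D.pushTwist f (-1) M).symm

/-- `i^! 1 ≅ 1(-1)[-2]` for a closed point `i`. -/
lemma nonempty_upper_unit {p : IsDedekindDomain.HeightOneSpectrum (𝓞 F)} {U : (specO F).Opens}
    (i : pt p ⟶ op U) :
    Nonempty ((D.upper i).obj (𝟙_ (D.DM (op U))) ≅ (D.purityShift (pt p)).obj (𝟙_ _)) := by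
  have a := D.absolutePurity i 1 inferInstance (isRegularScheme_pt p) (isRegularScheme_op U)
    (hasCodim_pt i)
  let b := a ≪≫ ((D.upper i).commShiftIso _).app _ ≪≫ (shiftFunctor _ _).mapIso
    ((D.upper i).mapIso (λ_ (D.tate (op U) (1 : ℕ))).symm ≪≫
      D.upperTwist i (.of_isClosedImmersion _) _ (𝟙_ _))
  exact ⟨((D.purityShift (pt p)).mapIso b ≪≫ (shiftFunctor _ (-2 : ℤ)).mapIso
    (((D.twist (pt p) (-1)).commShiftIso _).app _ ≪≫
      (shiftFunctor _ _).mapIso (D.twistNeg (pt p) (1 : ℕ) _)) ≪≫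
      (shiftFunctorCompIsoId (D.DM (pt p)) _ (-2) (by norm_num)).app _).symm⟩

/-- Absolute purity for smooth projective schemes over an open subscheme of `Spec 𝓞 F`. -/
lemma nonempty_upper_mot {p : IsDedekindDomain.HeightOneSpectrum (𝓞 F)} {U : (specO F).Opens}
    (i : pt p ⟶ op U) {X : Sch F} (f : X ⟶ op U) (hf : IsProjectiveHom (mor f)) (d : ℕ)
    (hd : SmoothOfRelativeDimension d (mor f)) :
    Nonempty ((D.upper i).obj (D.mot f) ≅ (D.purityShift (pt p)).obj ((D.pull i).obj (D.mot f))) := by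
  have := hf.isProper
  obtain ⟨Z, a, g, w, hc⟩ := exists_cartesian f i
  have hg : IsProjectiveHom (mor g) := .of_isPullback hc hf
  have ha : IsClosedImmersion (mor a) :=
    MorphismProperty.of_isPullback (P := @IsClosedImmersion) hc.flip inferInstance
  have := smoothOfRelativeDimension_isStableUnderBaseChange d
  have hdg : SmoothOfRelativeDimension d (mor g) :=
    MorphismProperty.of_isPullback (P := @SmoothOfRelativeDimension d) hc hd
  obtain ⟨ρf⟩ := D.relativePurity f d hf.quasiProjective hd
  obtain ⟨ρg⟩ := D.relativePurity g d hg.quasiProjective hdg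
  obtain ⟨u⟩ := D.nonempty_upper_unit i
  have qa : IsQuasiProjectiveHom (mor a) := .of_isImmersion _
  have qi : IsQuasiProjectiveHom (mor i) := .of_isImmersion _
  let G := D.twist Z d ⋙ shiftFunctor (D.DM Z) (2 * d : ℤ)
  let N := (D.pull f).obj (𝟙_ (D.DM (op U)))
  -- relative purity for `f` and `g` gives `a^! f^* 1 (d)[2d] ≅ a^! f^! 1 ≅ g^! i^! 1 ≅ g^* i^! 1
  -- (d)[2d]`
  have e₁ : G.obj ((D.upper a).obj N) ≅
      G.obj ((D.pull g).obj ((D.purityShift (pt p)).obj (𝟙_ _))) :=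
    ((D.upper a).mapIso (ρf.app _) ≪≫ ((D.upper a).commShiftIso _).app _ ≪≫
      (shiftFunctor _ _).mapIso (D.upperTwist a (.of_isClosedImmersion _) d N)).symm ≪≫
    (D.upperComp w qa hf.quasiProjective).app _ ≪≫
    (D.upperComp rfl hg.quasiProjective qi).symm.app _ ≪≫
    (D.upper g).mapIso u ≪≫ ρg.app _
  have e₂ : (D.upper a).obj N ≅ (D.purityShift Z).obj ((D.pull g).obj (𝟙_ _)) :=
    G.preimageIso e₁ ≪≫ D.pullPurityShift g _
  have := D.isIso_motBaseChange w hc hf hg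
  exact ⟨(D.upperPush w.symm hc.flip qi).app N ≪≫ (D.push g).mapIso e₂ ≪≫
    D.pushPurityShift g _ ≪≫ (D.purityShift (pt p)).mapIso (asIso (D.motBaseChange w)).symm⟩

end TriangulatedMotives

namespace WeightAxioms
open Sch TStructuresAndWeights
variable {F : Type} [Field F] [NumberField F] {D : TStructuresAndWeights.{v, u} F}
  (A : TStructureAxioms D) (W : WeightAxioms D) {S X : Sch F} (hS : IsArithmeticBase S)
include A W hS

/-- The motive `M(X)(n)` of a smooth projective scheme `X` has weights at least `-2n`. -/
lemma weights_mot_ge_of_relativeDimension (f : X ⟶ S) (hf : IsProjectiveHom (mor f)) (d : ℕ)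
    (hd : SmoothOfRelativeDimension d (mor f)) (n : ℤ) :
    D.Weights ((D.twist S n).obj (D.mot f)) (-2 * n ≤ ·) := by
  obtain ⟨k, hk, -⟩ := W.exists_unit_shift A hS
  obtain ⟨ρ⟩ := D.relativePurity f d hf.quasiProjective hd
  let N := (D.twist S (-d)).obj ((D.twist S n).obj (𝟙_ (D.DM S)))
  obtain ⟨h₁, h₂⟩ := W.weights_twist hS hk (W.unit hS) n
  have h := (W.weights_twist hS h₁ h₂ (-d)).2.imp (Q := (2 * d - 2 * n ≤ ·)) fun w hw => by omega
  let e : (D.twist X d).obj ((D.pull f).obj N) ≅ (D.twist X n).obj ((D.pull f).obj (𝟙_ _)) :=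
    (D.pullTwist f d N).symm ≪≫ (D.pull f).mapIso (D.negTwist S d _) ≪≫ D.pullTwist f n _
  have h' := ((W.push_upper hS f hf.quasiProjective).ge h).of_iso ((D.push f).mapIso
    (ρ.app N ≪≫ (shiftFunctor _ _).mapIso e) ≪≫ ((D.push f).commShiftIso _).app _ ≪≫
      (shiftFunctor _ _).mapIso (D.pushTwist f n _).symm)
  exact (h'.shift (Q := (-2 * n ≤ ·)) (-(2 * d)) fun w hw => by omega).of_iso
    ((shiftFunctorCompIsoId (D.DM S) _ (-(2 * d : ℤ)) (by omega)).app _)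

end WeightAxioms

/-! ### Purity for smooth projective schemes -/

namespace Sch
variable {F : Type} [Field F]

/-- An open and closed subscheme and its complement. -/
lemma exists_isOpenComplement_of_isClosed (X : Sch F) (V : X.toScheme.Opens)
    (hV : IsClosed (V : Set X.toScheme)) :
    ∃ (X₁ X₂ : Sch F) (i : X₁ ⟶ X) (j : X₂ ⟶ X), IsOpenImmersion (mor i) ∧
      IsClosedImmersion (mor j) ∧ IsOpenComplement j i ∧ Set.range (mor i) = V := by
  let V' : X.toScheme.Opens := ⟨(V : Set X.toScheme)ᶜ, hV.isOpen_compl⟩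
  have h₁ : IsClosedImmersion V.ι := .of_isPreimmersion _ (by rwa [Scheme.Opens.range_ι])
  have h₂ : IsClosedImmersion V'.ι := .of_isPreimmersion _ (by
    rw [Scheme.Opens.range_ι]
    exact V.isOpen.isClosed_compl)
  refine ⟨ofHom X V.ι, ofHom X V'.ι, ofHomπ X V.ι, ofHomπ X V'.ι, inferInstanceAs
    (IsOpenImmersion V.ι), h₂, ⟨inferInstanceAs (IsOpenImmersion V'.ι), h₁, ?_⟩, V.range_ι⟩
  exact V'.range_ι.trans (congrArg (fun s : Set X.toScheme => sᶜ) V.range_ι.symm)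

/-- A property of smooth projective schemes that holds for those with a relative dimension and is
stable under disjoint unions holds for all of them. -/
lemma induction_relativeDimension {S : Sch F} [CompactSpace S.toScheme]
    (P : ∀ {X : Sch F}, (X ⟶ S) → Prop)
    (h₁ : ∀ {X : Sch F} (f : X ⟶ S) (d : ℕ), IsProjectiveHom (mor f) →
      SmoothOfRelativeDimension d (mor f) → P f)
    (h₂ : ∀ {X X₁ X₂ : Sch F} (f : X ⟶ S) (i : X₁ ⟶ X) (j : X₂ ⟶ X), IsProjectiveHom (mor f) →
      IsOpenImmersion (mor i) → IsOpenComplement j i → P (i ≫ f) → P (j ≫ f) → P f)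
    {X : Sch F} (f : X ⟶ S) [Smooth (mor f)] (hf : IsProjectiveHom (mor f)) : P f := by
  -- induction on a bound `N` for the relative dimensions, splitting off the open and closed locus
  -- of relative dimension `N`
  have key : ∀ (N : ℕ) {X : Sch F} (f : X ⟶ S), Smooth (mor f) → IsProjectiveHom (mor f) →
      (∀ x, ∃ d < N, x ∈ relDimLocus (mor f) d) → P f := by
    have top : ∀ {X : Sch F} (f : X ⟶ S) (d : ℕ), IsProjectiveHom (mor f) →
        (∀ x, x ∈ relDimLocus (mor f) d) → P f := fun {X} f d hf h => by
      have e : relDimLocus (mor f) d = ⊤ := top_unique fun x _ => h x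
      have hd := smoothOfRelativeDimension_relDimLocus (mor f) d
      rw [e] at hd
      have := SmoothOfRelativeDimension.comp_open X.toScheme.topIso.inv _ hd
      rw [← Scheme.topIso_hom, Iso.inv_hom_id_assoc] at this
      exact h₁ f d hf this
    intro N
    induction N with
    | zero =>
      intro X f hs hf h
      refine top f 0 hf fun x => ?_
      obtain ⟨d, hd, -⟩ := h x
      omega
    | succ N ih =>
      intro X f hs hf h
      obtain ⟨X₁, X₂, i, j, hi, hj, hij, hr⟩ := exists_isOpenComplement_of_isClosed X _
        (isClosed_relDimLocus (mor f) N)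
      have := hij.1
      have := hij.2.1
      refine h₂ f i j hf hi hij (top _ N (hf.comp_isClosedImmersion _) fun x => ?_)
        (ih _ (by rw [mor_comp]; infer_instance) (hf.comp_isClosedImmersion _) fun x => ?_)
      · exact preimage_relDimLocus_le (mor i) (mor f) N (hr.le ⟨x, rfl⟩)
      · obtain ⟨d, hd, hx⟩ := h (mor j x)
        refine ⟨d, lt_of_le_of_ne (by omega) ?_, preimage_relDimLocus_le (mor j) (mor f) d hx⟩
        rintro rfl
        have h' : mor j x ∈ (Set.range (mor i))ᶜ := hij.2.2.le ⟨x, rfl⟩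
        rw [hr] at h'
        exact h' hx
  have := hf.isProper
  have : CompactSpace X.toScheme := QuasiCompact.compactSpace_of_compactSpace (mor f)
  obtain ⟨t, ht⟩ := isCompact_univ.elim_finite_subcover
    (fun d => (relDimLocus (mor f) d : Set X.toScheme)) (fun d => (relDimLocus (mor f) d).isOpen)
    fun x _ => Set.mem_iUnion.2 (exists_mem_relDimLocus (mor f) x)
  refine key (t.sup id + 1) f inferInstance hf fun x => ?_
  obtain ⟨d, hd, hx⟩ := Set.mem_iUnion₂.1 (ht (Set.mem_univ x))
  exact ⟨d, Nat.lt_succ_of_le (Finset.le_sup (f := id) hd), hx⟩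

end Sch

section Biprod
variable {C E : Type*} [Category* C] [TensorTriangulated C] [Category* E] [TensorTriangulated E]

/-- Additive functors commute with direct sums. -/
def mapBiprodIso (G : C ⥤ E) [G.Additive] (X Y : C) : G.obj (X ⊞ Y) ≅ G.obj X ⊞ G.obj Y :=
  have := preservesBinaryBiproducts_of_preservesBiproducts G
  G.mapBiprod X Y

end Biprod

namespace TriangulatedMotives
open Sch
variable {F : Type} [Field F] [NumberField F] (D : TriangulatedMotives.{v, u} F)

/-- `f_* ⋙ g_* ≅ (f ≫ g)_*`. -/
def pushComp {X Y Z : Sch F} (f : X ⟶ Y) (g : Y ⟶ Z) :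
    D.push f ⋙ D.push g ≅ D.push (f ≫ g) :=
  conjugateIsoEquiv ((D.adj g).comp (D.adj f)) (D.adj (f ≫ g)) (D.pullComp rfl).symm

/-- The motive of a disjoint union is a direct sum. -/
lemma nonempty_mot_biprod {X X₁ X₂ S : Sch F} (f : X ⟶ S) (i : X₁ ⟶ X) (j : X₂ ⟶ X)
    (hi : IsOpenImmersion (mor i)) (h : IsOpenComplement j i) :
    Nonempty (D.mot f ≅ D.mot (i ≫ f) ⊞ D.mot (j ≫ f)) := by
  have := h.2.1
  let N := (D.pull f).obj (𝟙_ (D.DM S))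
  obtain ⟨δ, hT⟩ := D.dualLocalization j i h N
  -- the localization triangle splits, because its boundary is a morphism between motives with
  -- disjoint support
  have hδ : δ = 0 := by
    have hz : IsZero ((D.pull i).obj ((D.push j).obj ((D.pull j).obj N))) :=
      (isZero_upper_push (D.open_closed_zero j i h) _).of_iso ((D.openIso i hi).app _)
    let c := ((D.shriek i).commShiftIso (1 : ℤ)).symm.app ((D.upper i).obj N) ≪≫
      (D.shriekIsoPushOfClosed i).app _
    rw [← cancel_mono c.hom, zero_comp]
    exact ((D.adj i).homEquiv _ _).symm.injective (hz.eq_of_src _ _)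
  obtain ⟨e, -, -⟩ := exists_iso_binaryBiproduct_of_distTriang _ hT hδ
  exact ⟨(D.push f).mapIso e ≪≫ mapBiprodIso _ _ _ ≪≫ biprod.mapIso
    ((D.push f).mapIso ((D.shriekIsoPushOfClosed i).app _ ≪≫
        (D.push i).mapIso ((D.openIso i hi).symm.app _)) ≪≫ (D.pushComp i f).app _ ≪≫
      (D.push _).mapIso ((D.pullComp rfl).app _))
    ((D.pushComp j f).app _ ≪≫ (D.push _).mapIso ((D.pullComp rfl).app _))⟩

end TriangulatedMotives

namespace TStructuresAndWeights
open Sch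
variable {F : Type} [Field F] [NumberField F] {D : TStructuresAndWeights.{v, u} F} {S : Sch F}

/-- Lower bounds for weights pass to direct sums: the projections to the summands are zero on the
step of the weight filtration below the bound. -/
lemma Weights.ge_of_iso_biprod (W : WeightAxioms D) (hS : IsArithmeticBase S)
    {M A B : D.DM S} {a : ℤ} (hA : D.Weights A (a ≤ ·)) (hB : D.Weights B (a ≤ ·))
    (hM : compactObjects _ M) (e : M ≅ A ⊞ B) : D.Weights M (a ≤ ·) := by
  obtain ⟨hA, hA'⟩ := hA
  obtain ⟨hB, hB'⟩ := hB
  refine ⟨hM, fun n w hw => ?_⟩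
  have h : WeightGE (D.pH ⟨M, hM⟩ n) (a + n) := by
    let _ := (D.t S).heartAbelian
    let T := (D.weight S (a + n - 1)).obj (D.pH ⟨M, hM⟩ n)
    let ι : T ⟶ (D.pHFunctor S n).obj ⟨M, hM⟩ := (D.weightι S (a + n - 1)).app _
    have : Mono ι := W.mono hS _ _
    have hT : WeightLE T (a + n - 1) := W.weightLE_weight_obj hS _ _
    let pA : (⟨M, hM⟩ : D.Gm S) ⟶ ⟨A, hA⟩ := ObjectProperty.homMk (e.hom ≫ biprod.fst)
    let pB : (⟨M, hM⟩ : D.Gm S) ⟶ ⟨B, hB⟩ := ObjectProperty.homMk (e.hom ≫ biprod.snd)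
    let iA : (⟨A, hA⟩ : D.Gm S) ⟶ ⟨M, hM⟩ := ObjectProperty.homMk (biprod.inl ≫ e.inv)
    let iB : (⟨B, hB⟩ : D.Gm S) ⟶ ⟨M, hM⟩ := ObjectProperty.homMk (biprod.inr ≫ e.inv)
    have hid : pA ≫ iA + pB ≫ iB = 𝟙 _ := by
      apply ObjectProperty.hom_ext
      change (e.hom ≫ biprod.fst) ≫ (biprod.inl ≫ e.inv) +
        (e.hom ≫ biprod.snd) ≫ (biprod.inr ≫ e.inv) = 𝟙 M
      simp only [Category.assoc]
      rw [← Preadditive.comp_add, ← Category.assoc biprod.fst, ← Category.assoc biprod.snd,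
        ← Preadditive.add_comp, biprod.total]
      simp
    have hA₁ : ι ≫ (D.pHFunctor S n).map pA = 0 := W.hom_eq_zero_of_lt hS hT
      ((W.weightGE_iff hS (n := a + n)).2 fun w hw => by have := hA' n w hw; omega) (by omega) _
    have hB₁ : ι ≫ (D.pHFunctor S n).map pB = 0 := W.hom_eq_zero_of_lt hS hT
      ((W.weightGE_iff hS (n := a + n)).2 fun w hw => by have := hB' n w hw; omega) (by omega) _
    have hι : ι = 0 := by
      have h := congrArg (fun g => ι ≫ (D.pHFunctor S n).map g) hid
      rw [Functor.map_add, Functor.map_comp, Functor.map_comp, Preadditive.comp_add] at h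
      rw [reassoc_of% hA₁, reassoc_of% hB₁, zero_comp, zero_comp, add_zero,
        CategoryTheory.Functor.map_id] at h
      exact (Category.comp_id ι).symm.trans h.symm
    exact IsZero.of_mono_eq_zero ι hι
  have := (W.weightGE_iff hS).1 h w hw
  omega

end TStructuresAndWeights

namespace MixedMotives
open Sch TStructuresAndWeights TriangulatedMotives TStructureAxioms InverseImages
variable {F : Type} [Field F] [NumberField F] {ℓ : ℕ} [Fact ℓ.Prime] {D : MixedMotives.{v, u} F ℓ}
  {U : (specO F).Opens} {M N : D.DM (op U)}

lemma IsSmoothMotive.of_iso (h : D.IsSmoothMotive M) (e : M ≅ N) : D.IsSmoothMotive N :=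
  fun p i => (h p i).map fun φ => (D.upper i).mapIso e.symm ≪≫ φ ≪≫
    (D.pull i ⋙ D.purityShift (pt p)).mapIso e

lemma IsSmoothMotive.twist (h : D.IsSmoothMotive M) (n : ℤ) :
    D.IsSmoothMotive ((D.twist _ n).obj M) :=
  fun p i => (h p i).map fun φ => D.upperTwist i (.of_isClosedImmersion _) n M ≪≫
    (D.twist (pt p) n).mapIso φ ≪≫ D.twistPurityShift (pt p) n _ ≪≫
    (D.purityShift (pt p)).mapIso (D.pullTwist i n M).symm

lemma IsSmoothMotive.biprod (hM : D.IsSmoothMotive M) (hN : D.IsSmoothMotive N) :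
    D.IsSmoothMotive (M ⊞ N) := fun p i => by
  obtain ⟨a⟩ := hM p i
  obtain ⟨b⟩ := hN p i
  exact ⟨mapBiprodIso (D.upper i) M N ≪≫ biprod.mapIso a b ≪≫
    (mapBiprodIso (D.pull i ⋙ D.purityShift (pt p)) M N).symm⟩

instance : CompactSpace (op U).toScheme :=
  isCompact_iff_compactSpace.1 (TopologicalSpace.NoetherianSpace.isCompact (U : Set (specO F)))

variable (D) {X : Sch F} (f : X ⟶ op U) [Smooth (mor f)] (hf : IsProjectiveHom (mor f))
include hf

/-- The motive of a smooth projective scheme over an open subscheme of `Spec 𝓞 F` is smooth. -/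
lemma isSmoothMotive_mot : D.IsSmoothMotive (D.mot f) :=
  induction_relativeDimension (fun f => D.IsSmoothMotive (D.mot f))
    (fun f d hf hd _ i => D.nonempty_upper_mot i f hf d hd)
    (fun f i j _ hi hij h₁ h₂ => (D.nonempty_mot_biprod f i j hi hij).elim fun e =>
      (h₁.biprod h₂).of_iso e.symm) f hf

/-- The motive `M(X)(n)` of a smooth projective scheme `X` has weights at least `-2n`. -/
lemma weights_mot_ge (n : ℤ) : D.Weights ((D.twist _ n).obj (D.mot f)) (-2 * n ≤ ·) :=
  induction_relativeDimension (fun f => D.Weights ((D.twist _ n).obj (D.mot f)) (-2 * n ≤ ·))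
    (fun f d hf hd => D.wAxioms.weights_mot_ge_of_relativeDimension D.tAxioms (.op U) f hf d hd n)
    (fun {X X₁ X₂} f i j hf hi hij h₁ h₂ => by
      obtain ⟨e⟩ := D.nonempty_mot_biprod f i j hi hij
      have : LocallyOfFiniteType (mor f) := hf.isProper.toLocallyOfFiniteType
      exact Weights.ge_of_iso_biprod D.wAxioms (.op U) h₁ h₂ (D.gm f n).property
        ((D.twist _ n).mapIso e ≪≫ mapBiprodIso (D.twist _ n) _ _)) f hf

end MixedMotives

/-! ### Pure motives and subobjects supported in closed points -/

namespace TStructuresAndWeights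
open Sch
variable {F : Type} [Field F] [NumberField F] {D : TStructuresAndWeights.{v, u} F} {S : Sch F}

/-- Morphisms from a motive in degrees at most `0` to a mixed motive factor through the cohomology
of the former in degree `0`, and vanish by weights. -/
lemma hom_eq_zero_of_LE (W : WeightAxioms D) (hS : IsArithmeticBase S) {M X : D.DM S} {a b : ℤ}
    (hX : D.LE X 0) (hw : D.Weights X (· ≤ a)) (hM : D.IsMixed M) (hwM : D.Weights M (b ≤ ·))
    (hab : a < b) (f : X ⟶ M) : f = 0 := by
  obtain ⟨-, A, B, C, i, q, δ, j, p, δ', hT₁, hT₂, hB, hC⟩ := isCohomology_pH (⟨X, hX.1⟩ : D.Gm S) 0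
  have hK : D.IsMixed (D.pH ⟨X, hX.1⟩ 0).obj.obj := isMixed_obj _
  have hwK : D.Weights (D.pH ⟨X, hX.1⟩ 0).obj.obj (· ≤ a) :=
    (W.weights_isMixed_iff hS hK).2 fun w hw' => by
      simpa using (weights_iff.1 hw).2 0 _ (isCohomology_pH ⟨X, hX.1⟩ 0) w hw'
  have : IsIso i := isIso₁_of_isZero₃ hT₁ (isZero_of_LE_GE (LE.obj₃ hT₁
    ((IsCohomology.le hT₂ hK hC).mono (by omega)) hX) hB (by omega))
  rw [← cancel_epi i, comp_zero]
  obtain ⟨g, hg⟩ := exists_desc₂ hT₂ (i ≫ f) (hom_eq_zero hC hM.2 (by omega) _)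
  have : g = 0 := by
    rw [← cancel_epi ((shiftFunctorZero' (D.DM S) (-(0 : ℤ)) (by simp)).inv.app _), comp_zero]
    exact W.mixed_hom_eq_zero_of_lt hS hK hM hwK hwM hab _
  rw [hg, this, comp_zero]

end TStructuresAndWeights

namespace TStructureAxioms
open Sch TStructuresAndWeights TriangulatedMotives
variable {F : Type} [Field F] [NumberField F] {D : TStructuresAndWeights.{v, u} F}
  (A : TStructureAxioms D) (W : WeightAxioms D) {U : (specO F).Opens} (e : gen F ⟶ op U)
include A

lemma hom_pt_eq_zero {p : IsDedekindDomain.HeightOneSpectrum (𝓞 F)} {M X : D.DM (pt p)}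
    (hM : D.IsMixed M) (hX : D.LE X (-1)) (f : M ⟶ X) : f = 0 :=
  A.eq_zero_of_cohDim (.pt p) (c := 0) (fun K hK i hi f => A.cohDim_pt p _ _ hM hK i hi f)
    (by simpa using hX) f

include W in
/-- A pure mixed motive `Q` such that `i^* Q` is concentrated in degrees `< 0` has no subobjects
supported in closed points: for a subobject `K`, the motive `i^* K` is a quotient of the cohomology
of `i^*(Q/K)` in degree `-1`, which has smaller weights. -/
lemma isZero_of_pure {Q K I : D.DM (op U)} (hK : D.IsMixed K)
    {k : K ⟶ Q} {q : Q ⟶ I} {δ : I ⟶ K⟦(1 : ℤ)⟧} (hT : Triangle.mk k q δ ∈ distTriang (D.DM (op U)))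
    (hz : IsZero ((D.pull e).obj K)) {a : ℤ} (hwK : D.Weights K (a ≤ ·))
    (hwI : D.Weights I (· ≤ a)) (h : ∀ (p : IsDedekindDomain.HeightOneSpectrum (𝓞 F))
      (i : pt p ⟶ op U), D.LE ((D.pull i).obj Q) (-1)) : IsZero K := by
  rw [IsZero.iff_id_eq_zero]
  refine eq_zero_of_generic e hK.1.1 hK.1.1 _ (hz.eq_of_src _ _) fun p i g => ?_
  -- it remains to see that `i^! K` vanishes; it is a direct summand of `i^* K`, and its inclusion
  -- into `i^* K` factors through `i^* I[-1]`, which has weights `< a`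
  refine IsZero.eq_of_tgt ?_ _ _
  obtain ⟨r⟩ := nonempty_retract_of_generic_isZero e hK.1.1 hz i
  obtain ⟨ε, h₁⟩ := map_distinguished (D.pull i) hT
  have hL : D.IsMixed ((D.upper i).obj K) :=
    ⟨A.upper_LE_of_generic_isZero e hz i hK.1, A.upper_GE i hK.2⟩
  have h₂ : D.LE ((D.pull i).obj I) (-1) := LE.obj₃ h₁ (A.pull_LE i hK.1) (h p i)
  obtain ⟨v, d, hv⟩ : ∃ (v : (D.upper i).obj K ⟶ ((D.pull i).obj I)⟦(-1 : ℤ)⟧)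
      (d : _ ⟶ (D.pull i).obj K), r.i = v ≫ d := by
    obtain ⟨v, hv⟩ := exists_lift₂ (inv_rot_of_distTriang _ h₁) r.i
      (A.hom_pt_eq_zero hL (h p i) _)
    exact ⟨v, _, hv⟩
  have hw : D.Weights (((D.pull i).obj I)⟦(-1 : ℤ)⟧) (· ≤ a - 1) :=
    ((W.closed_pull i).le hwI).shift (-1) fun w hw => by omega
  have hr := r.retract
  rw [hv, Category.assoc, hom_eq_zero_of_LE W (.pt p) (h₂.shift (-1) 0 (by omega)) hw hL
    ((W.closed_upper i).ge hwK) (by omega) (_ ≫ r.r), comp_zero] at hr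
  exact (IsZero.iff_id_eq_zero _).2 hr.symm

include W e in
/-- A pure mixed motive `Q` such that the motives `i^* Q` are concentrated in degrees `< 0` embeds
into `j_* j^* Q`, where `j` is the complement of the closed point `i`. As `i^! j_* = 0`, the motive
`i^! Q` is `i^! C[-1]` for the cokernel `C`. -/
lemma upper_GE_of_pure {Q : D.DM (op U)} (hQ : D.IsMixed Q) {a : ℤ} (hw₁ : D.Weights Q (a ≤ ·))
    (hw₂ : D.Weights Q (· ≤ a)) (h : ∀ (p : IsDedekindDomain.HeightOneSpectrum (𝓞 F))
      (i : pt p ⟶ op U), D.LE ((D.pull i).obj Q) (-1))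
    {p : IsDedekindDomain.HeightOneSpectrum (𝓞 F)} (i : pt p ⟶ op U) :
    D.GE ((D.upper i).obj Q) 1 := by
  obtain ⟨j, -⟩ := exists_isOpenComplement i
  let J := (D.push j).obj ((D.pull j).obj Q)
  have hpull : D.IsMixed ((D.pull j).obj Q) :=
    ⟨by simpa using (A.open_pull j _ _).2 hQ.1, by simpa using (A.open_pull j _ _).1 hQ.2⟩
  have hJ : D.IsMixed J :=
    ⟨by simpa using (A.open_push j _ _).2 hpull.1, by simpa using (A.open_push j _ _).1 hpull.2⟩
  have hV : genPoint F ∈ U ⊓ compl {p} := ⟨genPoint_mem_of_hom e, genPoint_mem_compl _⟩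
  obtain ⟨K, I, C, k, q, m, c, δ, δ', mK, mI, mC, hT, hT', hu, hzK, -, -, -, hwI, hwK⟩ :=
    A.exists_image W e hQ hJ ((D.adj j).unit.app Q) (isIso_generic_unit e j hV Q)
  have hK := A.isZero_of_pure W e mK hT hzK (hwK a hw₁) (hwI a hw₂) h
  have := isIso₂_of_isZero₁ hT hK
  obtain ⟨ε, h₁⟩ := map_distinguished (D.upper i) hT'
  have hz : IsZero ((D.upper i).obj J) :=
    isZero_upper_push_pt i j (fun h => point_mem_compl.1 h.2 (by simp)) _
  exact (GE.obj₁ h₁ (GE.of_isZero hz) (A.upper_GE i mC.2)).of_iso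
    ((D.upper i).mapIso (asIso q).symm)

end TStructureAxioms

section Orthogonal
variable {C E : Type*} [Category* C] [Preadditive C] [Category* E] [Preadditive E]

/-- If two additive functors take isomorphic values on a finite direct sum, and there are no
morphisms between the values on different summands, then they take isomorphic values on the
summands. -/
lemma nonempty_iso_of_orthogonal {G H : C ⥤ E} [G.Additive] [H.Additive] {J : Type*}
    {M : C} {A : J → C} (s : ∀ j, A j ⟶ M) (π : ∀ j, M ⟶ A j) (t : Finset J)
    (h₁ : ∀ j, s j ≫ π j = 𝟙 _) (hid : ∑ j ∈ t, π j ≫ s j = 𝟙 M) (θ : G.obj M ≅ H.obj M)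
    (h : ∀ j k, j ≠ k → ∀ f : G.obj (A j) ⟶ H.obj (A k), f = 0)
    (h' : ∀ j k, j ≠ k → ∀ f : H.obj (A j) ⟶ G.obj (A k), f = 0) (j : J) (hj : j ∈ t) :
    Nonempty (G.obj (A j) ≅ H.obj (A j)) := by
  have key : ∀ {G H : C ⥤ E} [G.Additive] [H.Additive] (θ : G.obj M ≅ H.obj M),
      (∀ j k, j ≠ k → ∀ f : G.obj (A j) ⟶ H.obj (A k), f = 0) →
      (G.map (s j) ≫ θ.hom ≫ H.map (π j)) ≫ H.map (s j) ≫ θ.inv ≫ G.map (π j) = 𝟙 _ := by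
    intro G H _ _ θ h
    have e : G.map (s j) ≫ θ.hom = (G.map (s j) ≫ θ.hom ≫ H.map (π j)) ≫ H.map (s j) := by
      have e := congrArg (fun f => G.map (s j) ≫ θ.hom ≫ H.map f) hid
      rw [Functor.map_sum, Preadditive.comp_sum, Preadditive.comp_sum,
        Finset.sum_eq_single_of_mem j hj, CategoryTheory.Functor.map_id] at e
      · simpa using e.symm
      · intro k _ hk
        have := h j k hk.symm (G.map (s j) ≫ θ.hom ≫ H.map (π k))
        rw [Functor.map_comp]
        simp only [← Category.assoc] at this ⊢
        rw [this, zero_comp]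
    rw [← Category.assoc, ← e]
    simp [← Functor.map_comp, h₁]
  exact ⟨⟨_, _, key θ h, key θ.symm h'⟩⟩

end Orthogonal

/-! ### Smoothness of the cohomology motives -/

section Conjugation
variable {C : Type*} [Category* C] {X Y Z : C} (c : X ≅ Y) (s : X ⟶ Z) (p : Z ⟶ X)

lemma conjugate_comp (h : s ≫ p = 𝟙 X) : (c.inv ≫ s) ≫ p ≫ c.hom = 𝟙 Y := by
  simp [reassoc_of% h]

lemma comp_conjugate : (p ≫ c.hom) ≫ c.inv ≫ s = p ≫ s := by simp

end Conjugation

namespace TStructureAxioms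
open Sch TStructuresAndWeights TriangulatedMotives ZeroObject
variable {F : Type} [Field F] [NumberField F] {D : TStructuresAndWeights.{v, u} F}
  (A : TStructureAxioms D)
include A

/-- Over a closed point, there are no morphisms between motives concentrated in different
degrees. -/
lemma hom_pt_eq_zero_of_ne {p : IsDedekindDomain.HeightOneSpectrum (𝓞 F)} {M N : D.DM (pt p)}
    {a b : ℤ} (hM : D.LE M a ∧ D.GE M a) (hN : D.LE N b ∧ D.GE N b) (hab : a ≠ b) (f : M ⟶ N) :
    f = 0 := by
  rcases lt_or_gt_of_ne hab with h | h
  · exact hom_eq_zero hM.1 hN.2 h f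
  · apply (shiftFunctor (D.DM (pt p)) a).map_injective
    rw [Functor.map_zero]
    exact A.hom_pt_eq_zero ⟨hM.1.shift a 0 (by omega), hM.2.shift a 0 (by omega)⟩
      ((hN.1.shift a (b - a) (by omega)).mono (by omega)) _

/-- A decomposition of the motive of a smooth projective scheme, with finitely many summands. -/
lemma exists_decomposition {U : (specO F).Opens} {X : Sch F} (f : X ⟶ op U) [Smooth (mor f)]
    (hf : IsProjectiveHom (mor f)) (m : ℤ) :
    ∃ (s : ∀ k : ℤ, (D.h f k 0).obj.obj⟦-k⟧ ⟶ (D.gm f 0).obj)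
      (π : ∀ k : ℤ, (D.gm f 0).obj ⟶ (D.h f k 0).obj.obj⟦-k⟧) (t : Finset ℤ), m ∈ t ∧
      (∀ k, s k ≫ π k = 𝟙 _) ∧ ∑ k ∈ t, π k ≫ s k = 𝟙 _ ∧
      ∀ (p : IsDedekindDomain.HeightOneSpectrum (𝓞 F)) (i : pt p ⟶ op U) (k : ℤ),
        D.LE ((D.pull i).obj (D.h f k 0).obj.obj) (-1) ∧
        D.GE ((D.pull i).obj (D.h f k 0).obj.obj) (-1) := by
  obtain ⟨s, ⟨hs⟩, hfib⟩ := A.decomposition_fibres f hf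
  let M := D.gm f 0
  let C : ∀ k : ℤ, ((D.h f k 0).obj⟦-k⟧).obj ≅ (D.h f k 0).obj.obj⟦-k⟧ := fun k =>
    ((compactObjects (D.DM (op U))).ι.commShiftIso (-k)).app (D.h f k 0).obj
  let π : ∀ k, M ⟶ (D.pH M k).obj⟦-k⟧ := fun k => Cofan.IsColimit.desc hs fun l =>
    if h : l = k then eqToHom (by rw [h]) else 0
  have hπ : ∀ l k, s l ≫ π k = if h : l = k then eqToHom (by rw [h]) else 0 := fun l k =>
    Cofan.IsColimit.fac hs _ l
  -- the cohomology vanishes outside of `[a, b]`, so that the sum over `t` is the identity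
  obtain ⟨a, b, ha, hb⟩ := A.exists_bounds (.op U) M.property
  let t := Finset.Icc (min a m) (max b m)
  have hz : ∀ k ∉ t, s k = 0 := fun k hk => by
    have h : D.IsCohomology M.obj k 0 := by
      rw [Finset.mem_Icc] at hk
      by_cases h : k < a
      · exact IsCohomology.of_ge (ha.anti (by omega))
      · exact IsCohomology.of_le (hb.mono (by omega))
    obtain ⟨e⟩ := (isCohomology_pH M k).unique h (Iso.refl _)
    have : IsZero ((D.pH M k).obj⟦-k⟧).obj :=
      (((shiftFunctor (D.DM (op U)) (-k)).map_isZero (isZero_zero _)).of_iso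
        ((shiftFunctor _ (-k)).mapIso e)).of_iso (C k)
    exact ObjectProperty.hom_ext _ (this.eq_of_src _ _)
  have hid : ∑ k ∈ t, π k ≫ s k = 𝟙 M := by
    refine Cofan.IsColimit.hom_ext hs _ _ fun k => ?_
    change s k ≫ _ = s k ≫ _
    by_cases hk : k ∈ t
    · rw [Preadditive.comp_sum, Finset.sum_eq_single_of_mem k hk, ← Category.assoc, hπ]
      · rw [dif_pos rfl]
        exact (Category.id_comp _).trans (Category.comp_id _).symm
      · intro l _ hl
        rw [← Category.assoc, hπ, dif_neg hl.symm, zero_comp]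
    · rw [hz k hk, zero_comp, zero_comp]
  refine ⟨fun k => (C k).inv ≫ (s k).hom, fun k => (π k).hom ≫ (C k).hom, t,
    Finset.mem_Icc.2 (by omega), fun k => ?_, ?_, fun p i k => ?_⟩
  · have h : s k ≫ π k = 𝟙 _ := (hπ k k).trans (by simp)
    exact conjugate_comp (C k) (s k).hom (π k).hom (congrArg (fun f => f.hom) h)
  · have h := congrArg ((compactObjects (D.DM (op U))).ι.map) hid
    rw [Functor.map_sum] at h
    exact Eq.trans (Finset.sum_congr rfl fun k _ => comp_conjugate (C k) (s k).hom (π k).hom) h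
  -- the summand of the fibre corresponding to `h^k` is `h^{k-1}` of the fibre, in degree `k - 1`
  · have := hf.isProper
    obtain ⟨Z, c, g, w, hc⟩ := exists_cartesian f i
    have hg : IsProjectiveHom (mor g) := .of_isPullback hc hf
    have : LocallyOfFiniteType (mor g) := hg.isProper.toLocallyOfFiniteType
    obtain ⟨s', -, h'⟩ := hfib p i Z c g w hc
    obtain ⟨ψ, -⟩ := h' k
    let e : (D.h g (k - 1) 0).obj.obj⟦-(k - 1)⟧ ≅ ((D.pull i).obj (D.h f k 0).obj.obj)⟦-k⟧ :=
      (((compactObjects (D.DM (pt p))).ι.commShiftIso (-(k - 1))).app (D.h g (k - 1) 0).obj).symm ≪≫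
        ψ.symm ≪≫ (D.pull i).mapIso (C k) ≪≫ ((D.pull i).commShiftIso (-k)).app _
    have h₀ := isMixed_obj (D.h g (k - 1) 0)
    exact ⟨LE.of_shift (-k) (k - 1) ((h₀.1.shift _ _ (by omega)).of_iso e) (by omega),
      GE.of_shift (-k) (k - 1) ((h₀.2.shift _ _ (by omega)).of_iso e) (by omega)⟩

end TStructureAxioms

namespace MixedMotives
open Sch TStructuresAndWeights TriangulatedMotives TStructureAxioms InverseImages
variable {F : Type} [Field F] [NumberField F] {ℓ : ℕ} [Fact ℓ.Prime] (D : MixedMotives.{v, u} F ℓ)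

section Smooth
variable {U : (specO F).Opens} (e : gen F ⟶ op U) {X : Sch F} (f : X ⟶ op U) [Smooth (mor f)]
  (hf : IsProjectiveHom (mor f))
include e hf

/-- The cohomology motives of a smooth projective scheme over an open subscheme of `Spec 𝓞 F` are
smooth, because both sides of the purity isomorphism for its motive are compatible with the
decomposition. -/
lemma isSmoothMotive_h_zero (m : ℤ) : D.IsSmoothMotive (D.h f m 0).obj.obj := fun p i => by
  obtain ⟨s, π, t, hm, h₁, hid, hfib⟩ := D.tAxioms.exists_decomposition f hf m
  obtain ⟨θ⟩ := (D.isSmoothMotive_mot f hf).twist 0 p i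
  -- both `G` and `H` take the summand `h^k[-k]` of the motive to a motive in degree `k + 1`, so
  -- that different summands are orthogonal
  let G := D.upper i
  let H := D.pull i ⋙ D.purityShift (pt p)
  let Q : ℤ → D.DM (op U) := fun k => (D.h f k 0).obj.obj
  have hQ : ∀ k, D.IsMixed (Q k) := fun k => isMixed_obj _
  have hw₁ := weights_iff.1 (D.wAxioms.weights_mot_le D.tAxioms (.op U) f hf 0)
  have hw₂ := weights_iff.1 (D.weights_mot_ge f hf 0)
  have hG₀ : ∀ k, D.GE (G.obj (Q k)) 1 := fun k =>
    D.tAxioms.upper_GE_of_pure D.wAxioms e (hQ k) (a := k)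
      ((D.wAxioms.weights_isMixed_iff (.op U) (hQ k)).2 fun w hw => by
        have := hw₂.2 k (D.h f k 0) (isCohomology_pH (D.gm f 0) k) w hw
        omega)
      ((D.wAxioms.weights_isMixed_iff (.op U) (hQ k)).2 fun w hw => by
        have := hw₁.2 k (D.h f k 0) (isCohomology_pH (D.gm f 0) k) w hw
        omega)
      (fun q j => (hfib q j k).1) i
  let cG : ∀ k, G.obj ((Q k)⟦-k⟧) ≅ (G.obj (Q k))⟦-k⟧ := fun k => (G.commShiftIso (-k)).app (Q k)
  let cH : ∀ k, H.obj ((Q k)⟦-k⟧) ≅ (H.obj (Q k))⟦-k⟧ := fun k =>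
    (D.purityShift (pt p)).mapIso (((D.pull i).commShiftIso (-k)).app (Q k)) ≪≫
      (shiftFunctor _ (-2 : ℤ)).mapIso (((D.twist (pt p) (-1)).commShiftIso (-k)).app _) ≪≫
      shiftComm _ (-k) (-2 : ℤ)
  have hG : ∀ k, D.LE (G.obj ((Q k)⟦-k⟧)) (k + 1) ∧ D.GE (G.obj ((Q k)⟦-k⟧)) (k + 1) := fun k =>
    ⟨(LE.shift (n := 1) ((D.tAxioms.closed_upper i _ 0).2 (hQ k).1) (-k) (k + 1)
      (by omega)).of_iso (cG k).symm,
      ((hG₀ k).shift (-k) (k + 1) (by omega)).of_iso (cG k).symm⟩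
  have hT := D.tAxioms.amplitude_twist D.wAxioms (.pt p) (-1)
  have hH : ∀ k, D.LE (H.obj ((Q k)⟦-k⟧)) (k + 1) ∧ D.GE (H.obj ((Q k)⟦-k⟧)) (k + 1) := fun k =>
    ⟨((LE.shift (n := -1) ((hT _ (-1)).2 (hfib p i k).1) (-2) 1 (by omega)).shift (-k) (k + 1)
      (by omega)).of_iso (cH k).symm,
      ((GE.shift (n := -1) ((hT _ (-1)).1 (hfib p i k).2) (-2) 1 (by omega)).shift (-k) (k + 1)
      (by omega)).of_iso (cH k).symm⟩
  obtain ⟨φ⟩ := nonempty_iso_of_orthogonal (G := G) (H := H) s π t h₁ hid θ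
    (fun j k hjk => D.tAxioms.hom_pt_eq_zero_of_ne (hG j) (hH k) (by omega))
    (fun j k hjk => D.tAxioms.hom_pt_eq_zero_of_ne (hH j) (hG k) (by omega)) m hm
  exact ⟨(shiftFunctor (D.DM (pt p)) (-m)).preimageIso ((cG m).symm ≪≫ φ ≪≫ cH m)⟩

/-- Twists of smooth motives are smooth, and twists are exact. -/
lemma isSmoothMotive_h (m n : ℤ) : D.IsSmoothMotive (D.h f m n).obj.obj := by
  have h := (isCohomology_pH (D.gm f 0) m).map (D.twist (op U) n)
    (D.tAxioms.amplitude_twist D.wAxioms (.op U) n) m (by omega)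
  obtain ⟨φ⟩ := h.unique (isCohomology_pH (D.gm f n) m)
    ((D.twist (op U) n).mapIso (D.twistZero (op U) _))
  exact ((D.isSmoothMotive_h_zero e f hf m).twist n).of_iso
    ((shiftFunctorZero (D.DM (op U)) ℤ).symm.app _ ≪≫ φ)

end Smooth

variable {Y : Sch F} (y : Y ⟶ gen F) [Smooth (mor y)] (hy : IsProjectiveHom (mor y)) (i n : ℤ)
include hy

/-- The motive `h^{i-1}(Y, n)[1]` extends to a smooth mixed motive over a nonempty open subscheme,
with weights at least `i - 2n`. -/
lemma exists_smooth_extension : ∃ (U : (specO F).Opens) (_ : U ≠ ⊥) (e : gen F ⟶ op U)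
    (Q : D.DM (op U)), D.IsMixed Q ∧ D.IsSmoothMotive Q ∧ D.Weights Q (i - 2 * n ≤ ·) ∧
      Nonempty ((D.pull e).obj Q ≅ D.hShift y i n) := by
  obtain ⟨m⟩ := exists_projectiveModel y hy
  obtain ⟨U, hU, e, X, f, a, hs, hf, w, hc⟩ := m.exists_smooth
  let Q := D.h f i n
  have h := ((isCohomology_pH (D.gm f n) i).map (D.pull e) (D.tAxioms.generic_pull e) (i - 1)
    (by omega)).unique (isCohomology_pH (D.gm y n) (i - 1)) (D.gmBaseChange w hc hf hy n)
  refine ⟨U, hU, e, Q.obj.obj, isMixed_obj Q, D.isSmoothMotive_h e f hf i n,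
    (D.wAxioms.weights_isMixed_iff (.op U) (isMixed_obj Q)).2 fun w hw => ?_, h.map fun φ =>
      (shiftFunctorCompIsoId (D.DM (gen F)) (-1) 1 (by omega)).symm.app _ ≪≫
        (shiftFunctor _ (1 : ℤ)).mapIso φ⟩
  have := (weights_iff.1 (D.weights_mot_ge f hf n)).2 i Q (isCohomology_pH (D.gm f n) i) w hw
  omega

/-- The motive `h^{i-1}(Y, n)[1]` extends to a mixed motive over `Spec 𝓞 F` that is smooth over a
nonempty open subscheme and has weights at least `i - 2n`. -/
lemma exists_extension : ∃ (U : (specO F).Opens) (_ : U ≠ ⊥) (_ : gen F ⟶ op U)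
    (j : op U ⟶ top F) (Q : D.DM (top F)), D.IsMixed Q ∧ D.IsSmoothMotive ((D.pull j).obj Q) ∧
      D.Weights Q (i - 2 * n ≤ ·) ∧
      Nonempty ((D.pull (gen F).struct).obj Q ≅ D.hShift y i n) := by
  obtain ⟨U, hU, e, Q, hQ, hQs, hw, ⟨φ⟩⟩ := D.exists_smooth_extension y hy i n
  obtain ⟨j⟩ := exists_op (le_top : U ≤ ⊤)
  have := D.open_counit j inferInstance
  let c := asIso ((D.adj j).counit.app Q)
  exact ⟨U, hU, e, j, (D.push j).obj Q, D.isMixed_of_amplitude (D.tAxioms.open_push j) hQ,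
    hQs.of_iso c.symm, (D.wAxioms.open_push j).ge hw,
    ⟨(D.pullComp (op_top_hom_ext (e ≫ j) _)).symm.app _ ≪≫ (D.pull e).mapIso c ≪≫ φ⟩⟩

lemma nonempty_genericIntermediateExtension :
    Nonempty (D.GenericIntermediateExtension (D.hShift y i n)) := by
  obtain ⟨U, hU, e, j, Q, hQ, hQs, -, ⟨φ⟩⟩ := D.exists_extension y hy i n
  let _ := (D.t (top F)).heartAbelian
  exact ⟨⟨Q, hQ, φ, U, hU, j, e, hQs, ⟨Image.monoFactorisation _, Image.isImage _⟩⟩⟩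

end MixedMotives

/-! ### Chow groups and vanishing above degree `2n` -/

/-- Two maps `A → B` and `W → B`, of which the second is bijective, combine with an injection of `W`
into `E` to an isomorphism of `A` onto a submodule of `E`. -/
lemma exists_linearEquiv_of_zigzag {R A B W E : Type*} [CommRing R] [AddCommGroup A]
    [AddCommGroup B] [AddCommGroup W] [AddCommGroup E] [Module R A] [Module R B] [Module R W]
    [Module R E] {r : A →ₗ[R] B} {p : W →ₗ[R] B} {t : W →ₗ[R] E} (hr : Function.Injective r)
    (hp : Function.Bijective p) (ht : Function.Injective t) {P : Submodule R E}
    (hP : P = ((LinearMap.range r).comap p).map t) :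
    ∃ Φ : A ≃ₗ[R] P, ∀ x, ∃ w, p w = r x ∧ t w = Φ x := by
  let p' := LinearEquiv.ofBijective p hp
  have hp' : ∀ b, p (p'.symm b) = b := p'.apply_symm_apply
  let L : A →ₗ[R] E := t ∘ₗ p'.symm.toLinearMap ∘ₗ r
  have hL : LinearMap.range L = P := by
    rw [hP]
    ext z
    constructor
    · rintro ⟨x, rfl⟩
      exact ⟨p'.symm (r x), ⟨x, (hp' _).symm⟩, rfl⟩
    · rintro ⟨w, ⟨x, hx⟩, rfl⟩
      exact ⟨x, congrArg t (hp.1 ((hp' _).trans hx))⟩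
  exact ⟨(LinearEquiv.ofInjective L (ht.comp (p'.symm.injective.comp hr))).trans
    (LinearEquiv.ofEq _ _ hL), fun x => ⟨p'.symm (r x), hp' _, rfl⟩⟩

namespace InverseImages
variable {F : Type} [Field F] [NumberField F] {D : InverseImages.{v, u} F} {X Y : Sch F}
open Functor.LaxMonoidal

/-- If the operation `x ↦ f^* x ≫ φ` on morphisms to `A` is injective, then so are the maps that `φ`
induces on cohomology. -/
lemma pullH_injective (f : X ⟶ Y) {A : D.DM Y} {N : D.DM X} (φ : (D.pull f).obj A ⟶ N)
    (h : ∀ (T : D.DM Y) (x : T ⟶ A), (D.pull f).map x ≫ φ = 0 → x = 0) (k : ℤ) :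
    Function.Injective (D.pullH f φ k) := by
  rw [injective_iff_map_eq_zero]
  intro x hx
  have hx' : (D.pull f).map x ≫ ((D.pull f).commShiftIso k).hom.app A ≫ φ⟦k⟧' = 0 := by
    rw [← cancel_epi (Functor.Monoidal.εIso (D.pull f)).hom, comp_zero]
    exact hx
  have h₀ : x⟦-k⟧' ≫ (shiftFunctorCompIsoId (D.DM Y) k (-k) (by omega)).hom.app A = 0 := by
    refine h _ _ ?_
    have hn := ((D.pull f).commShiftIso (-k)).hom.naturality x
    have hφ := (shiftFunctorCompIsoId (D.DM X) k (-k) (by omega)).hom.naturality φ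
    have hs := congrArg (fun g => g⟦-k⟧') hx'
    dsimp at hn hφ hs
    simp only [Functor.map_comp, Functor.map_zero] at hs
    rw [Functor.map_comp, Functor.map_shiftFunctorCompIsoId_hom_app]
    simp only [Category.assoc]
    rw [reassoc_of% hn, ← hφ, reassoc_of% hs, zero_comp, comp_zero]
  rw [Preadditive.IsIso.comp_right_eq_zero] at h₀
  exact (shiftFunctor (D.DM Y) (-k)).map_injective (h₀.trans (Functor.map_zero _ _ _).symm)

end InverseImages

namespace MixedMotives
open Sch TStructuresAndWeights TriangulatedMotives TStructureAxioms InverseImages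
variable {F : Type} [Field F] [NumberField F] {ℓ : ℕ} [Fact ℓ.Prime] (D : MixedMotives.{v, u} F ℓ)

/-- The comparison of `H^k(S, M(X)(n))` with `H^k(X, 1(n))` is injective by the projection formula
for twists. -/
lemma toUnitH_injective {X S : Sch F} (f : X ⟶ S) (n k : ℤ) :
    Function.Injective (D.toUnitH f n k) := by
  refine pullH_injective f _ (fun T x hx => eq_zero_of_map_pullTwist_counit _ f n x ?_) k
  let α := (D.twist X n).mapIso (Functor.Monoidal.εIso (D.pull f)).symm ≪≫ λ_ _
  rw [← cancel_mono α.hom, zero_comp, ← hx]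
  change _ = _ ≫ _ ≫ (D.twist X n).map (_ ≫ (Functor.Monoidal.εIso (D.pull f)).inv) ≫ _
  rw [Functor.map_comp]
  simp only [Category.assoc]
  rfl

lemma ofGm_bijective {S : Sch F} (M : D.Gm S) (k : ℤ) : Function.Bijective (D.ofGm M k) := by
  let c := ((compactObjects (D.DM S)).ι.commShiftIso k).app M
  refine ⟨fun a b h => ObjectProperty.hom_ext _ ((cancel_mono c.hom).1 h),
    fun x => ⟨ObjectProperty.homMk (x ≫ c.inv), ?_⟩⟩
  exact (Category.assoc _ _ _).trans ((congrArg (x ≫ ·) c.inv_hom_id).trans (Category.comp_id _))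

variable {Y : Sch F} (y : Y ⟶ gen F) [Smooth (mor y)]

/-- The motivic cohomology of `Y` over `F` vanishes above degree `2n`. -/
lemma eq_zero_of_two_mul_lt {i n : ℤ} (hi : 2 * n < i) (x : D.H ((D.twist _ n).obj (D.mot y)) i) :
    x = 0 :=
  D.toUnitH_injective y n i ((D.vanishing y inferInstance n i hi _).trans (map_zero _).symm)

variable (hy : IsProjectiveHom (mor y)) (n : ℤ)
include hy

/-- A class in `H^{2n}(Y, n)` is homologically trivial if and only if it comes from
`H^{2n}(τ_{≤ 2n-1} M(Y)(n))`. -/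
lemma map_ofGm_ker : (LinearMap.ker (D.real.mapLinearMap ℚ)).map (D.ofGm (D.gm y n) (2 * n)) =
    LinearMap.range (D.truncMap y (2 * n) n) := by
  have hn : ∀ b, D.truncMap y (2 * n) n (D.ofGm _ (2 * n) b) =
      D.ofGm (D.gm y n) (2 * n) (b ≫ (((D.t _).truncLEι (2 * n - 1)).app _)⟦2 * n⟧') := fun b => by
    have h := ((compactObjects (D.DM (gen F))).ι.commShiftIso (2 * n)).hom.naturality
      (((D.t _).truncLEι (2 * n - 1)).app (D.gm y n))
    exact (Category.assoc _ _ _).trans ((congrArg (b.hom ≫ ·) h.symm).trans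
      (Category.assoc _ _ _).symm)
  ext x
  constructor
  · rintro ⟨a, ha, rfl⟩
    obtain ⟨b, rfl⟩ := (D.chow_hom y hy n a).2 ha
    exact ⟨_, hn b⟩
  · rintro ⟨w, rfl⟩
    obtain ⟨b, rfl⟩ := (D.ofGm_bijective _ _).2 w
    exact ⟨_, (D.chow_hom y hy n _).1 ⟨b, rfl⟩, (hn b).symm⟩

variable {n} in
/-- If `i = 2n`, then every class of degree `0` of `h^{i-1}(Y, n)[1]` extends. -/
lemma restrict_zero_surjective {i : ℤ} (hi : i = 2 * n)
    (e : D.GenericIntermediateExtension (D.hShift y i n)) :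
    Function.Surjective (e.restrict 0) := by
  obtain ⟨-, -, -, -, Q, hQ, -, hw, ⟨γ⟩⟩ := D.exists_extension y hy i n
  exact e.restrict_surjective hQ γ (hw.imp fun w h => by omega)

/-- The classes in `CH^n(Y)` that are homologically trivial, in terms of the edge map. -/
lemma chowHom_eq (e : D.GenericIntermediateExtension (D.hShift y (2 * n) n)) :
    D.chowHom y n = ((LinearMap.range (e.restrict 0)).comap (D.edgeMap y (2 * n) n)).map
      ((D.chow y inferInstance n).symm.toLinearMap ∘ₗ D.toUnitH y n (2 * n) ∘ₗ
        D.truncMap y (2 * n) n) := by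
  rw [LinearMap.range_eq_top.2 (D.restrict_zero_surjective y hy rfl e), Submodule.comap_top,
    Submodule.map_top, LinearMap.range_comp, LinearMap.range_comp, chowHom, D.map_ofGm_ker y hy n]
  exact Submodule.comap_equiv_eq_map_symm _ _

end MixedMotives

end

theorem mainTheorem2 {F : Type} [Field F] [NumberField F] {ℓ : ℕ} [Fact ℓ.Prime]
    (D : MixedMotives.{v, u} F ℓ) {Y : Sch F} (y : Y ⟶ Sch.gen F) [Smooth (Sch.mor y)]
    (hy : IsProjectiveHom (Sch.mor y)) (n : ℤ) :
    Nonempty (MixedMotives.ProjectiveModel y) ∧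
    (∀ i : ℤ, Nonempty (D.GenericIntermediateExtension ((D.h y (i - 1) n).obj.obj⟦(1 : ℤ)⟧))) ∧
    (∀ i : ℤ, i ≠ 2 * n → ∀ m m' : MixedMotives.ProjectiveModel y,
      D.integralH m i n = D.integralH m' i n) ∧
    (∀ i : ℤ, i < 2 * n → ∀ m : MixedMotives.ProjectiveModel y,
      ∀ e : D.GenericIntermediateExtension ((D.h y (i - 1) n).obj.obj⟦(1 : ℤ)⟧),
      ∃ Φ : D.H e.obj 0 ≃ₗ[ℚ] D.integralH m i n, ∀ x, ∃ w,
        D.edgeMap y i n w = e.restrict 0 x ∧ D.truncMap y i n w = Φ x) ∧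
    (∀ e : D.GenericIntermediateExtension ((D.h y (2 * n - 1) n).obj.obj⟦(1 : ℤ)⟧),
      ∃ Φ : D.H e.obj 0 ≃ₗ[ℚ] D.chowHom y n, ∀ x, ∃ w,
        D.edgeMap y (2 * n) n w = e.restrict 0 x ∧
        D.toUnitH y n (2 * n) (D.truncMap y (2 * n) n w) = D.chow y inferInstance n (Φ x)) ∧
    (∀ (i : ℤ) (e : D.GenericIntermediateExtension ((D.h y (i - 1) n).obj.obj⟦(1 : ℤ)⟧)),
      ∃ Ψ : D.H e.obj (-1) ≃ₗ[ℚ] D.H (D.h y (i - 1) n).obj.obj 0,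
        ∀ x, Ψ x = D.unshiftH _ (e.restrict (-1) x)) := by
  refine ⟨exists_projectiveModel y hy,
    fun i => D.nonempty_genericIntermediateExtension y hy i n, fun i hi m m' => ?_,
    fun i hi m e => ?_, fun e => ?_, fun i e => ?_⟩
  · obtain hi | hi := hi.lt_or_gt
    · obtain ⟨e⟩ := D.nonempty_genericIntermediateExtension y hy i n
      rw [D.integralH_eq hy hi m e, D.integralH_eq hy hi m' e]
    · have h := D.eq_zero_of_two_mul_lt y hi
      ext x
      rw [h x]
      simp only [Submodule.zero_mem]
  · exact exists_linearEquiv_of_zigzag (e.restrict_injective le_rfl) (D.edgeMap_bijective y i n)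
      (D.truncMap_injective y i n) (D.integralH_eq hy hi m e)
  · obtain ⟨Φ, hΦ⟩ := exists_linearEquiv_of_zigzag (e.restrict_injective le_rfl)
      (D.edgeMap_bijective y (2 * n) n) ((D.chow y inferInstance n).symm.injective.comp
        ((D.toUnitH_injective y n (2 * n)).comp (D.truncMap_injective y (2 * n) n)))
      (D.chowHom_eq y hy n e)
    refine ⟨Φ, fun x => ?_⟩
    obtain ⟨w, h₁, h₂⟩ := hΦ x
    exact ⟨w, h₁, (LinearEquiv.symm_apply_eq _).1 h₂⟩
  · exact ⟨(LinearEquiv.ofBijective _ e.restrict_bijective).trans (D.unshiftH _), fun x => rfl⟩
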